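/- Let $n\ge 2$, and let $M_{n+1}$ be a smooth, time-oriented $(n+1)$-dimensional Lorentzian manifold with metric $g$ of signature $(-,+,\dots,+)$ that satisfies the Einstein equations $R_{\mu\nu}-\frac12 R\,g_{\mu\nu}=8\pi G\,(T_{\mu\nu}-\Lambda g_{\mu\nu})$ with $G>0$, a positive cosmological constant $\Lambda>0$, and a matter stress-energy tensor $T_{\mu\nu}$ that satisfies the strong energy condition: $\bigl(T_{\mu\nu}-\frac{1}{n-1}g_{\mu\nu}T\bigr)k^\mu k^\nu\ge 0$ for every future-directed timelike vector $k^\mu$, where $T=g^{\alpha\beta}T_{\alpha\beta}$. Put $K_\Lambda=\sqrt{\frac{n}{n-1}\,16\pi G\Lambda}>0$. Let $\lambda_1\le\lambda_2$, and let $M_\lambda$, $\lambda\in[\lambda_1,\lambda_2]$, be smooth compact spacelike hypersurfaces in $M_{n+1}$ that move by mean curvature flow. That is, there are a compact smooth $n$-manifold $M$ (without boundary) and a smooth map $y:M\times[\lambda_1,\lambda_2]\to M_{n+1}$ such that each $y(\cdot,\lambda)$ is a spacelike immersion with image $M_\lambda$ and $\partial_\lambda y=K\,n^\mu$. Here $n^\mu$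 is the future-directed unit normal of $M_\lambda$, and $K(x,\lambda)$ is its mean curvature, the trace with respect to the induced metric of the extrinsic curvature $K_{\mu\nu}=h_\mu{}^\alpha\nabla_\alpha n_\nu$, where $h_{\mu\nu}=g_{\mu\nu}+n_\mu n_\nu$ (so that $K>0$ means expansion). Suppose that $K(x,\lambda)>K_\Lambda$ for some $x\in M$ and some $\lambda\in[\lambda_1,\lambda_2]$. Then, for each $\lambda\in[\lambda_1,\lambda_2]$, the maximum $K_m(\lambda)=\max_{x\in M}K(x,\lambda)$ exists, and $$K_m(\lambda_2)\le K_\Lambda+e^{-\frac2n K_\Lambda^2(\lambda_2-\lambda_1)}\,\bigl(K_m(\lambda_1)-K_\Lambda\bigr).$$ -/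

import Mathlib

open scoped Manifold ContDiff Topology
open Set

noncomputable section

namespace LorentzMCF

/-- The trace `g^{ij} B_{ij}` of a bilinear form `B` on `ℝᵐ` with respect to a nondegenerate
symmetric bilinear form `g`: the components `g^{ij}` are those of the inverse of the Gram matrix of
`g` in the standard basis (the value does not depend on the basis). Every tangent space of an
`m`-dimensional manifold is a copy of `ℝᵐ`, so this applies to bilinear forms on tangent spaces. -/
def metricTrace {m : ℕ}
    (g B : EuclideanSpace ℝ (Fin m) → EuclideanSpace ℝ (Fin m) → ℝ) : ℝ :=
  ∑ i, ∑ j,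
    (Matrix.of fun k l : Fin m =>
      g (EuclideanSpace.single k 1) (EuclideanSpace.single l 1))⁻¹ i j *
    B (EuclideanSpace.single i 1) (EuclideanSpace.single j 1)

section Geometry

variable {m : ℕ} {M : Type*} [TopologicalSpace M] [ChartedSpace (EuclideanSpace ℝ (Fin m)) M]

/-- A smooth Lorentzian metric, of signature `(-,+,…,+)`, on an `m`-dimensional manifold: at every
point there is a timelike vector on whose orthogonal complement the form is positive definite. -/
structure LorentzianMetric (m : ℕ) (M : Type*) [TopologicalSpace M]
    [ChartedSpace (EuclideanSpace ℝ (Fin m)) M] [IsManifold (𝓡 m) ∞ M] where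
  /-- the bilinear form on each tangent space -/
  val : ∀ p : M, TangentSpace (𝓡 m) p →L[ℝ] TangentSpace (𝓡 m) p →L[ℝ] ℝ
  symm : ∀ (p : M) (v w : TangentSpace (𝓡 m) p), val p v w = val p w v
  signature : ∀ p : M, ∃ v : TangentSpace (𝓡 m) p, val p v v < 0 ∧
    ∀ w : TangentSpace (𝓡 m) p, val p v w = 0 → w ≠ 0 → 0 < val p w w
  smooth : ContMDiff (𝓡 m)
    ((𝓡 m).prod 𝓘(ℝ, EuclideanSpace ℝ (Fin m) →L[ℝ] EuclideanSpace ℝ (Fin m) →L[ℝ] ℝ)) ∞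
    (fun p ↦ Bundle.TotalSpace.mk'
      (EuclideanSpace ℝ (Fin m) →L[ℝ] EuclideanSpace ℝ (Fin m) →L[ℝ] ℝ) p (val p))

/-- The coordinate vector field `∂ᵢ` of the chart `c`, at the point with coordinates `y`. -/
def coordVector (c : OpenPartialHomeomorph M (EuclideanSpace ℝ (Fin m)))
    (y : EuclideanSpace ℝ (Fin m)) (i : Fin m) : TangentSpace (𝓡 m) (c.symm y) :=
  mfderiv (𝓡 m) (𝓡 m) c.symm y (EuclideanSpace.single i (1 : ℝ) : EuclideanSpace ℝ (Fin m))

/-- The coordinates `(v¹, …, vᵐ)` in the chart `c` of a tangent vector `v` at `p`. -/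
def coords (c : OpenPartialHomeomorph M (EuclideanSpace ℝ (Fin m))) (p : M)
    (v : TangentSpace (𝓡 m) p) : EuclideanSpace ℝ (Fin m) :=
  mfderiv (𝓡 m) (𝓡 m) c p v

variable [IsManifold (𝓡 m) ∞ M] (g : LorentzianMetric m M)

/-- The matrix `(g_{ij})` of the metric in the chart `c`, as a function of the coordinates. -/
def metricMatrix (c : OpenPartialHomeomorph M (EuclideanSpace ℝ (Fin m)))
    (y : EuclideanSpace ℝ (Fin m)) : Matrix (Fin m) (Fin m) ℝ :=
  Matrix.of fun i j => g.val (c.symm y) (coordVector c y i) (coordVector c y j)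

/-- `∂ₖ f`, for a real function `f` of the coordinates. -/
def partialDeriv (k : Fin m) (f : EuclideanSpace ℝ (Fin m) → ℝ)
    (y : EuclideanSpace ℝ (Fin m)) : ℝ :=
  fderiv ℝ f y (EuclideanSpace.single k 1)

/-- The Christoffel symbols of the Levi-Civita connection in the chart `c`:
`Γᵏᵢⱼ = ½ ∑ₗ gᵏˡ (∂ᵢ gⱼₗ + ∂ⱼ gᵢₗ - ∂ₗ gᵢⱼ)`. -/
def christoffel (c : OpenPartialHomeomorph M (EuclideanSpace ℝ (Fin m)))
    (k i j : Fin m) (y : EuclideanSpace ℝ (Fin m)) : ℝ :=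
  (1 / 2) * ∑ l, (metricMatrix g c y)⁻¹ k l *
    (partialDeriv i (fun z => metricMatrix g c z j l) y
      + partialDeriv j (fun z => metricMatrix g c z i l) y
      - partialDeriv l (fun z => metricMatrix g c z i j) y)

/-- The components of the Ricci tensor in the chart `c`:
`Rᵢⱼ = ∂ₖ Γᵏᵢⱼ - ∂ⱼ Γᵏᵢₖ + Γᵏₖₗ Γˡᵢⱼ - Γᵏⱼₗ Γˡᵢₖ` (positive on round spheres). -/
def ricciComponent (c : OpenPartialHomeomorph M (EuclideanSpace ℝ (Fin m)))
    (i j : Fin m) (y : EuclideanSpace ℝ (Fin m)) : ℝ :=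
  ∑ k, (partialDeriv k (christoffel g c k i j) y - partialDeriv j (christoffel g c k i k) y)
    + ∑ k, ∑ l, (christoffel g c k k l y * christoffel g c l i j y
      - christoffel g c k j l y * christoffel g c l i k y)

/-- The Ricci tensor `R_{μν} v^μ w^ν` at the point `p`, computed in the preferred chart at `p`
(it is a tensor, so any other chart gives the same value). -/
def ricci (p : M) (v w : TangentSpace (𝓡 m) p) : ℝ :=
  let c := chartAt (EuclideanSpace ℝ (Fin m)) p
  ∑ i, ∑ j, ricciComponent g c i j (c p) * coords c p v i * coords c p w j

/-- The scalar curvature `R = g^{μν} R_{μν}`. -/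
def scalarCurvature (p : M) : ℝ :=
  metricTrace (fun v w => g.val p v w) (fun v w => ricci g p v w)

/-- The Einstein equations `R_{μν} - ½ R g_{μν} = 8πG (T_{μν} - Λ g_{μν})`, where `T` is the
stress-energy tensor of the matter. -/
def EinsteinEquations (G Λ : ℝ)
    (T : ∀ p : M, TangentSpace (𝓡 m) p →L[ℝ] TangentSpace (𝓡 m) p →L[ℝ] ℝ) : Prop :=
  ∀ (p : M) (v w : TangentSpace (𝓡 m) p),
    ricci g p v w - (1 / 2) * scalarCurvature g p * g.val p v w
      = 8 * Real.pi * G * (T p v w - Λ * g.val p v w)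

/-- A time orientation: a smooth everywhere timelike vector field, declared future-directed. -/
structure TimeOrientation where
  /-- the vector field -/
  field : ∀ p : M, TangentSpace (𝓡 m) p
  timelike : ∀ p : M, g.val p (field p) (field p) < 0
  smooth : ContMDiff (𝓡 m) (𝓡 m).tangent ∞ (fun p ↦ (⟨p, field p⟩ : TangentBundle (𝓡 m) M))

variable {g}

/-- `k` is a future-directed timelike vector. -/
def TimeOrientation.FutureTimelike (τ : TimeOrientation g) (p : M)
    (k : TangentSpace (𝓡 m) p) : Prop :=
  g.val p k k < 0 ∧ g.val p (τ.field p) k < 0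

/-- The strong energy condition in dimension `m = n + 1`:
`(T_{μν} - g_{μν} T / (n - 1)) k^μ k^ν ≥ 0` for all future-directed timelike `k`; note that
`n - 1 = m - 2`. -/
def StrongEnergyCondition (τ : TimeOrientation g)
    (T : ∀ p : M, TangentSpace (𝓡 m) p →L[ℝ] TangentSpace (𝓡 m) p →L[ℝ] ℝ) : Prop :=
  ∀ (p : M) (k : TangentSpace (𝓡 m) p), τ.FutureTimelike p k →
    0 ≤ T p k k -
      1 / ((m : ℝ) - 2) * metricTrace (fun v w => g.val p v w) (fun v w => T p v w) * g.val p k k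

section Hypersurface

variable {n : ℕ} {S : Type*} [TopologicalSpace S] [ChartedSpace (EuclideanSpace ℝ (Fin n)) S]

variable (g) in
/-- The Levi-Civita covariant derivative `∇_u V`, at `x`, of a vector field `V` along a map
`f : S → M`, in the direction `u ∈ T_x S`. Its coordinates in the preferred chart of `M` at `f x`
are `u(Vᵏ) + ∑ᵢⱼ Γᵏᵢⱼ (df u)ⁱ Vʲ`. -/
def covDerivAlong (f : S → M) (V : ∀ x : S, TangentSpace (𝓡 m) (f x)) (x : S)
    (u : TangentSpace (𝓡 n) x) : TangentSpace (𝓡 m) (f x) :=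
  let c := chartAt (EuclideanSpace ℝ (Fin m)) (f x)
  let Vc : S → EuclideanSpace ℝ (Fin m) := fun x' => coords c (f x') (V x')
  let dVc : EuclideanSpace ℝ (Fin m) := mfderiv (𝓡 n) (𝓡 m) Vc x u
  let dfu : EuclideanSpace ℝ (Fin m) := coords c (f x) (mfderiv (𝓡 n) (𝓡 m) f x u)
  ∑ k, (dVc k + ∑ i, ∑ j, christoffel g c k i j (c (f x)) * dfu i * Vc x j) •
    (mfderiv (𝓡 m) (𝓡 m) c (f x)).inverse
      (EuclideanSpace.single k (1 : ℝ) : EuclideanSpace ℝ (Fin m))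

variable (g) in
/-- The metric `h` induced on `S` by `f : S → M`. -/
def inducedMetric (f : S → M) (x : S) (u v : TangentSpace (𝓡 n) x) : ℝ :=
  g.val (f x) (mfderiv (𝓡 n) (𝓡 m) f x u) (mfderiv (𝓡 n) (𝓡 m) f x v)

variable (g) in
/-- The map `f : S → M` is spacelike at every point: its induced metric is positive definite. (In
particular a differentiable such map is an immersion.) -/
def IsSpacelike (n : ℕ) {S : Type*} [TopologicalSpace S]
    [ChartedSpace (EuclideanSpace ℝ (Fin n)) S] (f : S → M) : Prop :=
  ∀ (x : S) (u : TangentSpace (𝓡 n) x), u ≠ 0 → 0 < inducedMetric g f x u u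

/-- `ν` is the future-directed unit normal of the spacelike hypersurface `f : S → M`. -/
structure IsFutureUnitNormal (τ : TimeOrientation g) (n : ℕ) {S : Type*} [TopologicalSpace S]
    [ChartedSpace (EuclideanSpace ℝ (Fin n)) S] (f : S → M)
    (ν : ∀ x : S, TangentSpace (𝓡 m) (f x)) : Prop where
  unit : ∀ x : S, g.val (f x) (ν x) (ν x) = -1
  orthogonal : ∀ (x : S) (u : TangentSpace (𝓡 n) x),
    g.val (f x) (ν x) (mfderiv (𝓡 n) (𝓡 m) f x u) = 0
  future : ∀ x : S, τ.FutureTimelike (f x) (ν x)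

variable (g) in
/-- The extrinsic curvature `K(u, v) = g(∇_u ν, df v)` of the hypersurface `f : S → M` with normal
`ν`. -/
def extrinsicCurvature (f : S → M) (ν : ∀ x : S, TangentSpace (𝓡 m) (f x)) (x : S)
    (u v : TangentSpace (𝓡 n) x) : ℝ :=
  g.val (f x) (covDerivAlong g f ν x u) (mfderiv (𝓡 n) (𝓡 m) f x v)

variable (g) in
/-- The mean curvature: the trace of the extrinsic curvature with respect to the induced metric.
With the future-directed normal, it is positive where the hypersurface expands. -/
def meanCurvature (n : ℕ) {S : Type*} [TopologicalSpace S]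
    [ChartedSpace (EuclideanSpace ℝ (Fin n)) S] (f : S → M)
    (ν : ∀ x : S, TangentSpace (𝓡 m) (f x)) (x : S) : ℝ :=
  metricTrace (m := n) (fun u v => inducedMetric (n := n) g f x u v)
    (fun u v => extrinsicCurvature (n := n) g f ν x u v)

end Hypersurface

end Geometry

section Flow

variable {n : ℕ} {M : Type*} [TopologicalSpace M]
  [ChartedSpace (EuclideanSpace ℝ (Fin (n + 1))) M] [IsManifold (𝓡 (n + 1)) ∞ M]
  {g : LorentzianMetric (n + 1) M}
  {S : Type*} [TopologicalSpace S] [ChartedSpace (EuclideanSpace ℝ (Fin n)) S]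

/-- Mean curvature flow of smooth spacelike hypersurfaces `M_s = y(S, s)`, `a ≤ s ≤ b`, in the
spacetime `M`: `y` is smooth on `S × [a, b]`, each `y(·, s)` is spacelike with future-directed unit
normal `ν(·, s)`, and `∂y/∂s = K ν` (with a one-sided derivative at the end points). -/
structure IsMeanCurvatureFlow (τ : TimeOrientation g) (a b : ℝ) (y : S → ℝ → M)
    (ν : ∀ (x : S) (s : ℝ), TangentSpace (𝓡 (n + 1)) (y x s)) : Prop where
  smooth : ContMDiffOn ((𝓡 n).prod 𝓘(ℝ, ℝ)) (𝓡 (n + 1)) ∞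
    (fun z : S × ℝ => y z.1 z.2) (univ ×ˢ Icc a b)
  spacelike : ∀ s ∈ Icc a b, IsSpacelike g n (fun x => y x s)
  normal : ∀ s ∈ Icc a b, IsFutureUnitNormal τ n (fun x => y x s) (fun x => ν x s)
  flow : ∀ s ∈ Icc a b, ∀ x : S,
    HasMFDerivWithinAt 𝓘(ℝ, ℝ) (𝓡 (n + 1)) (fun s' : ℝ => y x s') (Icc a b) s
      (ContinuousLinearMap.toSpanSingleton ℝ
        (meanCurvature g n (fun x' => y x' s) (fun x' => ν x' s) x • ν x s))

end Flow

/-- The constant `K_Λ > 0` with `K_Λ² = (n / (n - 1)) 16πGΛ`. -/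
def cosmologicalK (n : ℕ) (G Λ : ℝ) : ℝ :=
  Real.sqrt ((n : ℝ) / ((n : ℝ) - 1) * (16 * Real.pi * G * Λ))

end LorentzMCF

end

/-! Write `κ` for `K_Λ`, `k` for the extrinsic curvature and `ν` for the unit normal. Under the
flow, `∂K/∂λ = ΔK - K (|k|² + Ric(ν, ν))`. At a spatial maximum `ΔK ≤ 0`, and `|k|² ≥ K²/n` by
Cauchy–Schwarz. Tracing the Einstein equations and applying the strong energy condition gives
`Ric(ν, ν) ≥ -κ²/n` (`ricci_ge_of_einstein`). So where a spatial maximum of `K` exceeds `κ`, `∂K/∂λ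
≤ -K (K² - κ²)/n`. Since `K (K² - κ²) - 2κ² (K - κ) = (K - κ)² (K + 2κ) > 0`, this is strictly below
`-(2/n) κ² (K - κ)`. The right-hand side is the linear equation solved by the barrier `κ + C
exp(-(2/n) κ² (λ - λ₁))`, and the maximum principle `le_exp_of_deriv_le` shows that `K` cannot cross
it. If the initial maximum were below `κ`, the barrier with `C = 0` would keep `K ≤ κ` forever,
against the assumption that `K` exceeds `κ` somewhere; hence `C = K_m(λ₁) - κ` is admissible.

The evolution equation is never needed in full, only at a spatial maximum
(`IsNormalFlowOn.fderiv_speed_time_le`). There `dK = 0`, so `∇_λ ν = 0`, and the Hessian of `K`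
reduces to its coordinate second derivatives. A constant frame in the chart, orthonormal at that one
point, then turns `K` into `tr(h⁻¹ kᵀ)`, which is differentiated with `h = 1`. The curvature enters
by commuting `∇_λ` with `∇_u` on `ν` (`IsLeviCivitaOn.covD_comm`).

The calculation takes place in one chart of space and one of spacetime, for an abstract connection
form. Transporting it to the manifold needs three things: the Christoffel symbols define the
Levi-Civita connection (`isLeviCivitaOn_chart`), the mean curvature is independent of the charts
although its definition uses a chart varying with the point (`meanCurvature_eq`), and the Ricci
tensor is the trace of `w ↦ R(w, ν) ν` (`trace_curvOperator`). Smoothness of `ν` is not assumed; it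
follows because the future unit normal is a smooth function of the metric, the time orientation and
the tangent plane (`contDiffWithinAt_unitNormal`). -/

noncomputable section

namespace LorentzMCF

/-! ### Traces with respect to a bilinear form, and their independence of the basis. -/

/-- The `i`-th standard basis vector of `ℝᵐ`. -/
abbrev stdVec {m : ℕ} (i : Fin m) : EuclideanSpace ℝ (Fin m) := EuclideanSpace.single i 1

/-- The Gram matrix of a form on a family of vectors. -/
def gram {ι E : Type*} (B : E → E → ℝ) (b : ι → E) : Matrix ι ι ℝ :=
  Matrix.of fun i j => B (b i) (b j)

/-- As a matrix trace the quantity is accessible to cyclicity and congruence. The transpose is there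
because both factors are contracted in the same index order, and no symmetry of `B` is assumed. -/
theorem metricTrace_eq_trace {m : ℕ}
    (g B : EuclideanSpace ℝ (Fin m) → EuclideanSpace ℝ (Fin m) → ℝ) :
    metricTrace g B = ((gram g stdVec)⁻¹ * (gram B stdVec).transpose).trace := by
  simp [metricTrace, Matrix.trace, Matrix.mul_apply, gram]

theorem sum_coord_smul_stdVec {m : ℕ} (v : EuclideanSpace ℝ (Fin m)) :
    ∑ i, v i • stdVec i = v := by
  ext j
  simp [Finset.sum_apply, stdVec, Pi.single_apply]

theorem gram_change_basis {m : ℕ} {E : Type*} [NormedAddCommGroup E] [NormedSpace ℝ E]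
    (B : E →L[ℝ] E →L[ℝ] ℝ) (L : EuclideanSpace ℝ (Fin m) →L[ℝ] E) {ι : Type*}
    (b : ι → EuclideanSpace ℝ (Fin m)) :
    gram (fun u v => B u v) (fun i => L (b i)) =
      (Matrix.of fun (k : Fin m) (i : ι) => b i k).transpose *
        gram (fun u v => B u v) (fun k => L (stdVec k)) *
        (Matrix.of fun (k : Fin m) (i : ι) => b i k) := by
  ext i j
  have h : ∀ i, L (b i) = ∑ k, b i k • L (stdVec k) := fun i => by
    conv_lhs => rw [← sum_coord_smul_stdVec (b i)]
    simp
  simp only [gram, Matrix.of_apply, Matrix.mul_apply, Matrix.transpose_apply]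
  rw [h i, h j]
  simp only [map_sum, map_smul, FunLike.coe_sum, FunLike.coe_smul,
    Finset.sum_apply, Pi.smul_apply, smul_eq_mul, Finset.sum_mul, Finset.mul_sum]
  refine Finset.sum_congr rfl fun k _ => Finset.sum_congr rfl fun l _ => ?_
  ring

/-- The matrix of coordinates of a basis is invertible. -/
theorem isUnit_det_of_basis {m : ℕ} (b : Module.Basis (Fin m) ℝ (EuclideanSpace ℝ (Fin m))) :
    IsUnit (Matrix.of fun (k : Fin m) (i : Fin m) => b i k).det := by
  have := (EuclideanSpace.basisFun (Fin m) ℝ).toBasis.isUnit_det b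
  rw [Module.Basis.det_apply] at this
  have e : (Matrix.of fun (k : Fin m) (i : Fin m) => b i k)
      = (EuclideanSpace.basisFun (Fin m) ℝ).toBasis.toMatrix ⇑b := by
    ext k i
    simp [Module.Basis.toMatrix_apply]
  rwa [e]

/-- Both Gram matrices change by congruence with the same `A`; inverting the first makes the factors
cancel by cyclicity of the trace. -/
theorem trace_change_basis {m : ℕ} {A X Y : Matrix (Fin m) (Fin m) ℝ} (hA : IsUnit A.det) :
    ((A.transpose * X * A)⁻¹ * (A.transpose * Y * A).transpose).trace
      = (X⁻¹ * Y.transpose).trace := by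
  have hA' : IsUnit A.transpose.det := by rwa [Matrix.det_transpose]
  rw [Matrix.mul_inv_rev, Matrix.mul_inv_rev, Matrix.transpose_mul, Matrix.transpose_mul,
    Matrix.transpose_transpose, Matrix.mul_assoc, Matrix.trace_mul_comm]
  congr 1
  simp only [Matrix.mul_assoc]
  rw [Matrix.mul_nonsing_inv _ hA, Matrix.mul_one, Matrix.nonsing_inv_mul_cancel_left _ _ hA']

/-- The trace of `B` with respect to `g` can be computed in any basis. -/
theorem metricTrace_eq_of_basis {m : ℕ} {E : Type*} [NormedAddCommGroup E] [NormedSpace ℝ E]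
    (g B : E →L[ℝ] E →L[ℝ] ℝ) (L L' : EuclideanSpace ℝ (Fin m) →L[ℝ] E)
    (b : Module.Basis (Fin m) ℝ (EuclideanSpace ℝ (Fin m))) :
    metricTrace (fun u v => g (L u) (L v)) (fun u v => B (L' u) (L v))
      = ((gram (fun u v => g (L u) (L v)) b)⁻¹ *
          (gram (fun u v => B (L' u) (L v)) b).transpose).trace := by
  have h1 := gram_change_basis (g.bilinearComp L L) (ContinuousLinearMap.id ℝ _) b
  have h2 := gram_change_basis (B.bilinearComp L' L) (ContinuousLinearMap.id ℝ _) b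
  simp only [ContinuousLinearMap.bilinearComp_apply, ContinuousLinearMap.id_apply] at h1 h2
  have e1 : gram (fun u v => g (L u) (L v)) b = gram (fun u v => g (L u) (L v)) fun i => b i := rfl
  have e2 : gram (fun u v => B (L' u) (L v)) b =
    gram (fun u v => B (L' u) (L v)) fun i => b i := rfl
  rw [metricTrace_eq_trace, e1, e2, h1, h2, trace_change_basis (isUnit_det_of_basis b)]

/-- Used to discard the derivative of a chart of the hypersurface. Two maps `L` and `L'` are allowed
because the extrinsic curvature pairs `∇ν` in the first slot with the differential of the immersion
in the second. -/
theorem metricTrace_comp_equiv {m : ℕ} {E : Type*} [NormedAddCommGroup E] [NormedSpace ℝ E]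
    (g B : E →L[ℝ] E →L[ℝ] ℝ) (L L' : EuclideanSpace ℝ (Fin m) →L[ℝ] E)
    (A : EuclideanSpace ℝ (Fin m) ≃L[ℝ] EuclideanSpace ℝ (Fin m)) :
    metricTrace (fun u v => g (L (A u)) (L (A v))) (fun u v => B (L' (A u)) (L (A v)))
      = metricTrace (fun u v => g (L u) (L v)) (fun u v => B (L' u) (L v)) := by
  rw [metricTrace_eq_of_basis g B L L'
    ((EuclideanSpace.basisFun (Fin m) ℝ).toBasis.map A.toLinearEquiv), metricTrace_eq_trace]
  congr 3 <;> ext i j <;> simp [gram, stdVec]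

/-- A symmetric form with a timelike vector whose orthogonal complement is positive definite is
nondegenerate. -/
theorem nondegenerate_of_signature {E : Type*} [NormedAddCommGroup E] [NormedSpace ℝ E]
    (g : E →L[ℝ] E →L[ℝ] ℝ) (hsymm : ∀ v w, g v w = g w v)
    (hsig : ∃ v, g v v < 0 ∧ ∀ w, g v w = 0 → w ≠ 0 → 0 < g w w)
    {v : E} (hv : ∀ w, g v w = 0) : v = 0 := by
  obtain ⟨t, ht, hpos⟩ := hsig
  by_contra hne
  have := hpos v (by rw [hsymm]; exact hv t) hne
  rw [hv v] at this
  exact lt_irrefl _ this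

/-- A kernel vector of the Gram matrix is the coordinate vector of an element orthogonal to
everything. -/
theorem isUnit_det_gram_of_nondegenerate {m : ℕ}
    (g : EuclideanSpace ℝ (Fin m) →L[ℝ] EuclideanSpace ℝ (Fin m) →L[ℝ] ℝ)
    (hsymm : ∀ v w, g v w = g w v)
    (hnd : ∀ v, (∀ w, g v w = 0) → v = 0) : IsUnit (gram (fun u v => g u v) stdVec).det := by
  rw [isUnit_iff_ne_zero]
  intro h0
  obtain ⟨c, hc, hc0⟩ := Matrix.exists_mulVec_eq_zero_iff.mpr h0
  apply hc
  have key : (WithLp.toLp 2 c : EuclideanSpace ℝ (Fin m)) = 0 := by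
    apply hnd
    intro w
    rw [← sum_coord_smul_stdVec w, map_sum]
    refine Finset.sum_eq_zero fun i _ => ?_
    rw [map_smul]
    have := congrFun hc0 i
    simp only [Matrix.mulVec, dotProduct, gram, Matrix.of_apply, Pi.zero_apply] at this
    rw [← sum_coord_smul_stdVec (WithLp.toLp 2 c : EuclideanSpace ℝ (Fin m)), hsymm, map_sum]
    simp only [map_smul, smul_eq_mul]
    simp only [mul_comm _ (c _)] at this
    rw [this, mul_zero]
  ext i
  simpa using congrArg (fun v : EuclideanSpace ℝ (Fin m) => v i) key

theorem metricTrace_self {m : ℕ}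
    (g : EuclideanSpace ℝ (Fin m) →L[ℝ] EuclideanSpace ℝ (Fin m) →L[ℝ] ℝ)
    (hsymm : ∀ v w, g v w = g w v)
    (hnd : ∀ v, (∀ w, g v w = 0) → v = 0) :
    metricTrace (fun u v => g u v) (fun u v => g u v) = m := by
  have ht : (gram (fun u v => g u v) (stdVec (m := m))).transpose = gram (fun u v => g u v) stdVec := by
    ext i j
    simp [gram, hsymm (stdVec i)]
  rw [metricTrace_eq_trace, ht, Matrix.nonsing_inv_mul _
    (isUnit_det_gram_of_nondegenerate g hsymm hnd)]
  simp

theorem metricTrace_sub {m : ℕ}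
    (g B C : EuclideanSpace ℝ (Fin m) → EuclideanSpace ℝ (Fin m) → ℝ) :
    metricTrace g (fun u v => B u v - C u v) = metricTrace g B - metricTrace g C := by
  simp [metricTrace, mul_sub, Finset.sum_sub_distrib]

theorem metricTrace_const_mul {m : ℕ} (a : ℝ)
    (g B : EuclideanSpace ℝ (Fin m) → EuclideanSpace ℝ (Fin m) → ℝ) :
    metricTrace g (fun u v => a * B u v) = a * metricTrace g B := by
  simp only [metricTrace, Finset.mul_sum]
  exact Finset.sum_congr rfl fun _ _ => Finset.sum_congr rfl fun _ _ => by ring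

/-! ### The lower Ricci bound from the Einstein equations and the energy condition. -/

section
variable {m : ℕ} {M : Type*} [TopologicalSpace M] [ChartedSpace (EuclideanSpace ℝ (Fin m)) M]
  [IsManifold (𝓡 m) ∞ M]

theorem LorentzianMetric.nondegenerate (g : LorentzianMetric m M) (p : M)
    {v : TangentSpace (𝓡 m) p} (hv : ∀ w, g.val p v w = 0) : v = 0 :=
  nondegenerate_of_signature (E := EuclideanSpace ℝ (Fin m)) (g.val p) (g.symm p)
    (g.signature p) hv

theorem cosmologicalK_sq {n : ℕ} (hn : 2 ≤ n) {G Λ : ℝ} (hG : 0 < G) (hΛ : 0 < Λ) :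
    cosmologicalK n G Λ ^ 2 = (n : ℝ) / ((n : ℝ) - 1) * (16 * Real.pi * G * Λ) := by
  have : (2 : ℝ) ≤ n := by exact_mod_cast hn
  have h1 : (0 : ℝ) < n - 1 := by linarith
  have := Real.pi_pos
  exact Real.sq_sqrt (by positivity)

theorem cosmologicalK_pos {n : ℕ} (hn : 2 ≤ n) {G Λ : ℝ} (hG : 0 < G) (hΛ : 0 < Λ) :
    0 < cosmologicalK n G Λ := by
  have : (2 : ℝ) ≤ n := by exact_mod_cast hn
  have h1 : (0 : ℝ) < n - 1 := by linarith
  have := Real.pi_pos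
  exact Real.sqrt_pos.mpr (by positivity)

end

section
variable {n : ℕ} {M : Type*} [TopologicalSpace M]
  [ChartedSpace (EuclideanSpace ℝ (Fin (n + 1))) M] [IsManifold (𝓡 (n + 1)) ∞ M]

/-- The Einstein equations and the strong energy condition bound the Ricci curvature from below in
timelike directions. -/
theorem ricci_ge_of_einstein (hn : 2 ≤ n) (g : LorentzianMetric (n + 1) M) (τ : TimeOrientation g)
    {G Λ : ℝ} (hG : 0 < G) (hΛ : 0 < Λ)
    (T : ∀ p : M, TangentSpace (𝓡 (n + 1)) p →L[ℝ] TangentSpace (𝓡 (n + 1)) p →L[ℝ] ℝ)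
    (hE : EinsteinEquations g G Λ T) (hS : StrongEnergyCondition τ T) (p : M)
    (k : TangentSpace (𝓡 (n + 1)) p) (hk : τ.FutureTimelike p k) (hu : g.val p k k = -1) :
    -(cosmologicalK n G Λ ^ 2 / n) ≤ ricci g p k k := by
  have hn2 : (2 : ℝ) ≤ n := by exact_mod_cast hn
  have h1 : (0 : ℝ) < n - 1 := by linarith
  have hpi := Real.pi_pos
  set R := scalarCurvature g p with hR
  set t := metricTrace (fun v w => g.val p v w) (fun v w => T p v w) with ht
  have hself : metricTrace (fun v w => g.val p v w) (fun v w => g.val p v w) = ((n + 1 : ℕ) : ℝ) :=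
    metricTrace_self (g.val p) (g.symm p) fun v hv => g.nondegenerate p hv
  -- Trace of the Einstein equations, with `g^{μν} g_{μν} = n + 1`; it determines `R` because `n ≠
  -- 1`.
  have htr : R - (1 / 2) * R * (n + 1 : ℕ) = 8 * Real.pi * G * (t - Λ * (n + 1 : ℕ)) := by
    -- The tangent space is definitionally `ℝⁿ⁺¹`; retyping the forms lets the linearity lemmas for
    -- `metricTrace` apply.
    let gE : EuclideanSpace ℝ (Fin (n + 1)) → EuclideanSpace ℝ (Fin (n + 1)) → ℝ :=
      fun v w => g.val p v w
    let TE : EuclideanSpace ℝ (Fin (n + 1)) → EuclideanSpace ℝ (Fin (n + 1)) → ℝ :=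
      fun v w => T p v w
    let RE : EuclideanSpace ℝ (Fin (n + 1)) → EuclideanSpace ℝ (Fin (n + 1)) → ℝ :=
      fun v w => ricci g p v w
    have hself : metricTrace gE gE = ((n + 1 : ℕ) : ℝ) := hself
    have hfun : (fun v w => RE v w - (1 / 2) * R * gE v w) =
        fun v w => 8 * Real.pi * G * (TE v w - Λ * gE v w) :=
      funext fun v => funext fun w => hE p v w
    have := congrArg (metricTrace gE) hfun
    rw [metricTrace_sub, metricTrace_const_mul, metricTrace_const_mul, metricTrace_sub,
      metricTrace_const_mul, hself] at this
    exact this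
  have hs := hS p k hk
  have he := hE p k k
  rw [hu] at hs he
  rw [← ht] at hs
  rw [← hR] at he
  rw [cosmologicalK_sq hn hG hΛ]
  push_cast at htr hs
  have hne : (n : ℝ) - 1 ≠ 0 := h1.ne'
  have hR' : R = -(2 / (n - 1)) * (8 * Real.pi * G * (t - Λ * (n + 1))) := by
    rw [← htr]; field_simp; ring
  -- Eliminating `R` leaves exactly the combination of `T` in the energy condition; the terms in `Λ`
  -- add up to `-16πGΛ/(n - 1) = -κ²/n`.
  have hric : ricci g p k k + n / (n - 1) * (16 * Real.pi * G * Λ) / n =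
      8 * Real.pi * G * (T p k k - 1 / ((n : ℝ) + 1 - 2) * t * (-1)) := by
    have : ricci g p k k = 8 * Real.pi * G * (T p k k - Λ * -1) + 1 / 2 * R * -1 := by linarith
    rw [this, hR']
    have h2 : (n : ℝ) + 1 - 2 ≠ 0 := by intro h; apply hne; linarith
    have h3 : (n : ℝ) + 1 - 2 = n - 1 := by ring
    rw [h3]
    field_simp
    ring
  have : 0 ≤ 8 * Real.pi * G * (T p k k - 1 / ((n : ℝ) + 1 - 2) * t * (-1)) := by positivity
  linarith

end

/-! ### Connection forms on a vector space and covariant derivatives along maps. -/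

section Calculus

variable {P E : Type*} [NormedAddCommGroup P] [NormedSpace ℝ P]
  [NormedAddCommGroup E] [NormedSpace ℝ E]

/-- The covariant derivative in the direction `ξ`, for the connection form `Γ`, of a vector field
`V` along `Y`. -/
def covD (Γ : E → E →L[ℝ] E →L[ℝ] E) (Y V : P → E) (ξ q : P) : E :=
  fderiv ℝ V q ξ + Γ (Y q) (fderiv ℝ Y q ξ) (V q)

/-- The curvature `R(u, v) w` of the connection form `Γ`. -/
def curv (Γ : E → E →L[ℝ] E →L[ℝ] E) (z u v w : E) : E :=
  fderiv ℝ Γ z u v w - fderiv ℝ Γ z v u w + Γ z u (Γ z v w) - Γ z v (Γ z u w)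

/-- `G` is a smooth symmetric form on the open set `Ω` and `Γ` is a smooth torsion-free connection
form compatible with it. -/
structure IsLeviCivitaOn (Ω : Set E) (G : E → E →L[ℝ] E →L[ℝ] ℝ) (Γ : E → E →L[ℝ] E →L[ℝ] E) :
    Prop where
  isOpen : IsOpen Ω
  smooth_metric : ContDiffOn ℝ ∞ G Ω
  smooth_conn : ContDiffOn ℝ ∞ Γ Ω
  symm : ∀ z ∈ Ω, ∀ v w, G z v w = G z w v
  torsion_free : ∀ z ∈ Ω, ∀ u v, Γ z u v = Γ z v u
  compat : ∀ z ∈ Ω, ∀ u v w, fderiv ℝ G z u v w = G z (Γ z u v) w + G z v (Γ z u w)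

theorem _root_.ContDiffOn.diffAt {f : P → E} {W : Set P} (hf : ContDiffOn ℝ ∞ f W) (hW : IsOpen W)
    {q : P} (hq : q ∈ W) : DifferentiableAt ℝ f q :=
  (hf.contDiffAt (hW.mem_nhds hq)).differentiableAt (by simp)

theorem _root_.ContDiffOn.fderiv_apply_const {f : P → E} {W : Set P} (hf : ContDiffOn ℝ ∞ f W)
    (hW : IsOpen W) (ξ : P) : ContDiffOn ℝ ∞ (fun q => fderiv ℝ f q ξ) W :=
  (hf.fderiv_of_isOpen hW (m := ∞) (by simp)).clm_apply contDiffOn_const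

theorem fderiv_fderiv_apply {f : P → E} {W : Set P} (hf : ContDiffOn ℝ ∞ f W)
    (hW : IsOpen W) {q : P} (hq : q ∈ W) (ξ η : P) :
    fderiv ℝ (fun q' => fderiv ℝ f q' η) q ξ = fderiv ℝ (fderiv ℝ f) q ξ η := by
  have h := (hf.fderiv_of_isOpen hW (m := ∞) (by simp)).diffAt hW hq
  rw [fderiv_clm_apply h (differentiableAt_const _)]
  simp

theorem fderiv_fderiv_symm {f : P → E} {W : Set P} (hf : ContDiffOn ℝ ∞ f W)
    (hW : IsOpen W) {q : P} (hq : q ∈ W) (ξ η : P) :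
    fderiv ℝ (fderiv ℝ f) q ξ η = fderiv ℝ (fderiv ℝ f) q η ξ :=
  ((hf.contDiffAt (hW.mem_nhds hq)).isSymmSndFDerivAt
    (by rw [minSmoothness_of_isRCLikeNormedField]
        exact WithTop.coe_le_coe.mpr (le_top : (2 : ℕ∞) ≤ ⊤))) ξ η

variable {Ω : Set E} {G : E → E →L[ℝ] E →L[ℝ] ℝ} {Γ : E → E →L[ℝ] E →L[ℝ] E}

/-- Metric compatibility along a map. -/
theorem IsLeviCivitaOn.fderiv_inner (h : IsLeviCivitaOn Ω G Γ) {Y V W : P → E} {q : P}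
    (hq : Y q ∈ Ω) (hY : DifferentiableAt ℝ Y q) (hV : DifferentiableAt ℝ V q)
    (hW : DifferentiableAt ℝ W q) (ξ : P) :
    fderiv ℝ (fun q' => G (Y q') (V q') (W q')) q ξ =
      G (Y q) (covD Γ Y V ξ q) (W q) + G (Y q) (V q) (covD Γ Y W ξ q) := by
  have hG := h.smooth_metric.diffAt h.isOpen hq
  have hGY : HasFDerivAt (fun q' => G (Y q')) _ q := hG.hasFDerivAt.comp q hY.hasFDerivAt
  have := (hGY.clm_apply hV.hasFDerivAt).clm_apply hW.hasFDerivAt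
  rw [this.fderiv]
  simp [covD, h.compat _ hq]
  ring

/-- Equality of mixed second derivatives combined with the vanishing of the torsion. -/
theorem IsLeviCivitaOn.covD_fderiv_symm (h : IsLeviCivitaOn Ω G Γ) {Y : P → E} {W : Set P}
    (hW : IsOpen W) (hY : ContDiffOn ℝ ∞ Y W) {q : P} (hq : q ∈ W) (hz : Y q ∈ Ω) (ξ η : P) :
    covD Γ Y (fun q' => fderiv ℝ Y q' η) ξ q = covD Γ Y (fun q' => fderiv ℝ Y q' ξ) η q := by
  simp only [covD]
  rw [fderiv_fderiv_apply hY hW hq, fderiv_fderiv_apply hY hW hq, fderiv_fderiv_symm hY hW hq,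
    h.torsion_free _ hz]

theorem covD_smul {Y V : P → E} {f : P → ℝ} {q : P} (hf : DifferentiableAt ℝ f q)
    (hV : DifferentiableAt ℝ V q) (ξ : P) :
    covD Γ Y (fun q' => f q' • V q') ξ q = fderiv ℝ f q ξ • V q + f q • covD Γ Y V ξ q := by
  simp only [covD]
  rw [fderiv_fun_smul hf hV]
  simp
  abel

theorem IsLeviCivitaOn.smooth_covD (h : IsLeviCivitaOn Ω G Γ) {Y V : P → E} {W : Set P}
    (hW : IsOpen W) (hY : ContDiffOn ℝ ∞ Y W) (hV : ContDiffOn ℝ ∞ V W)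
    (hmaps : MapsTo Y W Ω) (ξ : P) : ContDiffOn ℝ ∞ (covD Γ Y V ξ) W :=
  (hV.fderiv_apply_const hW ξ).add
    (((h.smooth_conn.comp hY hmaps).clm_apply (hY.fderiv_apply_const hW ξ)).clm_apply hV)

/-- Covariant derivatives commute up to curvature. -/
theorem IsLeviCivitaOn.covD_comm (h : IsLeviCivitaOn Ω G Γ) {Y V : P → E} {W : Set P}
    (hW : IsOpen W) (hY : ContDiffOn ℝ ∞ Y W) (hV : ContDiffOn ℝ ∞ V W)
    {q : P} (hq : q ∈ W) (hz : Y q ∈ Ω) (ξ η : P) :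
    covD Γ Y (covD Γ Y V η) ξ q = covD Γ Y (covD Γ Y V ξ) η q +
      curv Γ (Y q) (fderiv ℝ Y q ξ) (fderiv ℝ Y q η) (V q) := by
  have hΓ := h.smooth_conn.diffAt h.isOpen hz
  have hYd := hY.diffAt hW hq
  have hVd := hV.diffAt hW hq
  have hΓY : HasFDerivAt (fun q' => Γ (Y q')) _ q := hΓ.hasFDerivAt.comp q hYd.hasFDerivAt
  have key : ∀ ξ η : P, fderiv ℝ (covD Γ Y V η) q ξ =
      fderiv ℝ (fderiv ℝ V) q ξ η + fderiv ℝ Γ (Y q) (fderiv ℝ Y q ξ) (fderiv ℝ Y q η) (V q)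
        + Γ (Y q) (fderiv ℝ (fderiv ℝ Y) q ξ η) (V q)
        + Γ (Y q) (fderiv ℝ Y q η) (fderiv ℝ V q ξ) := by
    -- The second-derivative terms are symmetric in `ξ` and `η`; what survives antisymmetrization is
    -- the derivative of `Γ` and the quadratic terms of the curvature.
    intro ξ η
    have hY' := (hY.fderiv_apply_const hW η).diffAt hW hq
    have hV' := (hV.fderiv_apply_const hW η).diffAt hW hq
    have := hV'.hasFDerivAt.add
      ((hΓY.clm_apply hY'.hasFDerivAt).clm_apply hVd.hasFDerivAt)
    have e : covD Γ Y V η = (fun q' => fderiv ℝ V q' η) +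
        fun q' => Γ (Y q') (fderiv ℝ Y q' η) (V q') := rfl
    rw [e, this.fderiv]
    simp [fderiv_fderiv_apply hV hW hq, fderiv_fderiv_apply hY hW hq]
    abel
  have e : ∀ ξ η : P, covD Γ Y (covD Γ Y V η) ξ q = fderiv ℝ (covD Γ Y V η) q ξ +
      Γ (Y q) (fderiv ℝ Y q ξ) (covD Γ Y V η q) := fun _ _ => rfl
  rw [e, e, key, key, fderiv_fderiv_symm hV hW hq ξ η, fderiv_fderiv_symm hY hW hq ξ η]
  simp only [covD, curv, map_add]
  abel

end Calculus

/-! ### Lorentz frames, and the derivative of a metric trace. -/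

section LinearAlgebra

variable {n : ℕ} {E : Type*} [NormedAddCommGroup E] [NormedSpace ℝ E]

/-- An orthonormal frame `N, e₁, …, eₙ` of a Lorentzian form `g`, with `N` timelike. -/
structure IsLorentzFrame (g : E →L[ℝ] E →L[ℝ] ℝ) (N : E) (e : Fin n → E) : Prop where
  symm : ∀ v w, g v w = g w v
  unit : g N N = -1
  orthogonal : ∀ i, g N (e i) = 0
  orthonormal : ∀ i j, g (e i) (e j) = (1 : Matrix (Fin n) (Fin n) ℝ) i j
  finrank_eq : Module.finrank ℝ E = n + 1

variable {g : E →L[ℝ] E →L[ℝ] ℝ} {N : E} {e : Fin n → E}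

theorem IsLorentzFrame.linearIndependent (h : IsLorentzFrame g N e) :
    LinearIndependent ℝ (Fin.cons N e : Fin (n + 1) → E) := by
  rw [Fintype.linearIndependent_iff]
  intro c hc
  rw [Fin.sum_univ_succ] at hc
  simp only [Fin.cons_zero, Fin.cons_succ] at hc
  have h0 := congrArg (g N) hc
  simp only [map_add, map_smul, map_sum, h.unit, h.orthogonal, smul_eq_mul, map_zero] at h0
  intro i
  refine Fin.cases ?_ (fun j => ?_) i
  · simpa using h0
  · have hj := congrArg (g (e j)) hc
    simp only [map_add, map_smul, map_sum, h.orthonormal, h.symm (e j) N, h.orthogonal,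
      smul_eq_mul, map_zero, Matrix.one_apply] at hj
    simpa using hj

/-- The basis formed by a Lorentz frame. -/
def IsLorentzFrame.basis (h : IsLorentzFrame g N e) : Module.Basis (Fin (n + 1)) ℝ E :=
  basisOfLinearIndependentOfCardEqFinrank h.linearIndependent (by simp [h.finrank_eq])

theorem IsLorentzFrame.basis_zero (h : IsLorentzFrame g N e) : h.basis 0 = N := by
  simp [IsLorentzFrame.basis]

theorem IsLorentzFrame.basis_succ (h : IsLorentzFrame g N e) (i : Fin n) :
    h.basis i.succ = e i := by
  simp [IsLorentzFrame.basis]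

/-- The sign comes from `g(N, N) = -1`. -/
theorem IsLorentzFrame.repr_zero (h : IsLorentzFrame g N e) (v : E) :
    h.basis.repr v 0 = -g v N := by
  have := h.basis.sum_repr v
  rw [Fin.sum_univ_succ] at this
  simp only [h.basis_zero, h.basis_succ] at this
  have h0 := congrArg (g N) this
  simp only [map_add, map_smul, map_sum, h.unit, h.orthogonal, smul_eq_mul] at h0
  simp only [mul_zero, Finset.sum_const_zero] at h0
  rw [h.symm v N]
  linarith

theorem IsLorentzFrame.repr_succ (h : IsLorentzFrame g N e) (v : E) (i : Fin n) :
    h.basis.repr v i.succ = g v (e i) := by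
  have := h.basis.sum_repr v
  rw [Fin.sum_univ_succ] at this
  simp only [h.basis_zero, h.basis_succ] at this
  have h0 := congrArg (g (e i)) this
  simp only [map_add, map_smul, map_sum, h.orthonormal, h.symm (e i) N, h.orthogonal,
      smul_eq_mul, Matrix.one_apply] at h0
  rw [h.symm v]
  simpa using h0

theorem IsLorentzFrame.expand (h : IsLorentzFrame g N e) (v : E) :
    v = -g v N • N + ∑ i, g v (e i) • e i := by
  conv_lhs => rw [← h.basis.sum_repr v]
  rw [Fin.sum_univ_succ]
  simp only [h.basis_zero, h.basis_succ, h.repr_zero, h.repr_succ]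

theorem IsLorentzFrame.trace_eq (h : IsLorentzFrame g N e) (T : E →ₗ[ℝ] E) :
    LinearMap.trace ℝ E T = -g (T N) N + ∑ i, g (T (e i)) (e i) := by
  rw [LinearMap.trace_eq_matrix_trace ℝ h.basis, Matrix.trace, Fin.sum_univ_succ]
  simp [LinearMap.toMatrix_apply, h.repr_zero, h.repr_succ, h.basis_zero, h.basis_succ]

/-- Applied to `∇_u ν`, which is orthogonal to `ν`, this turns `g(∇_u ν, ∇_u ν)` into a sum of
squares of second fundamental form entries. -/
theorem IsLorentzFrame.inner_of_orthogonal (h : IsLorentzFrame g N e) {v : E} (hv : g v N = 0)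
    (w : E) : g v w = ∑ i, g v (e i) * g w (e i) := by
  conv_lhs => rw [h.expand v]
  simp [hv, h.symm w]

/-- The derivative of `tr (h⁻¹ kᵀ)` where `h = 1`. -/
theorem hasDerivAt_trace_inv_mul {h k : ℝ → Matrix (Fin n) (Fin n) ℝ}
    {h' k' : Matrix (Fin n) (Fin n) ℝ} {t : ℝ} (h1 : h t = 1)
    (hh : ∀ i j, HasDerivAt (fun s => h s i j) (h' i j) t)
    (hk : ∀ i j, HasDerivAt (fun s => k s i j) (k' i j) t) :
    HasDerivAt (fun s => ((h s)⁻¹ * (k s).transpose).trace)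
      (∑ i, k' i i - ∑ i, ∑ j, h' i j * k t i j) t := by
  have hinv : ∀ i j, HasDerivAt (fun s => (h s)⁻¹ i j) (-h' i j) t := by
    -- Matrices carry no canonical norm. A submultiplicative one is chosen locally so that inversion
    -- has derivative `-h'` at the identity; the conclusion is entrywise and does not mention it.
    let _ : NormedRing (Matrix (Fin n) (Fin n) ℝ) := Matrix.linftyOpNormedRing
    let _ : NormedAlgebra ℝ (Matrix (Fin n) (Fin n) ℝ) := Matrix.linftyOpNormedAlgebra
    have hh' : HasDerivAt h h' t :=
      hasDerivAt_pi.mpr fun i => hasDerivAt_pi.mpr fun j => hh i j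
    have hinv : HasDerivAt (fun s => (h s)⁻¹) (-h') t := by
      have := (hasFDerivAt_ringInverse (𝕜 := ℝ) (1 : (Matrix (Fin n) (Fin n) ℝ)ˣ))
      rw [Units.val_one, ← h1] at this
      have := this.comp_hasDerivAt t hh'
      simp only [Function.comp_def, ← Matrix.nonsing_inv_eq_ringInverse] at this
      simp only [Units.val_one, inv_one, neg_apply, ContinuousLinearMap.mulLeftRight_apply,
        one_mul, mul_one] at this
      exact this
    exact fun i j => hasDerivAt_pi.mp (hasDerivAt_pi.mp hinv i) j
  have hsum := HasDerivAt.fun_sum (u := Finset.univ) fun i _ =>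
    HasDerivAt.fun_sum (u := Finset.univ) fun j _ => (hinv i j).mul (hk i j)
  have e : (fun s => ((h s)⁻¹ * (k s).transpose).trace) =
      fun s => ∑ i, ∑ j, (h s)⁻¹ i j * k s i j := by
    funext s
    simp [Matrix.trace, Matrix.mul_apply]
  rw [e]
  refine hsum.congr_deriv ?_
  simp [h1, Finset.sum_add_distrib, Matrix.one_apply]
  ring

end LinearAlgebra

/-! ### Evolution of the fundamental forms and of the speed, in a chart. -/

section Evolution

variable {F E : Type*} [NormedAddCommGroup F] [NormedSpace ℝ F]
  [NormedAddCommGroup E] [NormedSpace ℝ E]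

/-- The local form of a flow with normal speed `K`: `Y(u, s)` is the position and `N(u, s)` the unit
normal, in a chart where the metric is `G` and the connection is `Γ`. -/
structure IsNormalFlowOn (Ω : Set E) (G : E → E →L[ℝ] E →L[ℝ] ℝ) (Γ : E → E →L[ℝ] E →L[ℝ] E)
    (W : Set (F × ℝ)) (Y N : F × ℝ → E) (K : F × ℝ → ℝ) : Prop where
  metric : IsLeviCivitaOn Ω G Γ
  isOpen : IsOpen W
  mapsTo : MapsTo Y W Ω
  smooth_map : ContDiffOn ℝ ∞ Y W
  smooth_normal : ContDiffOn ℝ ∞ N W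
  unit : ∀ q ∈ W, G (Y q) (N q) (N q) = -1
  orthogonal : ∀ q ∈ W, ∀ u : F, G (Y q) (N q) (fderiv ℝ Y q (u, 0)) = 0
  flow : ∀ q ∈ W, fderiv ℝ Y q (0, 1) = K q • N q

variable {Ω : Set E} {G : E → E →L[ℝ] E →L[ℝ] ℝ} {Γ : E → E →L[ℝ] E →L[ℝ] E}
  {W : Set (F × ℝ)} {Y N : F × ℝ → E} {K : F × ℝ → ℝ}

/-- The second fundamental form `g(∇_u N, dY v)`. -/
def sff (G : E → E →L[ℝ] E →L[ℝ] ℝ) (Γ : E → E →L[ℝ] E →L[ℝ] E) (Y N : F × ℝ → E) (q : F × ℝ)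
    (u v : F) : ℝ :=
  G (Y q) (covD Γ Y N (u, 0) q) (fderiv ℝ Y q (v, 0))

/-- The first fundamental form. -/
def fff (G : E → E →L[ℝ] E →L[ℝ] ℝ) (Y : F × ℝ → E) (q : F × ℝ) (u v : F) : ℝ :=
  G (Y q) (fderiv ℝ Y q (u, 0)) (fderiv ℝ Y q (v, 0))

theorem fderiv_eq_of_eqOn {f g : F × ℝ → ℝ} (hW : IsOpen W) {q : F × ℝ} (hq : q ∈ W)
    (h : ∀ q' ∈ W, f q' = g q') : fderiv ℝ f q = fderiv ℝ g q :=
  Filter.EventuallyEq.fderiv_eq (Filter.eventually_of_mem (hW.mem_nhds hq) h)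

namespace IsNormalFlowOn

variable (h : IsNormalFlowOn Ω G Γ W Y N K)
include h

/-- Since `K` is recovered from first derivatives of `Y` and from `N`, its smoothness need not be
assumed. -/
theorem speed_eq {q : F × ℝ} (hq : q ∈ W) : K q = -G (Y q) (fderiv ℝ Y q (0, 1)) (N q) := by
  rw [h.flow q hq]
  simp [h.unit q hq]

theorem smooth_speed : ContDiffOn ℝ ∞ K W := by
  refine ContDiffOn.congr (f := fun q => -G (Y q) (fderiv ℝ Y q (0, 1)) (N q)) ?_
    fun q hq => h.speed_eq hq
  exact (((h.metric.smooth_metric.comp h.smooth_map h.mapsTo).clm_apply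
    (h.smooth_map.fderiv_apply_const h.isOpen _)).clm_apply h.smooth_normal).neg

theorem smooth_covD (ξ : F × ℝ) : ContDiffOn ℝ ∞ (covD Γ Y N ξ) W :=
  h.metric.smooth_covD h.isOpen h.smooth_map h.smooth_normal h.mapsTo ξ

/-- Differentiate `G(N, N) = -1`. -/
theorem covD_normal_normal {q : F × ℝ} (hq : q ∈ W) (ξ : F × ℝ) :
    G (Y q) (covD Γ Y N ξ q) (N q) = 0 := by
  have hN := h.smooth_normal.diffAt h.isOpen hq
  have h1 := h.metric.fderiv_inner (h.mapsTo hq) (h.smooth_map.diffAt h.isOpen hq) hN hN ξ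
  rw [fderiv_eq_of_eqOn h.isOpen hq h.unit, h.metric.symm _ (h.mapsTo hq) (N q)] at h1
  simp at h1
  linarith

/-- Differentiate `G(N, dY(u)) = 0`. This moves a derivative from the normal to the tangent vector,
where the symmetry of second derivatives is available. -/
theorem fderiv_orthogonal {q : F × ℝ} (hq : q ∈ W) (u : F) (ξ : F × ℝ) :
    G (Y q) (covD Γ Y N ξ q) (fderiv ℝ Y q (u, 0)) =
      -G (Y q) (N q) (covD Γ Y (fun q' => fderiv ℝ Y q' (u, 0)) ξ q) := by
  have h1 := h.metric.fderiv_inner (h.mapsTo hq) (h.smooth_map.diffAt h.isOpen hq)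
    (h.smooth_normal.diffAt h.isOpen hq)
    ((h.smooth_map.fderiv_apply_const h.isOpen (u, 0)).diffAt h.isOpen hq) ξ
  rw [fderiv_eq_of_eqOn (g := fun _ => 0) h.isOpen hq fun q' hq' => h.orthogonal q' hq' u] at h1
  simp at h1
  linarith

theorem sff_symm {q : F × ℝ} (hq : q ∈ W) (u v : F) : sff G Γ Y N q u v = sff G Γ Y N q v u := by
  rw [sff, sff, h.fderiv_orthogonal hq, h.fderiv_orthogonal hq,
    h.metric.covD_fderiv_symm h.isOpen h.smooth_map hq (h.mapsTo hq)]

/-- Exchange the two directions, use the flow equation `∂_s Y = K N`, and apply the product rule. -/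
theorem covD_time_tangent {q : F × ℝ} (hq : q ∈ W) (ξ : F × ℝ) :
    covD Γ Y (fun q' => fderiv ℝ Y q' ξ) (0, 1) q =
      fderiv ℝ K q ξ • N q + K q • covD Γ Y N ξ q := by
  rw [h.metric.covD_fderiv_symm h.isOpen h.smooth_map hq (h.mapsTo hq),
    ← covD_smul (h.smooth_speed.diffAt h.isOpen hq) (h.smooth_normal.diffAt h.isOpen hq), covD,
    covD, h.flow q hq]
  congr 2
  exact Filter.EventuallyEq.fderiv_eq (Filter.eventually_of_mem (h.isOpen.mem_nhds hq) h.flow)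

/-- The normal turns by the gradient of the speed. -/
theorem covD_time_normal {q : F × ℝ} (hq : q ∈ W) (u : F) :
    G (Y q) (covD Γ Y N (0, 1) q) (fderiv ℝ Y q (u, 0)) = fderiv ℝ K q (u, 0) := by
  rw [h.fderiv_orthogonal hq, h.covD_time_tangent hq]
  rw [map_add, map_smul, map_smul, h.unit q hq, h.metric.symm _ (h.mapsTo hq) (N q),
    h.covD_normal_normal hq]
  simp

/-- In `∇_s dY(u) = dK(u) N + K ∇_u N` the first term is orthogonal to the surface; symmetry of the
second fundamental form doubles the other. -/
theorem fderiv_fff_time {q : F × ℝ} (hq : q ∈ W) (u v : F) :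
    fderiv ℝ (fun q' => fff G Y q' u v) q (0, 1) = 2 * K q * sff G Γ Y N q u v := by
  have hd := fun u : F => (h.smooth_map.fderiv_apply_const h.isOpen (u, (0 : ℝ))).diffAt h.isOpen hq
  simp only [fff]
  rw [h.metric.fderiv_inner (h.mapsTo hq) (h.smooth_map.diffAt h.isOpen hq) (hd u) (hd v),
    h.covD_time_tangent hq, h.covD_time_tangent hq,
    h.metric.symm _ (h.mapsTo hq) (fderiv ℝ Y q (u, 0))]
  have := h.sff_symm hq u v
  simp only [sff] at this ⊢
  simp only [map_add, map_smul, add_apply, smul_apply, h.orthogonal q hq, this, smul_eq_mul]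
  ring

/-- At a critical point of the speed, the second derivative of the speed is the derivative of the
rotation of the normal. -/
theorem covD_covD_time_normal {q : F × ℝ} (hq : q ∈ W) (h0 : covD Γ Y N (0, 1) q = 0) (u v : F) :
    G (Y q) (covD Γ Y (covD Γ Y N (0, 1)) (v, 0) q) (fderiv ℝ Y q (u, 0)) =
      fderiv ℝ (fderiv ℝ K) q (v, 0) (u, 0) := by
  have h1 := h.metric.fderiv_inner (h.mapsTo hq) (h.smooth_map.diffAt h.isOpen hq)
    ((h.smooth_covD (0, 1)).diffAt h.isOpen hq)
    ((h.smooth_map.fderiv_apply_const h.isOpen (u, 0)).diffAt h.isOpen hq) (v, 0)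
  rw [fderiv_eq_of_eqOn h.isOpen hq fun q' hq' => h.covD_time_normal hq' u,
    fderiv_fderiv_apply h.smooth_speed h.isOpen hq, h0] at h1
  simpa using h1.symm

/-- Commuting `∇_s ∇_u N` produces the curvature `R(K N, dY u) N`, and the motion of `dY u` produces
the last term. Because `∇_s N` vanishes at `q`, `∇_u ∇_s N` contributes the plain coordinate Hessian
of `K`, without Christoffel symbols of the induced metric. -/
theorem fderiv_sff_time {q : F × ℝ} (hq : q ∈ W) (h0 : covD Γ Y N (0, 1) q = 0) (u : F) :
    fderiv ℝ (fun q' => sff G Γ Y N q' u u) q (0, 1) =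
      fderiv ℝ (fderiv ℝ K) q (u, 0) (u, 0)
      - K q * G (Y q) (curv Γ (Y q) (fderiv ℝ Y q (u, 0)) (N q) (N q)) (fderiv ℝ Y q (u, 0))
      + K q * G (Y q) (covD Γ Y N (u, 0) q) (covD Γ Y N (u, 0) q) := by
  have hd := (h.smooth_map.fderiv_apply_const h.isOpen (u, (0 : ℝ))).diffAt h.isOpen hq
  simp only [sff]
  rw [h.metric.fderiv_inner (h.mapsTo hq) (h.smooth_map.diffAt h.isOpen hq)
    ((h.smooth_covD (u, 0)).diffAt h.isOpen hq) hd, h.covD_time_tangent hq,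
    h.metric.covD_comm h.isOpen h.smooth_map h.smooth_normal hq (h.mapsTo hq), h.flow q hq]
  simp only [map_add, map_smul, add_apply, h.covD_normal_normal hq,
    h.covD_covD_time_normal hq h0, smul_eq_mul]
  have : curv Γ (Y q) (K q • N q) (fderiv ℝ Y q (u, 0)) (N q) =
      -(K q • curv Γ (Y q) (fderiv ℝ Y q (u, 0)) (N q) (N q)) := by
    simp only [curv, map_smul, smul_apply, smul_sub, smul_add]
    abel
  rw [this]
  simp
  ring

/-- The parabolic inequality for the mean curvature under mean curvature flow, at a spatial
maximum. -/
theorem fderiv_speed_time_le {n : ℕ} {q : F × ℝ} (hq : q ∈ W) (e : Fin n → F)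
    (hdim : Module.finrank ℝ E = n + 1)
    (horth : ∀ i j, fff G Y q (e i) (e j) = (1 : Matrix (Fin n) (Fin n) ℝ) i j)
    (htrace : ∀ q' ∈ W, K q' = ((gram (fff G Y q') e)⁻¹ *
      (gram (sff G Γ Y N q') e).transpose).trace)
    (hcrit : ∀ u : F, fderiv ℝ K q (u, 0) = 0)
    (hmax : ∀ u : F, fderiv ℝ (fderiv ℝ K) q (u, 0) (u, 0) ≤ 0)
    (hpos : 0 ≤ K q) (Ric : E →ₗ[ℝ] E) (hRic : ∀ w, Ric w = curv Γ (Y q) w (N q) (N q)) :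
    fderiv ℝ K q (0, 1) ≤ -K q * (K q ^ 2 / n + LinearMap.trace ℝ E Ric) := by
  have hframe : IsLorentzFrame (G (Y q)) (N q) (fun i => fderiv ℝ Y q (e i, 0)) :=
    ⟨h.metric.symm _ (h.mapsTo hq), h.unit q hq, fun i => h.orthogonal q hq (e i), horth, hdim⟩
  -- The tangential components of `∇_s N` are the derivatives of `K`, zero at a critical point; the
  -- normal component always vanishes.
  have h0 : covD Γ Y N (0, 1) q = 0 := by
    rw [hframe.expand (covD Γ Y N (0, 1) q)]
    simp [h.covD_normal_normal hq, h.covD_time_normal hq, hcrit]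
  set k : Fin n → Fin n → ℝ := fun i j => sff G Γ Y N q (e i) (e j) with hk
  have h1 : gram (fff G Y q) e = 1 := by
    ext i j
    exact horth i j
  have hKq : K q = ∑ i, k i i := by
    rw [htrace q hq, h1]
    simp [Matrix.trace, gram, hk]
  have hline : ∀ {f : F × ℝ → ℝ}, DifferentiableAt ℝ f q →
      HasDerivAt (fun t : ℝ => f (q + t • ((0 : F), (1 : ℝ)))) (fderiv ℝ f q (0, 1)) 0 :=
    fun hf => hf.hasFDerivAt.hasLineDerivAt _
  have hfd : ∀ i j, DifferentiableAt ℝ (fun q' => fff G Y q' (e i) (e j)) q := fun i j =>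
    ((((h.metric.smooth_metric.comp h.smooth_map h.mapsTo).clm_apply
      (h.smooth_map.fderiv_apply_const h.isOpen _)).clm_apply
      (h.smooth_map.fderiv_apply_const h.isOpen _))).diffAt h.isOpen hq
  have hsd : ∀ i j, DifferentiableAt ℝ (fun q' => sff G Γ Y N q' (e i) (e j)) q := fun i j =>
    ((((h.metric.smooth_metric.comp h.smooth_map h.mapsTo).clm_apply
      (h.smooth_covD _)).clm_apply
      (h.smooth_map.fderiv_apply_const h.isOpen _))).diffAt h.isOpen hq
  have hq0 : q + (0 : ℝ) • ((0 : F), (1 : ℝ)) = q := by simp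
  -- The frame `e` is constant in time and orthonormal only at `q`, so the change of the induced
  -- metric is accounted for by the derivative of `h⁻¹`.
  have hder := hasDerivAt_trace_inv_mul (t := 0)
    (h := fun t => gram (fff G Y (q + t • ((0 : F), (1 : ℝ)))) e)
    (k := fun t => gram (sff G Γ Y N (q + t • ((0 : F), (1 : ℝ)))) e)
    (h' := Matrix.of fun i j => 2 * K q * k i j)
    (k' := Matrix.of fun i j => fderiv ℝ (fun q' => sff G Γ Y N q' (e i) (e j)) q (0, 1))
    (by simp only [hq0]; exact h1)
    (fun i j => by
      have := hline (hfd i j)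
      rw [h.fderiv_fff_time hq] at this
      exact this)
    (fun i j => hline (hsd i j))
  have hKder : HasDerivAt (fun t : ℝ => K (q + t • ((0 : F), (1 : ℝ)))) (fderiv ℝ K q (0, 1)) 0 :=
    hline (h.smooth_speed.diffAt h.isOpen hq)
  have hcont : Continuous fun t : ℝ => q + t • ((0 : F), (1 : ℝ)) := by fun_prop
  have hev : (fun t : ℝ => K (q + t • ((0 : F), (1 : ℝ)))) =ᶠ[𝓝 0]
      fun t => ((gram (fff G Y (q + t • ((0 : F), (1 : ℝ)))) e)⁻¹ *
      (gram (sff G Γ Y N (q + t • ((0 : F), (1 : ℝ)))) e).transpose).trace :=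
    Filter.eventually_of_mem
      (hcont.continuousAt.preimage_mem_nhds (by rw [hq0]; exact h.isOpen.mem_nhds hq))
      fun t ht => htrace _ ht
  have hval := hKder.unique (hder.congr_of_eventuallyEq hev)
  simp only [hq0, Matrix.of_apply, gram] at hval
  have hsq : ∀ i, G (Y q) (covD Γ Y N (e i, 0) q) (covD Γ Y N (e i, 0) q) =
      ∑ j, k i j * k i j := fun i =>
    hframe.inner_of_orthogonal (h.covD_normal_normal hq _) _
  have htr : LinearMap.trace ℝ E Ric = ∑ i, G (Y q) (curv Γ (Y q) (fderiv ℝ Y q (e i, 0))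
      (N q) (N q)) (fderiv ℝ Y q (e i, 0)) := by
    -- The `N`-direction contributes nothing to the trace, since `R(N, N) = 0`.
    rw [hframe.trace_eq, hRic]
    have : curv Γ (Y q) (N q) (N q) (N q) = 0 := by simp [curv]
    rw [this]
    simp [hRic]
  -- The inverse metric contributes `-2K|k|²` and the term `K g(∇N, ∇N)` contributes `+K|k|²`.
  have hsum : fderiv ℝ K q (0, 1) = ∑ i, fderiv ℝ (fderiv ℝ K) q (e i, 0) (e i, 0)
      - K q * LinearMap.trace ℝ E Ric - K q * ∑ i, ∑ j, k i j * k i j := by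
    rw [hval, htr]
    simp only [h.fderiv_sff_time hq h0, hsq, Finset.sum_add_distrib, Finset.sum_sub_distrib,
      Finset.mul_sum]
    have : ∀ i j, 2 * K q * k i j * sff G Γ Y N q (e i) (e j) =
        K q * (k i j * k i j) + K q * (k i j * k i j) := fun i j => by simp only [hk]; ring
    simp only [this, Finset.sum_add_distrib]
    ring
  have hhess : ∑ i, fderiv ℝ (fderiv ℝ K) q (e i, 0) (e i, 0) ≤ 0 :=
    Finset.sum_nonpos fun i _ => hmax (e i)
  -- Cauchy–Schwarz for the diagonal entries; the off-diagonal squares are dropped.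
  have hcs : K q ^ 2 / n ≤ ∑ i, ∑ j, k i j * k i j := by
    have h2 : K q ^ 2 ≤ n * ∑ i, k i i ^ 2 := by
      rw [hKq]
      simpa using sq_sum_le_card_mul_sum_sq (s := (Finset.univ : Finset (Fin n)))
        (f := fun i => k i i)
    have h3 : ∑ i, k i i ^ 2 ≤ ∑ i, ∑ j, k i j * k i j :=
      Finset.sum_le_sum fun i _ => by
        rw [pow_two]
        exact Finset.single_le_sum (f := fun j => k i j * k i j)
          (fun j _ => mul_self_nonneg _) (Finset.mem_univ i)
    exact (div_le_of_le_mul₀ (Nat.cast_nonneg n) (Finset.sum_nonneg fun i _ => sq_nonneg _)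
      (by rw [mul_comm]; exact h2)).trans h3
  have := mul_le_mul_of_nonneg_left hcs hpos
  rw [hsum]
  linarith

end IsNormalFlowOn

end Evolution

/-! ### Transformation of the Levi-Civita connection under a change of coordinates. -/

section ChangeOfCoordinates

variable {P E : Type*} [NormedAddCommGroup P] [NormedSpace ℝ P]
  [NormedAddCommGroup E] [NormedSpace ℝ E]

variable {Ω Ω' O : Set E} {G G' : E → E →L[ℝ] E →L[ℝ] ℝ} {Γ Γ' : E → E →L[ℝ] E →L[ℝ] E}

/-- The Koszul formula. -/
theorem IsLeviCivitaOn.koszul (h : IsLeviCivitaOn Ω G Γ) {z : E} (hz : z ∈ Ω) (u v w : E) :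
    2 * G z (Γ z u v) w = fderiv ℝ G z u v w + fderiv ℝ G z v u w - fderiv ℝ G z w u v := by
  rw [h.compat z hz, h.compat z hz, h.compat z hz, h.torsion_free z hz v u,
    h.torsion_free z hz w u, h.torsion_free z hz w v, h.symm z hz u, h.symm z hz v (Γ z u w)]
  ring

/-- The transformation law of a Levi-Civita connection under the change of coordinates `ψ`. -/
theorem IsLeviCivitaOn.conn_change (h : IsLeviCivitaOn Ω G Γ) (h' : IsLeviCivitaOn Ω' G' Γ')
    (hO : IsOpen O) {ψ : E → E} (hψ : ContDiffOn ℝ ∞ ψ O) (hO' : O ⊆ Ω') (hmaps : MapsTo ψ O Ω)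
    (hG : ∀ z ∈ O, ∀ v w, G' z v w = G (ψ z) (fderiv ℝ ψ z v) (fderiv ℝ ψ z w))
    {z : E} (hz : z ∈ O) (hsurj : Function.Surjective (fderiv ℝ ψ z))
    (hnd : ∀ v, (∀ w, G (ψ z) v w = 0) → v = 0) (u v : E) :
    fderiv ℝ ψ z (Γ' z u v) = fderiv ℝ (fderiv ℝ ψ) z u v +
      Γ (ψ z) (fderiv ℝ ψ z u) (fderiv ℝ ψ z v) := by
  set A : E → E → E := fun u v => covD Γ ψ (fun z' => fderiv ℝ ψ z' v) u z with hA
  have hAuv : fderiv ℝ (fderiv ℝ ψ) z u v + Γ (ψ z) (fderiv ℝ ψ z u) (fderiv ℝ ψ z v) = A u v := by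
    simp only [hA, covD, fderiv_fderiv_apply hψ hO hz]
  have hsymmA : ∀ u v, A u v = A v u := fun u v =>
    h.covD_fderiv_symm hO hψ hz (hmaps hz) u v
  have hd := hψ.diffAt hO hz
  have hdv := fun v : E => (hψ.fderiv_apply_const hO v).diffAt hO hz
  -- The derivative of the pulled-back metric obeys the compatibility rule with `A u v` in place of
  -- `dψ(Γ' u v)`. As `A` is symmetric, the Koszul formula for `Γ'` identifies the two after pairing
  -- with any `dψ(w)`.
  have hder : ∀ u v w, fderiv ℝ G' z u v w =
      G (ψ z) (A u v) (fderiv ℝ ψ z w) + G (ψ z) (fderiv ℝ ψ z v) (A u w) := by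
    intro u v w
    rw [← h.fderiv_inner (hmaps hz) hd (hdv v) (hdv w) u]
    have e : fderiv ℝ (fun z' => G' z' v w) z u = fderiv ℝ G' z u v w := by
      have hG' := h'.smooth_metric.diffAt h'.isOpen (hO' hz)
      have := (hG'.hasFDerivAt.clm_apply (hasFDerivAt_const v z)).clm_apply (hasFDerivAt_const w z)
      rw [this.fderiv]
      simp
    rw [← e, Filter.EventuallyEq.fderiv_eq
      (Filter.eventually_of_mem (hO.mem_nhds hz) fun z' hz' => hG z' hz' v w)]
  rw [hAuv, ← sub_eq_zero]
  apply hnd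
  intro w'
  obtain ⟨w, rfl⟩ := hsurj w'
  have hk := h'.koszul (hO' hz) u v w
  rw [hder, hder, hder, hG z hz, hsymmA v u, hsymmA w u, hsymmA w v,
    h.symm _ (hmaps hz) (fderiv ℝ ψ z u), h.symm _ (hmaps hz) (fderiv ℝ ψ z v) (A u w)] at hk
  rw [map_sub, sub_apply]
  linarith

/-- The inhomogeneous term in `conn_change` cancels the second derivative of `ψ` produced by
differentiating `dψ(V')`. Only germs at `q` matter, whence the eventual equalities. -/
theorem IsLeviCivitaOn.covD_change (h : IsLeviCivitaOn Ω G Γ) (h' : IsLeviCivitaOn Ω' G' Γ')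
    (hO : IsOpen O) {ψ : E → E} (hψ : ContDiffOn ℝ ∞ ψ O) (hO' : O ⊆ Ω') (hmaps : MapsTo ψ O Ω)
    (hG : ∀ z ∈ O, ∀ v w, G' z v w = G (ψ z) (fderiv ℝ ψ z v) (fderiv ℝ ψ z w))
    {Y Y' V V' : P → E} {q : P} (hz : Y' q ∈ O)
    (hsurj : Function.Surjective (fderiv ℝ ψ (Y' q)))
    (hnd : ∀ v, (∀ w, G (ψ (Y' q)) v w = 0) → v = 0)
    (hY : Y =ᶠ[𝓝 q] fun q' => ψ (Y' q')) (hV : V =ᶠ[𝓝 q] fun q' => fderiv ℝ ψ (Y' q') (V' q'))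
    (hY' : DifferentiableAt ℝ Y' q) (hV' : DifferentiableAt ℝ V' q) (ξ : P) :
    fderiv ℝ Y q ξ = fderiv ℝ ψ (Y' q) (fderiv ℝ Y' q ξ) ∧
    covD Γ Y V ξ q = fderiv ℝ ψ (Y' q) (covD Γ' Y' V' ξ q) := by
  have hd := (hψ.diffAt hO hz).hasFDerivAt.comp q hY'.hasFDerivAt
  have hd2 := ((hψ.fderiv_of_isOpen hO (m := ∞) (by simp)).diffAt hO hz).hasFDerivAt.comp q
    hY'.hasFDerivAt
  have hd3 := hd2.clm_apply hV'.hasFDerivAt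
  have e1 : fderiv ℝ Y q ξ = fderiv ℝ ψ (Y' q) (fderiv ℝ Y' q ξ) := by
    rw [hY.fderiv_eq]
    exact congrArg (fun f => f ξ) hd.fderiv
  have e2 : fderiv ℝ V q ξ = fderiv ℝ (fderiv ℝ ψ) (Y' q) (fderiv ℝ Y' q ξ) (V' q) +
      fderiv ℝ ψ (Y' q) (fderiv ℝ V' q ξ) := by
    rw [hV.fderiv_eq]
    refine (congrArg (fun f => f ξ) hd3.fderiv).trans ?_
    simp
    abel
  refine ⟨e1, ?_⟩
  rw [covD, covD, e1, e2, hV.eq_of_nhds, hY.eq_of_nhds, map_add,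
    h.conn_change h' hO hψ hO' hmaps hG hz hsurj hnd]
  abel

end ChangeOfCoordinates

/-! ### The unit normal as a smooth function of the tangent plane. -/

section Normal

variable {n : ℕ} {E F : Type*} [NormedAddCommGroup F] [NormedSpace ℝ F]
  [NormedAddCommGroup E] [NormedSpace ℝ E]

/-- The linear map `v ↦ (g(v, L ·), θ(v))`. -/
def normalSystem (g : E →L[ℝ] E →L[ℝ] ℝ) (θ : E →L[ℝ] ℝ) (L : F →L[ℝ] E) :
    E →L[ℝ] (F →L[ℝ] ℝ) × ℝ :=
  (ContinuousLinearMap.inl ℝ (F →L[ℝ] ℝ) ℝ).comp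
      (((ContinuousLinearMap.compL ℝ F E ℝ).flip L).comp g)
    + (ContinuousLinearMap.inr ℝ (F →L[ℝ] ℝ) ℝ).comp θ

/-- The vector orthogonal to the range of `L` with `θ = -1`. -/
def preNormal (g : E →L[ℝ] E →L[ℝ] ℝ) (θ : E →L[ℝ] ℝ) (L : F →L[ℝ] E) : E :=
  (normalSystem g θ L).inverse (0, -1)

/-- The unit normal to the range of `L` with `θ < 0`. -/
def unitNormal (g : E →L[ℝ] E →L[ℝ] ℝ) (θ : E →L[ℝ] ℝ) (L : F →L[ℝ] E) : E :=
  (Real.sqrt (-g (preNormal g θ L) (preNormal g θ L)))⁻¹ • preNormal g θ L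

/-- `N` is the unit normal with `θ(N) < 0` to the positive definite range of `L`. -/
structure IsUnitNormal (g : E →L[ℝ] E →L[ℝ] ℝ) (θ : E →L[ℝ] ℝ) (L : F →L[ℝ] E) (N : E) : Prop where
  symm : ∀ v w, g v w = g w v
  unit : g N N = -1
  orthogonal : ∀ a, g N (L a) = 0
  future : θ N < 0
  spacelike : ∀ a, a ≠ 0 → 0 < g (L a) (L a)

variable {g : E →L[ℝ] E →L[ℝ] ℝ} {θ : E →L[ℝ] ℝ} {L : F →L[ℝ] E} {N : E}

theorem normalSystem_apply (v : E) : normalSystem g θ L v = ((g v).comp L, θ v) := by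
  simp [normalSystem]

namespace IsUnitNormal

variable [FiniteDimensional ℝ E] [FiniteDimensional ℝ F]
  (h : IsUnitNormal g θ L N) (hdim : Module.finrank ℝ E = Module.finrank ℝ F + 1)
include h hdim

/-- Orthogonality and definiteness make the sum of the range of `L` and the line of `N` direct, and
its dimension is that of `E`. -/
theorem exists_decomp (v : E) : ∃ (a : F) (t : ℝ), v = L a + t • N := by
  let f : F × ℝ →ₗ[ℝ] E := L.toLinearMap.coprod (LinearMap.toSpanSingleton ℝ E N)
  have hinj : Function.Injective f := by
    rw [injective_iff_map_eq_zero]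
    rintro ⟨a, t⟩ h0
    have h0 : L a + t • N = 0 := h0
    have ht : t = 0 := by
      have := congrArg (g N) h0
      simpa [h.orthogonal, h.unit] using this
    rw [ht, zero_smul, add_zero] at h0
    have ha : a = 0 := by
      by_contra hne
      have := h.spacelike a hne
      simp [h0] at this
    rw [ha, ht, Prod.mk_zero_zero]
  have hsurj : Function.Surjective f :=
    (LinearMap.injective_iff_surjective_of_finrank_eq_finrank (by simp [hdim])).mp hinj
  obtain ⟨⟨a, t⟩, hat⟩ := hsurj v
  exact ⟨a, t, hat.symm⟩

theorem isInvertible : (normalSystem g θ L).IsInvertible := by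
  have hinj : Function.Injective (normalSystem g θ L).toLinearMap := by
    rw [injective_iff_map_eq_zero]
    intro v hv
    have hv : normalSystem g θ L v = 0 := hv
    rw [normalSystem_apply, Prod.mk_eq_zero] at hv
    obtain ⟨a, t, rfl⟩ := h.exists_decomp hdim v
    have h1 := congrArg (fun f => f a) hv.1
    have ha : a = 0 := by
      by_contra hne
      have := h.spacelike a hne
      simp [h.orthogonal] at h1
      linarith
    have h2 := hv.2
    simp only [ha, map_zero, zero_add, map_smul, smul_eq_mul, mul_eq_zero, h.future.ne,
      or_false] at h2
    simp [ha, h2]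
  have hfin : Module.finrank ℝ E = Module.finrank ℝ ((F →L[ℝ] ℝ) × ℝ) := by
    have : Module.finrank ℝ (F →L[ℝ] ℝ) = Module.finrank ℝ F := by
      rw [← (LinearMap.toContinuousLinearMap : (F →ₗ[ℝ] ℝ) ≃ₗ[ℝ] (F →L[ℝ] ℝ)).finrank_eq]
      exact Subspace.dual_finrank_eq
    simp [this, hdim]
  refine ⟨(LinearEquiv.ofInjectiveOfFinrankEq (normalSystem g θ L).toLinearMap
    hinj hfin).toContinuousLinearEquiv, ?_⟩
  ext v <;> rfl

theorem preNormal_eq : preNormal g θ L = (-(θ N)⁻¹) • N := by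
  obtain ⟨e, he⟩ := h.isInvertible hdim
  rw [preNormal, ← he, ContinuousLinearMap.inverse_equiv]
  rw [ContinuousLinearEquiv.coe_coe, ContinuousLinearEquiv.symm_apply_eq]
  have := normalSystem_apply (g := g) (θ := θ) (L := L) ((-(θ N)⁻¹) • N)
  rw [← he] at this
  refine Eq.trans ?_ this.symm
  have hne := h.future.ne
  ext a
  · simp [h.orthogonal]
  · simp [hne]

theorem inner_preNormal_neg : g (preNormal g θ L) (preNormal g θ L) < 0 := by
  rw [h.preNormal_eq hdim]
  simpa [h.unit] using h.future.ne

theorem unitNormal_eq : unitNormal g θ L = N := by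
  have hr : 0 < -(θ N)⁻¹ := by simpa using h.future
  rw [unitNormal, h.preNormal_eq hdim]
  have : -g ((-(θ N)⁻¹) • N) ((-(θ N)⁻¹) • N) = (-(θ N)⁻¹) ^ 2 := by
    simp [h.unit]; ring
  rw [this, Real.sqrt_sq hr.le, smul_smul, inv_mul_cancel₀ hr.ne', one_smul]

end IsUnitNormal

/-- Inversion is smooth near an invertible operator, and the square root is taken of a positive
number because the preliminary normal is timelike. The version within a set is needed at the end
times of the flow. -/
theorem contDiffWithinAt_unitNormal [FiniteDimensional ℝ E] [FiniteDimensional ℝ F]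
    {H : Type*} [NormedAddCommGroup H] [NormedSpace ℝ H] {g : H → E →L[ℝ] E →L[ℝ] ℝ}
    {θ : H → E →L[ℝ] ℝ} {L : H → F →L[ℝ] E} {s : Set H} {q : H} {k : ℕ∞}
    (hg : ContDiffWithinAt ℝ k g s q) (hθ : ContDiffWithinAt ℝ k θ s q)
    (hL : ContDiffWithinAt ℝ k L s q)
    {N : E} (h : IsUnitNormal (g q) (θ q) (L q) N)
    (hdim : Module.finrank ℝ E = Module.finrank ℝ F + 1) :
    ContDiffWithinAt ℝ k (fun q' => unitNormal (g q') (θ q') (L q')) s q := by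
  have : CompleteSpace E := FiniteDimensional.complete ℝ E
  have hsys : ContDiffWithinAt ℝ k (fun q' => normalSystem (g q') (θ q') (L q')) s q := by
    have h1 : ContDiffWithinAt ℝ k (fun q' => (ContinuousLinearMap.compL ℝ F E ℝ).flip (L q'))
        s q := (ContinuousLinearMap.contDiff _).comp_contDiffWithinAt hL
    have h2 := h1.clm_comp hg
    have h3 : ContDiffWithinAt ℝ k (fun q' => (ContinuousLinearMap.inl ℝ (F →L[ℝ] ℝ) ℝ).comp
        (((ContinuousLinearMap.compL ℝ F E ℝ).flip (L q')).comp (g q'))) s q :=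
      (contDiffWithinAt_const (c := ContinuousLinearMap.inl ℝ (F →L[ℝ] ℝ) ℝ)).clm_comp h2
    have h4 : ContDiffWithinAt ℝ k (fun q' => (ContinuousLinearMap.inr ℝ (F →L[ℝ] ℝ) ℝ).comp
        (θ q')) s q :=
      (contDiffWithinAt_const (c := ContinuousLinearMap.inr ℝ (F →L[ℝ] ℝ) ℝ)).clm_comp hθ
    exact h3.add h4
  have hpre : ContDiffWithinAt ℝ k (fun q' => preNormal (g q') (θ q') (L q')) s q := by
    obtain ⟨e, he⟩ := h.isInvertible hdim
    have hinv : ContDiffAt ℝ k ContinuousLinearMap.inverse (normalSystem (g q) (θ q) (L q)) := by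
      rw [← he]
      exact contDiffAt_map_inverse e
    exact (hinv.comp_contDiffWithinAt q hsys).clm_apply contDiffWithinAt_const
  have hneg := h.inner_preNormal_neg hdim
  have hsq := ((hg.clm_apply hpre).clm_apply hpre).neg
  have hsqrt := hsq.sqrt (neg_pos.mpr hneg).ne'
  exact (hsqrt.inv (Real.sqrt_pos.mpr (neg_pos.mpr hneg)).ne').smul hpre

end Normal

/-! ### Smoothness of the inverse matrix. -/

section MatrixInverse

variable {ι H : Type*} [Fintype ι] [DecidableEq ι] [NormedAddCommGroup H] [NormedSpace ℝ H]

theorem contDiffOn_det {A : H → Matrix ι ι ℝ} {s : Set H} {k : WithTop ℕ∞}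
    (hA : ∀ i j, ContDiffOn ℝ k (fun z => A z i j) s) : ContDiffOn ℝ k (fun z => (A z).det) s := by
  simp only [Matrix.det_apply']
  exact ContDiffOn.sum fun σ _ => contDiffOn_const.mul (contDiffOn_prod fun i _ => hA _ _)

/-- Cramer's rule: the entries are cofactors divided by the determinant. -/
theorem contDiffOn_matrix_inv {A : H → Matrix ι ι ℝ} {s : Set H} {k : WithTop ℕ∞}
    (hA : ∀ i j, ContDiffOn ℝ k (fun z => A z i j) s) (hdet : ∀ z ∈ s, IsUnit (A z).det)
    (i j : ι) : ContDiffOn ℝ k (fun z => (A z)⁻¹ i j) s := by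
  simp only [Matrix.inv_def, Matrix.smul_apply, Matrix.adjugate_apply, smul_eq_mul,
    Ring.inverse_eq_inv']
  refine ((contDiffOn_det hA).inv fun z hz => (hdet z hz).ne_zero).mul (contDiffOn_det ?_)
  intro a b
  by_cases h : a = j
  · subst h
    simp only [Matrix.updateRow_self]
    exact contDiffOn_const
  · simp only [Matrix.updateRow_ne h]
    exact hA a b

end MatrixInverse

/-! ### Charts, transition maps and the metric in coordinates. -/

section Charts

variable {m : ℕ} {M : Type*} [TopologicalSpace M] [ChartedSpace (EuclideanSpace ℝ (Fin m)) M]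

/-- The derivative of a chart at `p`. -/
def chartDeriv (c : OpenPartialHomeomorph M (EuclideanSpace ℝ (Fin m))) (p : M) :
    EuclideanSpace ℝ (Fin m) →L[ℝ] EuclideanSpace ℝ (Fin m) :=
  mfderiv (𝓡 m) (𝓡 m) c p

/-- The derivative of the inverse of a chart at `z`. -/
def chartSymmDeriv (c : OpenPartialHomeomorph M (EuclideanSpace ℝ (Fin m)))
    (z : EuclideanSpace ℝ (Fin m)) : EuclideanSpace ℝ (Fin m) →L[ℝ] EuclideanSpace ℝ (Fin m) :=
  mfderiv (𝓡 m) (𝓡 m) c.symm z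

variable [IsManifold (𝓡 m) ∞ M] {c c' : OpenPartialHomeomorph M (EuclideanSpace ℝ (Fin m))}

omit [IsManifold (𝓡 m) ∞ M] in
theorem coords_eq (p : M) (v : TangentSpace (𝓡 m) p) : coords c p v = chartDeriv c p v := rfl

theorem mdifferentiable_chart_of_mem (hc : c ∈ atlas (EuclideanSpace ℝ (Fin m)) M) :
    c.MDifferentiable (𝓡 m) (𝓡 m) :=
  have : IsManifold (𝓡 m) 1 M := IsManifold.of_le (n := ∞) (by exact mod_cast le_top)
  mdifferentiable_of_mem_atlas hc

theorem chartSymmDeriv_chartDeriv (hc : c ∈ atlas (EuclideanSpace ℝ (Fin m)) M) {p : M}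
    (hp : p ∈ c.source) (v : EuclideanSpace ℝ (Fin m)) :
    chartSymmDeriv c (c p) (chartDeriv c p v) = v :=
  congrArg (fun f => f v) ((mdifferentiable_chart_of_mem hc).symm_comp_deriv hp)

theorem chartDeriv_chartSymmDeriv (hc : c ∈ atlas (EuclideanSpace ℝ (Fin m)) M)
    {z : EuclideanSpace ℝ (Fin m)} (hz : z ∈ c.target) (v : EuclideanSpace ℝ (Fin m)) :
    chartDeriv c (c.symm z) (chartSymmDeriv c z v) = v :=
  congrArg (fun f => f v) ((mdifferentiable_chart_of_mem hc).comp_symm_deriv hz)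

theorem chartDeriv_chartSymmDeriv' (hc : c ∈ atlas (EuclideanSpace ℝ (Fin m)) M)
    {p : M} (hp : p ∈ c.source) (v : EuclideanSpace ℝ (Fin m)) :
    chartDeriv c p (chartSymmDeriv c (c p) v) = v := by
  have := chartDeriv_chartSymmDeriv hc (c.map_source hp) v
  rwa [c.left_inv hp] at this

theorem chartSymmDeriv_chartDeriv' (hc : c ∈ atlas (EuclideanSpace ℝ (Fin m)) M)
    {z : EuclideanSpace ℝ (Fin m)} (hz : z ∈ c.target) (v : EuclideanSpace ℝ (Fin m)) :
    chartSymmDeriv c z (chartDeriv c (c.symm z) v) = v := by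
  have := chartSymmDeriv_chartDeriv hc (c.map_target hz) v
  rwa [c.right_inv hz] at this

/-- The transition map from the chart `c'` to the chart `c`. -/
def transition (c' c : OpenPartialHomeomorph M (EuclideanSpace ℝ (Fin m))) :
    EuclideanSpace ℝ (Fin m) → EuclideanSpace ℝ (Fin m) := c ∘ c'.symm

/-- The domain of the transition map. -/
def transitionDomain (c' c : OpenPartialHomeomorph M (EuclideanSpace ℝ (Fin m))) :
    Set (EuclideanSpace ℝ (Fin m)) := (c'.symm.trans c).source

omit [ChartedSpace (EuclideanSpace ℝ (Fin m)) M] [IsManifold (𝓡 m) ∞ M] in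
theorem isOpen_transitionDomain : IsOpen (transitionDomain c' c) := (c'.symm.trans c).open_source

omit [ChartedSpace (EuclideanSpace ℝ (Fin m)) M] [IsManifold (𝓡 m) ∞ M] in
theorem mem_transitionDomain {z : EuclideanSpace ℝ (Fin m)} :
    z ∈ transitionDomain c' c ↔ z ∈ c'.target ∧ c'.symm z ∈ c.source := by
  simp [transitionDomain]

omit [ChartedSpace (EuclideanSpace ℝ (Fin m)) M] [IsManifold (𝓡 m) ∞ M] in
theorem map_mem_transitionDomain {p : M} (hp' : p ∈ c'.source) (hp : p ∈ c.source) :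
    c' p ∈ transitionDomain c' c := by
  rw [mem_transitionDomain, c'.left_inv hp']
  exact ⟨c'.map_source hp', hp⟩

theorem contMDiffOn_chart_of_mem (hc : c ∈ atlas (EuclideanSpace ℝ (Fin m)) M) :
    ContMDiffOn (𝓡 m) (𝓡 m) ∞ c c.source :=
  contMDiffOn_of_mem_maximalAtlas (IsManifold.subset_maximalAtlas hc)

theorem contMDiffOn_chart_symm_of_mem (hc : c ∈ atlas (EuclideanSpace ℝ (Fin m)) M) :
    ContMDiffOn (𝓡 m) (𝓡 m) ∞ c.symm c.target :=
  contMDiffOn_symm_of_mem_maximalAtlas (IsManifold.subset_maximalAtlas hc)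

theorem contDiffOn_transition (hc' : c' ∈ atlas (EuclideanSpace ℝ (Fin m)) M)
    (hc : c ∈ atlas (EuclideanSpace ℝ (Fin m)) M) :
    ContDiffOn ℝ ∞ (transition c' c) (transitionDomain c' c) := by
  rw [← contMDiffOn_iff_contDiffOn]
  refine (contMDiffOn_chart_of_mem hc).comp
    ((contMDiffOn_chart_symm_of_mem hc').mono fun z hz => (mem_transitionDomain.mp hz).1)
    fun z hz => (mem_transitionDomain.mp hz).2

theorem fderiv_transition (hc' : c' ∈ atlas (EuclideanSpace ℝ (Fin m)) M)
    (hc : c ∈ atlas (EuclideanSpace ℝ (Fin m)) M) {z : EuclideanSpace ℝ (Fin m)}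
    (hz : z ∈ transitionDomain c' c) (v : EuclideanSpace ℝ (Fin m)) :
    fderiv ℝ (transition c' c) z v = chartDeriv c (c'.symm z) (chartSymmDeriv c' z v) := by
  rw [← mfderiv_eq_fderiv, transition]
  rw [mem_transitionDomain] at hz
  have := mfderiv_comp z ((mdifferentiable_chart_of_mem hc).mdifferentiableAt hz.2)
    ((mdifferentiable_chart_of_mem hc').mdifferentiableAt_symm hz.1)
  exact congrArg (fun f => f v) this

theorem fderiv_transition_surjective (hc' : c' ∈ atlas (EuclideanSpace ℝ (Fin m)) M)
    (hc : c ∈ atlas (EuclideanSpace ℝ (Fin m)) M) {z : EuclideanSpace ℝ (Fin m)}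
    (hz : z ∈ transitionDomain c' c) : Function.Surjective (fderiv ℝ (transition c' c) z) := by
  intro w
  have hz' := mem_transitionDomain.mp hz
  refine ⟨chartDeriv c' (c'.symm z) (chartSymmDeriv c (c (c'.symm z)) w), ?_⟩
  rw [fderiv_transition hc' hc hz, chartSymmDeriv_chartDeriv' hc' hz'.1,
    chartDeriv_chartSymmDeriv' hc hz'.2]

variable (g : LorentzianMetric m M)

/-- The metric at `p`, as a bilinear form on `ℝᵐ`. -/
def metricForm (p : M) : EuclideanSpace ℝ (Fin m) →L[ℝ] EuclideanSpace ℝ (Fin m) →L[ℝ] ℝ := g.val p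

/-- The metric in the chart `c`. -/
def chartMetric (c : OpenPartialHomeomorph M (EuclideanSpace ℝ (Fin m)))
    (z : EuclideanSpace ℝ (Fin m)) :
    EuclideanSpace ℝ (Fin m) →L[ℝ] EuclideanSpace ℝ (Fin m) →L[ℝ] ℝ :=
  (metricForm g (c.symm z)).bilinearComp (chartSymmDeriv c z) (chartSymmDeriv c z)

theorem chartMetric_apply (z v w : EuclideanSpace ℝ (Fin m)) :
    chartMetric g c z v w = metricForm g (c.symm z) (chartSymmDeriv c z v) (chartSymmDeriv c z w) :=
  rfl

theorem metricMatrix_eq (z : EuclideanSpace ℝ (Fin m)) :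
    metricMatrix g c z = gram (fun u v => chartMetric g c z u v) stdVec := rfl

theorem chartMetric_chartDeriv (hc : c ∈ atlas (EuclideanSpace ℝ (Fin m)) M) {p : M}
    (hp : p ∈ c.source) (v w : EuclideanSpace ℝ (Fin m)) :
    chartMetric g c (c p) (chartDeriv c p v) (chartDeriv c p w) = metricForm g p v w := by
  rw [chartMetric_apply, chartSymmDeriv_chartDeriv hc hp, chartSymmDeriv_chartDeriv hc hp,
    c.left_inv hp]

theorem chartMetric_symm (z v w : EuclideanSpace ℝ (Fin m)) :
    chartMetric g c z v w = chartMetric g c z w v := g.symm _ _ _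

theorem chartMetric_nondegenerate (hc : c ∈ atlas (EuclideanSpace ℝ (Fin m)) M)
    {z : EuclideanSpace ℝ (Fin m)} (hz : z ∈ c.target) (v : EuclideanSpace ℝ (Fin m))
    (hv : ∀ w, chartMetric g c z v w = 0) : v = 0 := by
  have h : chartSymmDeriv c z v = 0 := by
    refine g.nondegenerate (c.symm z) fun (w : EuclideanSpace ℝ (Fin m)) => ?_
    have := hv (chartDeriv c (c.symm z) w)
    rwa [chartMetric_apply, chartSymmDeriv_chartDeriv' hc hz] at this
  rw [← chartDeriv_chartSymmDeriv hc hz v, h, map_zero]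

/-- The tangent map of the inverse chart applied to a constant vector field. -/
theorem contMDiffOn_chartSymmDeriv (hc : c ∈ atlas (EuclideanSpace ℝ (Fin m)) M)
    (v : EuclideanSpace ℝ (Fin m)) :
    ContMDiffOn (𝓡 m) (𝓡 m).tangent ∞
      (fun z => (⟨c.symm z, chartSymmDeriv c z v⟩ : TangentBundle (𝓡 m) M)) c.target := by
  have h1 := (contMDiffOn_chart_symm_of_mem hc).contMDiffOn_tangentMapWithin (m := ∞) (by simp)
    c.open_target.uniqueMDiffOn
  have h2 : ContMDiff (𝓡 m) (𝓡 m).tangent ∞ (fun z : EuclideanSpace ℝ (Fin m) =>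
      (⟨z, v⟩ : TangentBundle (𝓡 m) (EuclideanSpace ℝ (Fin m)))) :=
    contMDiff_vectorSpace_iff_contDiff.mpr contDiff_const
  refine (h1.comp h2.contMDiffOn (s := c.target) (fun z hz => hz)).congr fun z hz => ?_
  simp only [Function.comp_apply, tangentMapWithin, chartSymmDeriv]
  rw [mfderivWithin_of_isOpen c.open_target hz]
  rfl

/-- In finite dimension it is enough to evaluate on fixed vectors, that is, to evaluate the smooth
bundle section `g` on smooth coordinate fields. -/
theorem contDiffOn_chartMetric (hc : c ∈ atlas (EuclideanSpace ℝ (Fin m)) M) :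
    ContDiffOn ℝ ∞ (chartMetric g c) c.target := by
  rw [contDiffOn_clm_apply]
  intro v
  rw [contDiffOn_clm_apply]
  intro w
  have h1 := g.smooth.comp_contMDiffOn (contMDiffOn_chart_symm_of_mem hc)
  have h2 := ContMDiffOn.clm_bundle_apply₂ (F₁ := EuclideanSpace ℝ (Fin m))
    (F₂ := EuclideanSpace ℝ (Fin m)) (F₃ := ℝ) (E₃ := Bundle.Trivial M ℝ) (b := c.symm)
    (ψ := fun z => g.val (c.symm z)) h1
    (contMDiffOn_chartSymmDeriv hc v) (contMDiffOn_chartSymmDeriv hc w)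
  intro z hz
  have h3 := Bundle.contMDiffWithinAt_totalSpace.mp (h2 z hz)
  exact h3.2.contDiffWithinAt

/-- The covector `g(τ, ·)` in the chart `c`. -/
def timeForm (τ : TimeOrientation g) (c : OpenPartialHomeomorph M (EuclideanSpace ℝ (Fin m)))
    (z : EuclideanSpace ℝ (Fin m)) : EuclideanSpace ℝ (Fin m) →L[ℝ] ℝ :=
  (metricForm g (c.symm z) (τ.field (c.symm z))).comp (chartSymmDeriv c z)

theorem contDiffOn_timeForm (τ : TimeOrientation g)
    (hc : c ∈ atlas (EuclideanSpace ℝ (Fin m)) M) :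
    ContDiffOn ℝ ∞ (timeForm g τ c) c.target := by
  rw [contDiffOn_clm_apply]
  intro v
  have h1 := g.smooth.comp_contMDiffOn (contMDiffOn_chart_symm_of_mem hc)
  have h2 := ContMDiffOn.clm_bundle_apply₂ (F₁ := EuclideanSpace ℝ (Fin m))
    (F₂ := EuclideanSpace ℝ (Fin m)) (F₃ := ℝ) (E₃ := Bundle.Trivial M ℝ) (b := c.symm)
    (ψ := fun z => g.val (c.symm z)) h1
    (τ.smooth.comp_contMDiffOn (contMDiffOn_chart_symm_of_mem hc))
    (contMDiffOn_chartSymmDeriv hc v)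
  intro z hz
  have h3 := Bundle.contMDiffWithinAt_totalSpace.mp (h2 z hz)
  exact h3.2.contDiffWithinAt

end Charts

/-! ### Christoffel symbols define the Levi-Civita connection. -/

section ChartConnection

variable {m : ℕ} {M : Type*} [TopologicalSpace M] [ChartedSpace (EuclideanSpace ℝ (Fin m)) M]
  [IsManifold (𝓡 m) ∞ M] (g : LorentzianMetric m M)
  {c c' : OpenPartialHomeomorph M (EuclideanSpace ℝ (Fin m))}

/-- The Levi-Civita connection form in the chart `c`. -/
def chartConn (c : OpenPartialHomeomorph M (EuclideanSpace ℝ (Fin m)))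
    (z : EuclideanSpace ℝ (Fin m)) :
    EuclideanSpace ℝ (Fin m) →L[ℝ] EuclideanSpace ℝ (Fin m) →L[ℝ] EuclideanSpace ℝ (Fin m) :=
  ∑ k, ∑ i, ∑ j, christoffel g c k i j z •
    (EuclideanSpace.proj i : EuclideanSpace ℝ (Fin m) →L[ℝ] ℝ).smulRight
      ((EuclideanSpace.proj j : EuclideanSpace ℝ (Fin m) →L[ℝ] ℝ).smulRight (stdVec k))

theorem chartConn_apply (z u v : EuclideanSpace ℝ (Fin m)) :
    chartConn g c z u v = ∑ k, (∑ i, ∑ j, christoffel g c k i j z * u i * v j) • stdVec k := by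
  simp only [chartConn, FunLike.coe_sum, FunLike.coe_smul, Finset.sum_apply, Pi.smul_apply,
    ContinuousLinearMap.smulRight_apply, Finset.sum_smul]
  refine Finset.sum_congr rfl fun k _ => Finset.sum_congr rfl fun i _ =>
    Finset.sum_congr rfl fun j _ => ?_
  simp [smul_smul, mul_assoc]

theorem chartConn_coord (z u v : EuclideanSpace ℝ (Fin m)) (k : Fin m) :
    chartConn g c z u v k = ∑ i, ∑ j, christoffel g c k i j z * u i * v j := by
  rw [chartConn_apply]
  simp [Pi.single_apply]

theorem isUnit_det_metricMatrix (hc : c ∈ atlas (EuclideanSpace ℝ (Fin m)) M)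
    {z : EuclideanSpace ℝ (Fin m)} (hz : z ∈ c.target) : IsUnit (metricMatrix g c z).det := by
  rw [metricMatrix_eq]
  exact isUnit_det_gram_of_nondegenerate _ (chartMetric_symm g z)
    (chartMetric_nondegenerate g hc hz)

theorem contDiffOn_metricMatrix (hc : c ∈ atlas (EuclideanSpace ℝ (Fin m)) M) (i j : Fin m) :
    ContDiffOn ℝ ∞ (fun z => metricMatrix g c z i j) c.target :=
  ((contDiffOn_chartMetric g hc).clm_apply contDiffOn_const).clm_apply contDiffOn_const

theorem contDiffOn_christoffel (hc : c ∈ atlas (EuclideanSpace ℝ (Fin m)) M) (k i j : Fin m) :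
    ContDiffOn ℝ ∞ (christoffel g c k i j) c.target := by
  have hd : ∀ i j l, ContDiffOn ℝ ∞ (partialDeriv i fun z => metricMatrix g c z j l) c.target :=
    fun i j l => (contDiffOn_metricMatrix g hc j l).fderiv_apply_const c.open_target _
  refine contDiffOn_const.mul (ContDiffOn.sum fun l _ => ?_)
  exact (contDiffOn_matrix_inv (contDiffOn_metricMatrix g hc)
    (fun z hz => isUnit_det_metricMatrix g hc hz) k l).mul
    (((hd i j l).add (hd j i l)).sub (hd l i j))

theorem contDiffOn_chartConn (hc : c ∈ atlas (EuclideanSpace ℝ (Fin m)) M) :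
    ContDiffOn ℝ ∞ (chartConn g c) c.target := by
  rw [contDiffOn_clm_apply]
  intro u
  rw [contDiffOn_clm_apply]
  intro v
  simp only [chartConn_apply]
  exact ContDiffOn.sum fun k _ => (ContDiffOn.sum fun i _ => ContDiffOn.sum fun j _ =>
    ((contDiffOn_christoffel g hc k i j).mul contDiffOn_const).mul contDiffOn_const).smul
    contDiffOn_const

theorem partialDeriv_metricMatrix (hc : c ∈ atlas (EuclideanSpace ℝ (Fin m)) M)
    {z : EuclideanSpace ℝ (Fin m)} (hz : z ∈ c.target) (i j l : Fin m) :
    partialDeriv i (fun z => metricMatrix g c z j l) z =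
      fderiv ℝ (chartMetric g c) z (stdVec i) (stdVec j) (stdVec l) := by
  have hG := (contDiffOn_chartMetric g hc).diffAt c.open_target hz
  have := (hG.hasFDerivAt.clm_apply (hasFDerivAt_const (stdVec j) z)).clm_apply
    (hasFDerivAt_const (stdVec l) z)
  refine (congrArg (fun f => f (stdVec i)) this.fderiv).trans ?_
  simp

/-- The Koszul formula. Lowering the index in the definition of the Christoffel symbols cancels the
inverse metric on basis vectors, and trilinearity (`hC1`, `hC2`, `hC3`) gives the rest. -/
theorem chartMetric_chartConn (hc : c ∈ atlas (EuclideanSpace ℝ (Fin m)) M)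
    {z : EuclideanSpace ℝ (Fin m)} (hz : z ∈ c.target) (u v w : EuclideanSpace ℝ (Fin m)) :
    chartMetric g c z (chartConn g c z u v) w =
      (1 / 2) * (fderiv ℝ (chartMetric g c) z u v w + fderiv ℝ (chartMetric g c) z v u w
        - fderiv ℝ (chartMetric g c) z w u v) := by
  set D := fderiv ℝ (chartMetric g c) z with hD
  let C : EuclideanSpace ℝ (Fin m) → EuclideanSpace ℝ (Fin m) → EuclideanSpace ℝ (Fin m) → ℝ :=
    fun u v w => (1 / 2) * (D u v w + D v u w - D w u v)
  have hC1 : ∀ u v w, C u v w = ∑ i, u i * C (stdVec i) v w := fun u v w => by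
    simp only [C]
    conv_lhs => rw [← sum_coord_smul_stdVec u]
    simp only [map_sum, map_smul, FunLike.coe_sum, FunLike.coe_smul, Finset.sum_apply,
      Pi.smul_apply, smul_eq_mul, Finset.mul_sum, ← Finset.sum_add_distrib,
      ← Finset.sum_sub_distrib]
    exact Finset.sum_congr rfl fun _ _ => by ring
  have hC2 : ∀ u v w, C u v w = ∑ i, v i * C u (stdVec i) w := fun u v w => by
    simp only [C]
    conv_lhs => rw [← sum_coord_smul_stdVec v]
    simp only [map_sum, map_smul, FunLike.coe_sum, FunLike.coe_smul, Finset.sum_apply,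
      Pi.smul_apply, smul_eq_mul, Finset.mul_sum, ← Finset.sum_add_distrib,
      ← Finset.sum_sub_distrib]
    exact Finset.sum_congr rfl fun _ _ => by ring
  have hC3 : ∀ u v w, C u v w = ∑ i, w i * C u v (stdVec i) := fun u v w => by
    simp only [C]
    conv_lhs => rw [← sum_coord_smul_stdVec w]
    simp only [map_sum, map_smul, FunLike.coe_sum, FunLike.coe_smul, Finset.sum_apply,
      Pi.smul_apply, smul_eq_mul, Finset.mul_sum, ← Finset.sum_add_distrib,
      ← Finset.sum_sub_distrib]
    exact Finset.sum_congr rfl fun _ _ => by ring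
  have hchr : ∀ k i j, christoffel g c k i j z =
      ∑ l, (metricMatrix g c z)⁻¹ k l * C (stdVec i) (stdVec j) (stdVec l) := fun k i j => by
    simp only [christoffel, partialDeriv_metricMatrix g hc hz, Finset.mul_sum, C]
    exact Finset.sum_congr rfl fun _ _ => by ring
  have hconn : chartConn g c z u v =
      ∑ k, (∑ l, (metricMatrix g c z)⁻¹ k l * C u v (stdVec l)) • stdVec k := by
    rw [chartConn_apply]
    refine Finset.sum_congr rfl fun k _ => ?_
    congr 1
    simp only [hchr, Finset.sum_mul]
    have : ∀ i, ∑ j, ∑ l, (metricMatrix g c z)⁻¹ k l * C (stdVec i) (stdVec j) (stdVec l) *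
        u i * v j = ∑ l, (metricMatrix g c z)⁻¹ k l * (u i * C (stdVec i) v (stdVec l)) := by
      intro i
      rw [Finset.sum_comm]
      refine Finset.sum_congr rfl fun l _ => ?_
      rw [hC2 (stdVec i) v, Finset.mul_sum, Finset.mul_sum]
      exact Finset.sum_congr rfl fun _ _ => by ring
    rw [Finset.sum_congr rfl fun i _ => this i, Finset.sum_comm]
    refine Finset.sum_congr rfl fun l _ => ?_
    rw [hC1 u v, Finset.mul_sum]
  have hbase : ∀ i, chartMetric g c z (chartConn g c z u v) (stdVec i) = C u v (stdVec i) := by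
    intro i
    rw [hconn]
    simp only [map_sum, map_smul, FunLike.coe_sum, FunLike.coe_smul, Finset.sum_apply,
      Pi.smul_apply, smul_eq_mul, Finset.sum_mul]
    rw [Finset.sum_comm]
    have : ∀ l, ∑ k, (metricMatrix g c z)⁻¹ k l * C u v (stdVec l) *
        chartMetric g c z (stdVec k) (stdVec i) =
        C u v (stdVec l) * (metricMatrix g c z * (metricMatrix g c z)⁻¹) i l := by
      intro l
      rw [Matrix.mul_apply, Finset.mul_sum]
      refine Finset.sum_congr rfl fun k _ => ?_
      rw [metricMatrix_eq, chartMetric_symm g z (stdVec k)]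
      simp only [gram, Matrix.of_apply]
      ring
    rw [Finset.sum_congr rfl fun l _ => this l,
      Matrix.mul_nonsing_inv _ (isUnit_det_metricMatrix g hc hz)]
    simp [Matrix.one_apply]
  have : C u v w = (1 / 2) * (D u v w + D v u w - D w u v) := rfl
  rw [← this, hC3 u v w]
  conv_lhs => rw [← sum_coord_smul_stdVec w]
  simp only [map_sum, map_smul, smul_eq_mul, hbase]

theorem fderiv_chartMetric_symm (hc : c ∈ atlas (EuclideanSpace ℝ (Fin m)) M)
    {z : EuclideanSpace ℝ (Fin m)} (hz : z ∈ c.target) (w u v : EuclideanSpace ℝ (Fin m)) :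
    fderiv ℝ (chartMetric g c) z w u v = fderiv ℝ (chartMetric g c) z w v u := by
  have hG := (contDiffOn_chartMetric g hc).diffAt c.open_target hz
  have h1 : ∀ u v, fderiv ℝ (fun z => chartMetric g c z u v) z w =
      fderiv ℝ (chartMetric g c) z w u v := fun u v => by
    rw [((hG.hasFDerivAt.clm_apply (hasFDerivAt_const u z)).clm_apply
      (hasFDerivAt_const v z)).fderiv]
    simp
  rw [← h1, ← h1]
  simp only [chartMetric_symm g _ u v]

/-- Vanishing torsion and compatibility both come from the Koszul formula and the symmetry of the
differentiated metric, the former with the help of nondegeneracy. -/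
theorem isLeviCivitaOn_chart (hc : c ∈ atlas (EuclideanSpace ℝ (Fin m)) M) :
    IsLeviCivitaOn c.target (chartMetric g c) (chartConn g c) where
  isOpen := c.open_target
  smooth_metric := contDiffOn_chartMetric g hc
  smooth_conn := contDiffOn_chartConn g hc
  symm := fun z _ => chartMetric_symm g z
  torsion_free := fun z hz u v => by
    rw [← sub_eq_zero]
    refine chartMetric_nondegenerate g hc hz _ fun w => ?_
    rw [map_sub, sub_apply, chartMetric_chartConn g hc hz, chartMetric_chartConn g hc hz,
      fderiv_chartMetric_symm g hc hz w u v]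
    ring
  compat := fun z hz u v w => by
    rw [chartMetric_symm g z v, chartMetric_chartConn g hc hz, chartMetric_chartConn g hc hz,
      fderiv_chartMetric_symm g hc hz u w v]
    ring

theorem chartMetric_transition (hc' : c' ∈ atlas (EuclideanSpace ℝ (Fin m)) M)
    (hc : c ∈ atlas (EuclideanSpace ℝ (Fin m)) M) {z : EuclideanSpace ℝ (Fin m)}
    (hz : z ∈ transitionDomain c' c) (v w : EuclideanSpace ℝ (Fin m)) :
    chartMetric g c' z v w = chartMetric g c (transition c' c z)
      (fderiv ℝ (transition c' c) z v) (fderiv ℝ (transition c' c) z w) := by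
  have hz' := mem_transitionDomain.mp hz
  rw [fderiv_transition hc' hc hz, fderiv_transition hc' hc hz, transition, Function.comp_apply,
    chartMetric_chartDeriv g hc hz'.2]
  rfl

end ChartConnection

/-! ### Covariant derivative and mean curvature of a hypersurface in coordinates. -/

section Localization

variable {m n : ℕ} {M : Type*} [TopologicalSpace M] [ChartedSpace (EuclideanSpace ℝ (Fin m)) M]
  [IsManifold (𝓡 m) ∞ M] (g : LorentzianMetric m M)
  {S : Type*} [TopologicalSpace S] [ChartedSpace (EuclideanSpace ℝ (Fin n)) S]
  [IsManifold (𝓡 n) ∞ S]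
  {c c' : OpenPartialHomeomorph M (EuclideanSpace ℝ (Fin m))}
  {φ : OpenPartialHomeomorph S (EuclideanSpace ℝ (Fin n))} {f : S → M}
  {ν : ∀ x : S, TangentSpace (𝓡 m) (f x)}

/-- The coordinate expression of `f : S → M`. -/
def localMap (φ : OpenPartialHomeomorph S (EuclideanSpace ℝ (Fin n)))
    (c : OpenPartialHomeomorph M (EuclideanSpace ℝ (Fin m))) (f : S → M)
    (u : EuclideanSpace ℝ (Fin n)) : EuclideanSpace ℝ (Fin m) := c (f (φ.symm u))

/-- The coordinate expression of a vector field along `f : S → M`. -/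
def localField (φ : OpenPartialHomeomorph S (EuclideanSpace ℝ (Fin n)))
    (c : OpenPartialHomeomorph M (EuclideanSpace ℝ (Fin m))) (f : S → M)
    (ν : ∀ x : S, TangentSpace (𝓡 m) (f x))
    (u : EuclideanSpace ℝ (Fin n)) : EuclideanSpace ℝ (Fin m) :=
  chartDeriv c (f (φ.symm u)) (ν (φ.symm u))

theorem mdifferentiableAt_localMap (hφ : φ ∈ atlas (EuclideanSpace ℝ (Fin n)) S)
    (hc : c ∈ atlas (EuclideanSpace ℝ (Fin m)) M) {x : S} (hx : x ∈ φ.source)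
    (hf : MDifferentiableAt (𝓡 n) (𝓡 m) f x) (hfx : f x ∈ c.source) :
    DifferentiableAt ℝ (localMap φ c f) (φ x) := by
  rw [← mdifferentiableAt_iff_differentiableAt]
  have h1 := (mdifferentiable_chart_of_mem hφ).mdifferentiableAt_symm (φ.map_source hx)
  have hf' : MDifferentiableAt (𝓡 n) (𝓡 m) f (φ.symm (φ x)) := by rwa [φ.left_inv hx]
  have h2 := hf'.comp (φ x) h1
  have h3 : MDifferentiableAt (𝓡 m) (𝓡 m) c ((f ∘ φ.symm) (φ x)) := by
    rw [Function.comp_apply, φ.left_inv hx]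
    exact (mdifferentiable_chart_of_mem hc).mdifferentiableAt hfx
  exact h3.comp (φ x) h2

/-- The differential of `f` in coordinates. -/
theorem chartDeriv_mfderiv (hφ : φ ∈ atlas (EuclideanSpace ℝ (Fin n)) S)
    (hc : c ∈ atlas (EuclideanSpace ℝ (Fin m)) M) {x : S} (hx : x ∈ φ.source)
    (hf : MDifferentiableAt (𝓡 n) (𝓡 m) f x) (hfx : f x ∈ c.source)
    (a : EuclideanSpace ℝ (Fin n)) :
    chartDeriv c (f x) (mfderiv (𝓡 n) (𝓡 m) f x a) =
      fderiv ℝ (localMap φ c f) (φ x) (chartDeriv φ x a) := by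
  have h1 := mfderiv_comp x ((mdifferentiable_chart_of_mem hc).mdifferentiableAt hfx) hf
  have h2 := mfderiv_comp x (g := localMap φ c f) (f := φ)
    (mdifferentiableAt_iff_differentiableAt.mpr (mdifferentiableAt_localMap hφ hc hx hf hfx))
    ((mdifferentiable_chart_of_mem hφ).mdifferentiableAt hx)
  have h3 : c ∘ f =ᶠ[𝓝 x] localMap φ c f ∘ φ :=
    Filter.eventually_of_mem (φ.open_source.mem_nhds hx) fun x' hx' => by
      simp [localMap, φ.left_inv hx']
  rw [h3.mfderiv_eq, h2, mfderiv_eq_fderiv] at h1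
  exact (congrArg (fun f => f a) h1).symm

theorem inducedMetric_eq (hφ : φ ∈ atlas (EuclideanSpace ℝ (Fin n)) S)
    (hc : c ∈ atlas (EuclideanSpace ℝ (Fin m)) M) {x : S} (hx : x ∈ φ.source)
    (hf : MDifferentiableAt (𝓡 n) (𝓡 m) f x) (hfx : f x ∈ c.source)
    (a b : EuclideanSpace ℝ (Fin n)) :
    inducedMetric (n := n) g f x a b = chartMetric g c (localMap φ c f (φ x))
      (fderiv ℝ (localMap φ c f) (φ x) (chartDeriv φ x a))
      (fderiv ℝ (localMap φ c f) (φ x) (chartDeriv φ x b)) := by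
  rw [← chartDeriv_mfderiv hφ hc hx hf hfx, ← chartDeriv_mfderiv hφ hc hx hf hfx, localMap,
    φ.left_inv hx]
  exact (chartMetric_chartDeriv g hc hfx _ _).symm

theorem inverse_mfderiv_chart (hc : c ∈ atlas (EuclideanSpace ℝ (Fin m)) M) {p : M}
    (hp : p ∈ c.source) (w : EuclideanSpace ℝ (Fin m)) :
    (mfderiv (𝓡 m) (𝓡 m) c p).inverse w = chartSymmDeriv c (c p) w := by
  have h : mfderiv (𝓡 m) (𝓡 m) c p = ((mdifferentiable_chart_of_mem hc).mfderiv hp :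
    TangentSpace (𝓡 m) p →L[ℝ] TangentSpace (𝓡 m) (c p)) := rfl
  rw [h, ContinuousLinearMap.inverse_equiv]
  rfl

theorem covDerivAlong_eq (hφ : φ ∈ atlas (EuclideanSpace ℝ (Fin n)) S) {x : S}
    (hx : x ∈ φ.source) (hf : MDifferentiableAt (𝓡 n) (𝓡 m) f x)
    (hν : DifferentiableAt ℝ (localField φ (chartAt (EuclideanSpace ℝ (Fin m)) (f x)) f ν) (φ x))
    (a : EuclideanSpace ℝ (Fin n)) :
    chartDeriv (chartAt (EuclideanSpace ℝ (Fin m)) (f x)) (f x)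
      (covDerivAlong (n := n) g f ν x a) =
    covD (chartConn g (chartAt (EuclideanSpace ℝ (Fin m)) (f x)))
      (localMap φ (chartAt (EuclideanSpace ℝ (Fin m)) (f x)) f)
      (localField φ (chartAt (EuclideanSpace ℝ (Fin m)) (f x)) f ν) (chartDeriv φ x a) (φ x) := by
  set c := chartAt (EuclideanSpace ℝ (Fin m)) (f x) with hcdef
  have hc : c ∈ atlas (EuclideanSpace ℝ (Fin m)) M := chart_mem_atlas _ _
  have hfx : f x ∈ c.source := mem_chart_source _ _
  have hV : mfderiv (𝓡 n) (𝓡 m) (fun x' => coords c (f x') (ν x')) x a =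
      fderiv ℝ (localField φ c f ν) (φ x) (chartDeriv φ x a) := by
    have h2 := mfderiv_comp x (g := localField φ c f ν) (f := φ)
      (mdifferentiableAt_iff_differentiableAt.mpr hν)
      ((mdifferentiable_chart_of_mem hφ).mdifferentiableAt hx)
    have h3 : (fun x' => coords c (f x') (ν x')) =ᶠ[𝓝 x] localField φ c f ν ∘ φ :=
      Filter.eventually_of_mem (φ.open_source.mem_nhds hx) fun x' hx' => by
        simp only [localField, Function.comp_apply, coords_eq]
        rw [φ.left_inv hx']
    rw [h3.mfderiv_eq, h2, mfderiv_eq_fderiv]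
    rfl
  have hdf : coords c (f x) (mfderiv (𝓡 n) (𝓡 m) f x a) =
      fderiv ℝ (localMap φ c f) (φ x) (chartDeriv φ x a) :=
    chartDeriv_mfderiv hφ hc hx hf hfx a
  have hcov : covDerivAlong (n := n) g f ν x a = chartSymmDeriv c (c (f x))
      (covD (chartConn g c) (localMap φ c f) (localField φ c f ν) (chartDeriv φ x a) (φ x)) := by
    set W := covD (chartConn g c) (localMap φ c f) (localField φ c f ν) (chartDeriv φ x a) (φ x)
      with hW
    have e1 : localMap φ c f (φ x) = c (f x) := by rw [localMap, φ.left_inv hx]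
    have e2 : localField φ c f ν (φ x) = coords c (f x) (ν x) := by
      rw [localField, φ.left_inv hx]; rfl
    rw [covD, e1, e2, ← hdf, ← hV] at hW
    -- Stated for free `d`, `z`, `u`, `v` to read off coordinates while avoiding rewriting under the
    -- tangent-space types.
    have hcoord : ∀ d z u v : EuclideanSpace ℝ (Fin m), W = d + chartConn g c z u v →
        ∀ k, W k = d k + ∑ i, ∑ j, christoffel g c k i j z * u i * v j := by
      intro d z u v h k
      rw [h, PiLp.add_apply, chartConn_coord]
    rw [← sum_coord_smul_stdVec W, map_sum]
    refine Finset.sum_congr rfl fun k _ => ?_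
    rw [map_smul, hcoord _ _ _ _ hW k]
    exact congrArg (_ • ·) (inverse_mfderiv_chart hc hfx _)
  rw [hcov, chartDeriv_chartSymmDeriv' hc hfx]

/-- The mean curvature in arbitrary charts of the hypersurface and of the ambient manifold. -/
theorem meanCurvature_eq (hφ : φ ∈ atlas (EuclideanSpace ℝ (Fin n)) S)
    (hc : c ∈ atlas (EuclideanSpace ℝ (Fin m)) M) {x : S} (hx : x ∈ φ.source)
    (hf : ∀ᶠ x' in 𝓝 x, MDifferentiableAt (𝓡 n) (𝓡 m) f x') (hfx : f x ∈ c.source)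
    (hν : DifferentiableAt ℝ (localField φ (chartAt (EuclideanSpace ℝ (Fin m)) (f x)) f ν) (φ x)) :
    meanCurvature g n f ν x = metricTrace
      (fun a b => chartMetric g c (localMap φ c f (φ x))
        (fderiv ℝ (localMap φ c f) (φ x) a) (fderiv ℝ (localMap φ c f) (φ x) b))
      (fun a b => chartMetric g c (localMap φ c f (φ x))
        (covD (chartConn g c) (localMap φ c f) (localField φ c f ν) a (φ x))
        (fderiv ℝ (localMap φ c f) (φ x) b)) := by
  set c' := chartAt (EuclideanSpace ℝ (Fin m)) (f x) with hcdef
  have hc' : c' ∈ atlas (EuclideanSpace ℝ (Fin m)) M := chart_mem_atlas _ _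
  have hfx' : f x ∈ c'.source := mem_chart_source _ _
  have hfd := hf.self_of_nhds
  have hY' : localMap φ c' f (φ x) = c' (f x) := by rw [localMap, φ.left_inv hx]
  have hz : localMap φ c' f (φ x) ∈ transitionDomain c' c := by
    rw [hY']
    exact map_mem_transitionDomain hfx' hfx
  have hYd' := mdifferentiableAt_localMap hφ hc' hx hfd hfx'
  have hYz : transition c' c (localMap φ c' f (φ x)) = localMap φ c f (φ x) := by
    rw [hY', transition, Function.comp_apply, c'.left_inv hfx', localMap, φ.left_inv hx]
  have hnear : ∀ᶠ u in 𝓝 (φ x), f (φ.symm u) ∈ c'.source ∧ f (φ.symm u) ∈ c.source := by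
    have hcont : ContinuousAt (fun u => f (φ.symm u)) (φ x) := by
      refine ContinuousAt.comp (f := φ.symm) ?_ (φ.continuousAt_symm (φ.map_source hx))
      rw [φ.left_inv hx]
      exact hfd.continuousAt
    refine hcont.eventually_mem (f := fun u => f (φ.symm u))
      (s := c'.source ∩ c.source) ?_
    simp only [φ.left_inv hx]
    exact (c'.open_source.inter c.open_source).mem_nhds ⟨hfx', hfx⟩
  have hYe : localMap φ c f =ᶠ[𝓝 (φ x)] fun u => transition c' c (localMap φ c' f u) :=
    hnear.mono fun u hu => by
      simp only [localMap, transition, Function.comp_apply, c'.left_inv hu.1]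
  have hNe : localField φ c f ν =ᶠ[𝓝 (φ x)] fun u =>
      fderiv ℝ (transition c' c) (localMap φ c' f u) (localField φ c' f ν u) :=
    hnear.mono fun u hu => by
      simp only [localField, localMap]
      rw [fderiv_transition hc' hc (map_mem_transitionDomain hu.1 hu.2),
        c'.left_inv hu.1]
      exact congrArg _ (chartSymmDeriv_chartDeriv hc' hu.1 _).symm
  -- The definition uses the preferred chart `c'` at `f x`, which varies with `x`; tensoriality
  -- moves the computation to the fixed chart `c`.
  have hchange := (isLeviCivitaOn_chart g hc).covD_change (isLeviCivitaOn_chart g hc')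
    isOpen_transitionDomain (contDiffOn_transition hc' hc)
    (fun z hz => (mem_transitionDomain.mp hz).1)
    (fun z hz => c.map_source (mem_transitionDomain.mp hz).2)
    (fun z hz => chartMetric_transition g hc' hc hz) hz
    (fderiv_transition_surjective hc' hc hz)
    (chartMetric_nondegenerate g hc (c.map_source (mem_transitionDomain.mp hz).2))
    hYe hNe hYd' hν
  have hK : ∀ a b : EuclideanSpace ℝ (Fin n), extrinsicCurvature (n := n) g f ν x a b =
      chartMetric g c (localMap φ c f (φ x))
        (covD (chartConn g c) (localMap φ c f) (localField φ c f ν) (chartDeriv φ x a) (φ x))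
        (fderiv ℝ (localMap φ c f) (φ x) (chartDeriv φ x b)) := by
    intro a b
    rw [(hchange _).2, (hchange _).1, ← hYz, ← chartMetric_transition g hc' hc hz,
      ← covDerivAlong_eq g hφ hx hfd hν, ← chartDeriv_mfderiv hφ hc' hx hfd hfx', hY']
    exact (chartMetric_chartDeriv g hc' hfx' _ _).symm
  -- The chart of `S` enters only through this isomorphism, which the trace does not see; `D`
  -- presents `∇ν` as a linear map so that `metricTrace_comp_equiv` applies.
  let A : EuclideanSpace ℝ (Fin n) ≃L[ℝ] EuclideanSpace ℝ (Fin n) :=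
    (mdifferentiable_chart_of_mem hφ).mfderiv hx
  have hA : ∀ a, A a = chartDeriv φ x a := fun a => rfl
  let D : EuclideanSpace ℝ (Fin n) →L[ℝ] EuclideanSpace ℝ (Fin m) :=
    fderiv ℝ (localField φ c f ν) (φ x) +
      ((chartConn g c (localMap φ c f (φ x))).flip (localField φ c f ν (φ x))).comp
        (fderiv ℝ (localMap φ c f) (φ x))
  have hD : ∀ a, covD (chartConn g c) (localMap φ c f) (localField φ c f ν) a (φ x) = D a :=
    fun a => rfl
  have htr := metricTrace_comp_equiv (chartMetric g c (localMap φ c f (φ x)))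
    (chartMetric g c (localMap φ c f (φ x))) (fderiv ℝ (localMap φ c f) (φ x)) D A
  simp only [hD]
  rw [← htr, meanCurvature]
  simp only [hA, ← hD]
  congr 1
  · funext a b
    exact inducedMetric_eq g hφ hc hx hfd hfx a b
  · funext a b
    exact hK a b

end Localization

/-! ### Regularity of the normal and of the mean curvature on a single hypersurface. -/

section Slices

variable {n : ℕ} {M : Type*} [TopologicalSpace M]
  [ChartedSpace (EuclideanSpace ℝ (Fin (n + 1))) M]
  [IsManifold (𝓡 (n + 1)) ∞ M] {g : LorentzianMetric (n + 1) M} {τ : TimeOrientation g}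
  {S : Type*} [TopologicalSpace S] [ChartedSpace (EuclideanSpace ℝ (Fin n)) S]
  [IsManifold (𝓡 n) ∞ S]
  {c : OpenPartialHomeomorph M (EuclideanSpace ℝ (Fin (n + 1)))}
  {φ : OpenPartialHomeomorph S (EuclideanSpace ℝ (Fin n))} {f : S → M}
  {ν : ∀ x : S, TangentSpace (𝓡 (n + 1)) (f x)}

theorem isUnitNormal_local (hsp : IsSpacelike g n f) (hN : IsFutureUnitNormal τ n f ν)
    (hφ : φ ∈ atlas (EuclideanSpace ℝ (Fin n)) S)
    (hc : c ∈ atlas (EuclideanSpace ℝ (Fin (n + 1))) M) {u : EuclideanSpace ℝ (Fin n)}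
    (hu : u ∈ φ.target) (hf : MDifferentiableAt (𝓡 n) (𝓡 (n + 1)) f (φ.symm u))
    (hfu : f (φ.symm u) ∈ c.source) :
    IsUnitNormal (chartMetric g c (localMap φ c f u)) (timeForm g τ c (localMap φ c f u))
      (fderiv ℝ (localMap φ c f) u) (localField φ c f ν u) := by
  have hder : ∀ a, fderiv ℝ (localMap φ c f) u a = chartDeriv c (f (φ.symm u))
      (mfderiv (𝓡 n) (𝓡 (n + 1)) f (φ.symm u) (chartSymmDeriv φ u a)) := by
    intro a
    refine Eq.trans ?_ (chartDeriv_mfderiv hφ hc (φ.map_target hu) hf hfu _).symm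
    rw [φ.right_inv hu, chartDeriv_chartSymmDeriv hφ hu]
  constructor
  · exact chartMetric_symm g _
  · exact (chartMetric_chartDeriv g hc hfu _ _).trans (hN.unit _)
  · intro a
    rw [hder]
    exact (chartMetric_chartDeriv g hc hfu _ _).trans (hN.orthogonal _ _)
  · have h : timeForm g τ c (localMap φ c f u) (localField φ c f ν u) =
        g.val (f (φ.symm u)) (τ.field (f (φ.symm u))) (ν (φ.symm u)) := by
      have h1 : ∀ v, timeForm g τ c (localMap φ c f u) (chartDeriv c (f (φ.symm u)) v) =
          metricForm g (f (φ.symm u)) (τ.field (f (φ.symm u))) v := by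
        intro v
        simp only [timeForm, localMap, ContinuousLinearMap.comp_apply]
        rw [chartSymmDeriv_chartDeriv hc hfu, c.left_inv hfu]
      exact h1 _
    rw [h]
    exact (hN.future _).2
  · intro a ha
    rw [hder]
    refine lt_of_lt_of_eq (hsp (φ.symm u) (chartSymmDeriv φ u a) ?_)
      (chartMetric_chartDeriv g hc hfu _ _).symm
    intro h0
    apply ha
    rw [← chartDeriv_chartSymmDeriv hφ hu a]
    exact (congrArg _ h0).trans (map_zero _)

/-- The domain of the coordinate expression of `f`. -/
def localDomain (φ : OpenPartialHomeomorph S (EuclideanSpace ℝ (Fin n)))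
    (c : OpenPartialHomeomorph M (EuclideanSpace ℝ (Fin (n + 1)))) (f : S → M) :
    Set (EuclideanSpace ℝ (Fin n)) := φ.target ∩ φ.symm ⁻¹' (f ⁻¹' c.source)

omit [ChartedSpace (EuclideanSpace ℝ (Fin (n + 1))) M] [IsManifold (𝓡 (n + 1)) ∞ M]
  [ChartedSpace (EuclideanSpace ℝ (Fin n)) S] [IsManifold (𝓡 n) ∞ S] in
theorem isOpen_localDomain (hf : Continuous f) : IsOpen (localDomain φ c f) :=
  φ.isOpen_inter_preimage_symm (c.open_source.preimage hf)

theorem contDiffOn_localMap (hf : ContMDiff (𝓡 n) (𝓡 (n + 1)) ∞ f)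
    (hφ : φ ∈ atlas (EuclideanSpace ℝ (Fin n)) S)
    (hc : c ∈ atlas (EuclideanSpace ℝ (Fin (n + 1))) M) :
    ContDiffOn ℝ ∞ (localMap φ c f) (localDomain φ c f) := by
  rw [← contMDiffOn_iff_contDiffOn]
  exact (contMDiffOn_chart_of_mem hc).comp
    (hf.comp_contMDiffOn ((contMDiffOn_chart_symm_of_mem hφ).mono inter_subset_left))
    fun u hu => hu.2

theorem contDiffOn_localField (hf : ContMDiff (𝓡 n) (𝓡 (n + 1)) ∞ f) (hsp : IsSpacelike g n f)
    (hN : IsFutureUnitNormal τ n f ν)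
    (hφ : φ ∈ atlas (EuclideanSpace ℝ (Fin n)) S)
    (hc : c ∈ atlas (EuclideanSpace ℝ (Fin (n + 1))) M) :
    ContDiffOn ℝ ∞ (localField φ c f ν) (localDomain φ c f) := by
  have hY := contDiffOn_localMap hf hφ hc
  have hopen := isOpen_localDomain (φ := φ) (c := c) hf.continuous
  have hmaps : MapsTo (localMap φ c f) (localDomain φ c f) c.target :=
    fun u hu => c.map_source hu.2
  have hunit := fun u (hu : u ∈ localDomain φ c f) => isUnitNormal_local hsp hN hφ hc hu.1
    (hf.mdifferentiableAt (by simp)) hu.2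
  have hdim : Module.finrank ℝ (EuclideanSpace ℝ (Fin (n + 1))) =
    Module.finrank ℝ (EuclideanSpace ℝ (Fin n)) + 1 := by simp
  refine ContDiffOn.congr (f := fun u => unitNormal (chartMetric g c (localMap φ c f u))
    (timeForm g τ c (localMap φ c f u)) (fderiv ℝ (localMap φ c f) u)) ?_
    fun u hu => ((hunit u hu).unitNormal_eq hdim).symm
  intro u hu
  exact contDiffWithinAt_unitNormal (((contDiffOn_chartMetric g hc).comp hY hmaps) u hu)
    (((contDiffOn_timeForm g τ hc).comp hY hmaps) u hu)
    ((hY.fderiv_of_isOpen hopen (m := ∞) (by simp)) u hu) (hunit u hu) hdim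

/-- The mean curvature of a smooth hypersurface, in arbitrary charts. -/
theorem meanCurvature_local (hf : ContMDiff (𝓡 n) (𝓡 (n + 1)) ∞ f) (hsp : IsSpacelike g n f)
    (hN : IsFutureUnitNormal τ n f ν)
    (hφ : φ ∈ atlas (EuclideanSpace ℝ (Fin n)) S)
    (hc : c ∈ atlas (EuclideanSpace ℝ (Fin (n + 1))) M)
    {u : EuclideanSpace ℝ (Fin n)} (hu : u ∈ localDomain φ c f) :
    meanCurvature g n f ν (φ.symm u) = metricTrace
      (fun a b => chartMetric g c (localMap φ c f u)
        (fderiv ℝ (localMap φ c f) u a) (fderiv ℝ (localMap φ c f) u b))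
      (fun a b => chartMetric g c (localMap φ c f u)
        (covD (chartConn g c) (localMap φ c f) (localField φ c f ν) a u)
        (fderiv ℝ (localMap φ c f) u b)) := by
  have hx := φ.map_target hu.1
  have := meanCurvature_eq g hφ hc hx (ν := ν)
    (Filter.Eventually.of_forall fun x' => hf.mdifferentiableAt (by simp)) hu.2
    ((contDiffOn_localField hf hsp hN hφ (chart_mem_atlas _ _)).diffAt
      (isOpen_localDomain hf.continuous) (by
        refine ⟨φ.map_source hx, ?_⟩
        simp only [mem_preimage, φ.left_inv hx]
        exact mem_chart_source _ _))
  rwa [φ.right_inv hu.1] at this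

theorem isUnit_det_gram_of_pos {m : ℕ} {E : Type*} [NormedAddCommGroup E] [NormedSpace ℝ E]
    {G : E →L[ℝ] E →L[ℝ] ℝ} (hsymm : ∀ v w, G v w = G w v)
    {L : EuclideanSpace ℝ (Fin m) →L[ℝ] E} (hpos : ∀ a, a ≠ 0 → 0 < G (L a) (L a)) :
    IsUnit (gram (fun a b => G (L a) (L b)) stdVec).det := by
  refine isUnit_det_gram_of_nondegenerate (G.bilinearComp L L) (fun v w => hsymm _ _)
    fun v hv => ?_
  by_contra hne
  have := hpos v hne
  exact this.ne' (hv v)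

/-- Gives existence of the spatial maximum on each slice. Being free of time derivatives, it also
covers the degenerate interval `λ₁ = λ₂`. -/
theorem continuous_meanCurvature (hf : ContMDiff (𝓡 n) (𝓡 (n + 1)) ∞ f) (hsp : IsSpacelike g n f)
    (hN : IsFutureUnitNormal τ n f ν) : Continuous (meanCurvature g n f ν) := by
  rw [continuous_iff_continuousAt]
  intro x
  set φ := chartAt (EuclideanSpace ℝ (Fin n)) x with hφdef
  set c := chartAt (EuclideanSpace ℝ (Fin (n + 1))) (f x) with hcdef
  have hφ : φ ∈ atlas (EuclideanSpace ℝ (Fin n)) S := chart_mem_atlas _ _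
  have hc : c ∈ atlas (EuclideanSpace ℝ (Fin (n + 1))) M := chart_mem_atlas _ _
  have hx : x ∈ φ.source := mem_chart_source _ _
  have hopen := isOpen_localDomain (φ := φ) (c := c) hf.continuous
  have hmem : φ x ∈ localDomain φ c f := by
    refine ⟨φ.map_source hx, ?_⟩
    simp only [mem_preimage, φ.left_inv hx]
    exact mem_chart_source _ _
  have hY := contDiffOn_localMap hf hφ hc
  have hNl := contDiffOn_localField hf hsp hN hφ hc
  have hmaps : MapsTo (localMap φ c f) (localDomain φ c f) c.target :=
    fun u hu => c.map_source hu.2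
  have hG : ContDiffOn ℝ ∞ (fun u => chartMetric g c (localMap φ c f u)) (localDomain φ c f) :=
    (contDiffOn_chartMetric g hc).comp hY hmaps
  have hcov : ∀ a, ContDiffOn ℝ ∞ (fun u => covD (chartConn g c) (localMap φ c f)
      (localField φ c f ν) a u) (localDomain φ c f) :=
    fun a => (isLeviCivitaOn_chart g hc).smooth_covD hopen hY hNl hmaps a
  have hdY := fun a => hY.fderiv_apply_const hopen a
  have hent : ∀ a b, ContDiffOn ℝ ∞ (fun u => chartMetric g c (localMap φ c f u)
      (fderiv ℝ (localMap φ c f) u a) (fderiv ℝ (localMap φ c f) u b)) (localDomain φ c f) :=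
    fun a b => (hG.clm_apply (hdY a)).clm_apply (hdY b)
  have hent' : ∀ a b, ContDiffOn ℝ ∞ (fun u => chartMetric g c (localMap φ c f u)
      (covD (chartConn g c) (localMap φ c f) (localField φ c f ν) a u)
      (fderiv ℝ (localMap φ c f) u b)) (localDomain φ c f) :=
    fun a b => (hG.clm_apply (hcov a)).clm_apply (hdY b)
  have hdet : ∀ u ∈ localDomain φ c f, IsUnit (gram (fun a b => chartMetric g c
      (localMap φ c f u) (fderiv ℝ (localMap φ c f) u a) (fderiv ℝ (localMap φ c f) u b))
      stdVec).det := fun u hu => isUnit_det_gram_of_pos (chartMetric_symm g _)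
          (isUnitNormal_local hsp hN hφ hc hu.1 (hf.mdifferentiableAt (by simp)) hu.2).spacelike
  have hloc : ContinuousOn (fun u => meanCurvature g n f ν (φ.symm u)) (localDomain φ c f) := by
    refine ContinuousOn.congr ?_ fun u hu => meanCurvature_local hf hsp hN hφ hc hu
    refine continuousOn_finsetSum _ fun i _ => continuousOn_finsetSum _ fun j _ =>
      ContinuousOn.mul ?_ (hent' _ _).continuousOn
    exact (contDiffOn_matrix_inv (fun i j => hent (stdVec i) (stdVec j)) hdet i j).continuousOn
  have h1 : ContinuousAt (fun u => meanCurvature g n f ν (φ.symm u)) (φ x) :=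
    hloc.continuousAt (hopen.mem_nhds hmem)
  have h2 := ContinuousAt.comp (f := φ) (x := x) h1 (φ.continuousAt hx)
  exact h2.congr (Filter.eventually_of_mem (φ.open_source.mem_nhds hx) fun x' hx' => by
    simp [φ.left_inv hx'])

end Slices

/-! ### Space-time coordinates for the flow, including the end times. -/

section JointCoordinates

variable {n : ℕ} {M : Type*} [TopologicalSpace M]
  [ChartedSpace (EuclideanSpace ℝ (Fin (n + 1))) M]
  [IsManifold (𝓡 (n + 1)) ∞ M] {g : LorentzianMetric (n + 1) M} {τ : TimeOrientation g}
  {S : Type*} [TopologicalSpace S] [ChartedSpace (EuclideanSpace ℝ (Fin n)) S]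
  [IsManifold (𝓡 n) ∞ S]
  {c : OpenPartialHomeomorph M (EuclideanSpace ℝ (Fin (n + 1)))}
  {φ : OpenPartialHomeomorph S (EuclideanSpace ℝ (Fin n))} {y : S → ℝ → M}
  {ν : ∀ (x : S) (s : ℝ), TangentSpace (𝓡 (n + 1)) (y x s)} {a b : ℝ}

/-- The coordinate expression of `y : S × ℝ → M`. -/
def jointMap (φ : OpenPartialHomeomorph S (EuclideanSpace ℝ (Fin n)))
    (c : OpenPartialHomeomorph M (EuclideanSpace ℝ (Fin (n + 1)))) (y : S → ℝ → M)
    (q : EuclideanSpace ℝ (Fin n) × ℝ) : EuclideanSpace ℝ (Fin (n + 1)) :=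
  localMap φ c (fun x => y x q.2) q.1

/-- The coordinate expression of a vector field along `y : S × ℝ → M`. -/
def jointField (φ : OpenPartialHomeomorph S (EuclideanSpace ℝ (Fin n)))
    (c : OpenPartialHomeomorph M (EuclideanSpace ℝ (Fin (n + 1)))) (y : S → ℝ → M)
    (ν : ∀ (x : S) (s : ℝ), TangentSpace (𝓡 (n + 1)) (y x s))
    (q : EuclideanSpace ℝ (Fin n) × ℝ) : EuclideanSpace ℝ (Fin (n + 1)) :=
  localField φ c (fun x => y x q.2) (fun x => ν x q.2) q.1

/-- The domain of the coordinate expression of `y`, for times in `I`. -/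
def jointDomain (φ : OpenPartialHomeomorph S (EuclideanSpace ℝ (Fin n)))
    (c : OpenPartialHomeomorph M (EuclideanSpace ℝ (Fin (n + 1)))) (y : S → ℝ → M) (I : Set ℝ) :
    Set (EuclideanSpace ℝ (Fin n) × ℝ) :=
  {q | q.2 ∈ I ∧ q.1 ∈ localDomain φ c fun x => y x q.2}

/-- The mean curvature in coordinates. -/
def jointCurvature (g : LorentzianMetric (n + 1) M)
    (φ : OpenPartialHomeomorph S (EuclideanSpace ℝ (Fin n))) (y : S → ℝ → M)
    (ν : ∀ (x : S) (s : ℝ), TangentSpace (𝓡 (n + 1)) (y x s))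
    (q : EuclideanSpace ℝ (Fin n) × ℝ) : ℝ :=
  meanCurvature g n (fun x => y x q.2) (fun x => ν x q.2) (φ.symm q.1)

theorem contMDiffOn_chart_symm_prod (hφ : φ ∈ atlas (EuclideanSpace ℝ (Fin n)) S) (I : Set ℝ) :
    ContMDiffOn 𝓘(ℝ, EuclideanSpace ℝ (Fin n) × ℝ) ((𝓡 n).prod 𝓘(ℝ, ℝ)) ∞
      (fun q : EuclideanSpace ℝ (Fin n) × ℝ => (φ.symm q.1, q.2)) (φ.target ×ˢ I) := by
  refine ContMDiffOn.prodMk ?_ contDiff_snd.contMDiff.contMDiffOn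
  exact (contMDiffOn_chart_symm_of_mem hφ).comp
    (contDiff_fst (E := EuclideanSpace ℝ (Fin n)) (F := ℝ)).contMDiff.contMDiffOn
    fun q hq => hq.1

namespace IsMeanCurvatureFlow

variable (h : IsMeanCurvatureFlow τ a b y ν)
include h

omit [IsManifold (𝓡 n) ∞ S] in
theorem smooth_slice {s : ℝ} (hs : s ∈ Icc a b) :
    ContMDiff (𝓡 n) (𝓡 (n + 1)) ∞ (fun x => y x s) := by
  have h1 : ContMDiff (𝓡 n) ((𝓡 n).prod 𝓘(ℝ, ℝ)) ∞ (fun x : S => (x, s)) :=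
    contMDiff_id.prodMk contMDiff_const
  exact h.smooth.comp_contMDiff h1 fun x => ⟨mem_univ _, hs⟩

/-- The flow is continuous only on the closed time interval, so the coordinate domain is merely
relatively open. This form yields unique differentiability on the closed interval and openness on
the open one. -/
theorem exists_isOpen_jointDomain (hφ : φ ∈ atlas (EuclideanSpace ℝ (Fin n)) S) :
    ∃ O : Set (EuclideanSpace ℝ (Fin n) × ℝ), IsOpen O ∧
      jointDomain φ c y (Icc a b) = (φ.target ×ˢ Icc a b) ∩ O := by
  have h1 : ContinuousOn (fun q : EuclideanSpace ℝ (Fin n) × ℝ => y (φ.symm q.1) q.2)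
      (φ.target ×ˢ Icc a b) :=
    h.smooth.continuousOn.comp (contMDiffOn_chart_symm_prod hφ _).continuousOn
      fun q hq => ⟨mem_univ _, hq.2⟩
  obtain ⟨O, hO, hO'⟩ := continuousOn_iff'.mp h1 _ c.open_source
  refine ⟨O, hO, ?_⟩
  rw [inter_comm _ O, ← hO']
  ext q
  simp only [jointDomain, localDomain, mem_ofPred_eq, mem_inter_iff, mem_preimage, mem_prod]
  tauto

theorem uniqueDiffOn_jointDomain (hφ : φ ∈ atlas (EuclideanSpace ℝ (Fin n)) S) (hab : a < b) :
    UniqueDiffOn ℝ (jointDomain φ c y (Icc a b)) := by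
  obtain ⟨O, hO, hD⟩ := h.exists_isOpen_jointDomain (c := c) hφ
  rw [hD]
  exact (φ.open_target.uniqueDiffOn.prod (uniqueDiffOn_Icc hab)).inter hO

theorem isOpen_jointDomain (hφ : φ ∈ atlas (EuclideanSpace ℝ (Fin n)) S) :
    IsOpen (jointDomain φ c y (Ioo a b)) := by
  obtain ⟨O, hO, hD⟩ := h.exists_isOpen_jointDomain (c := c) hφ
  have : jointDomain φ c y (Ioo a b) = (φ.target ×ˢ Ioo a b) ∩ O := by
    ext q
    have h1 : q ∈ jointDomain φ c y (Icc a b) ↔ q ∈ (φ.target ×ˢ Icc a b) ∩ O := by rw [hD]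
    simp only [jointDomain, localDomain, mem_ofPred_eq, mem_inter_iff, mem_preimage,
      mem_prod] at h1 ⊢
    have h2 : q.2 ∈ Ioo a b → q.2 ∈ Icc a b := fun h => Ioo_subset_Icc_self h
    tauto
  rw [this]
  exact (φ.open_target.prod isOpen_Ioo).inter hO

omit h [IsManifold (𝓡 (n + 1)) ∞ M] [IsManifold (𝓡 n) ∞ S]
  [ChartedSpace (EuclideanSpace ℝ (Fin (n + 1))) M] [ChartedSpace (EuclideanSpace ℝ (Fin n)) S] in
theorem jointDomain_mono {I J : Set ℝ} (hIJ : I ⊆ J) :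
    jointDomain φ c y I ⊆ jointDomain φ c y J := fun _ hq => ⟨hIJ hq.1, hq.2⟩

theorem contDiffOn_jointMap (hφ : φ ∈ atlas (EuclideanSpace ℝ (Fin n)) S)
    (hc : c ∈ atlas (EuclideanSpace ℝ (Fin (n + 1))) M) :
    ContDiffOn ℝ ∞ (jointMap φ c y) (jointDomain φ c y (Icc a b)) := by
  rw [← contMDiffOn_iff_contDiffOn]
  refine (contMDiffOn_chart_of_mem hc).comp
    (h.smooth.comp ((contMDiffOn_chart_symm_prod hφ (Icc a b)).mono fun q hq => ?_)
    fun q hq => ⟨mem_univ _, hq.1⟩) fun q hq => hq.2.2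
  exact ⟨hq.2.1, hq.1⟩

theorem fderivWithin_jointMap_space (hφ : φ ∈ atlas (EuclideanSpace ℝ (Fin n)) S)
    (hc : c ∈ atlas (EuclideanSpace ℝ (Fin (n + 1))) M)
    {q : EuclideanSpace ℝ (Fin n) × ℝ} (hq : q ∈ jointDomain φ c y (Icc a b)) :
    (fderivWithin ℝ (jointMap φ c y) (jointDomain φ c y (Icc a b)) q).comp
      (ContinuousLinearMap.inl ℝ _ ℝ) = fderiv ℝ (localMap φ c fun x => y x q.2) q.1 := by
  obtain ⟨u, s⟩ := q
  have h1 := ((h.contDiffOn_jointMap hφ hc (u, s) hq).differentiableWithinAt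
    (by simp)).hasFDerivWithinAt
  have h2 : HasFDerivWithinAt (fun u' : EuclideanSpace ℝ (Fin n) => (u', s))
      (ContinuousLinearMap.inl ℝ _ ℝ) (localDomain φ c fun x => y x s) u :=
    (hasFDerivAt_prodMk_left u s).hasFDerivWithinAt
  have h3 := h1.comp u h2 fun u' hu' =>
    (⟨hq.1, hu'⟩ : (u', s) ∈ jointDomain φ c y (Icc a b))
  have h4 := h3.hasFDerivAt
    ((isOpen_localDomain (h.smooth_slice hq.1).continuous).mem_nhds hq.2)
  exact h4.fderiv.symm

theorem fderivWithin_jointMap_time (hφ : φ ∈ atlas (EuclideanSpace ℝ (Fin n)) S)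
    (hc : c ∈ atlas (EuclideanSpace ℝ (Fin (n + 1))) M) (hab : a < b)
    {q : EuclideanSpace ℝ (Fin n) × ℝ} (hq : q ∈ jointDomain φ c y (Icc a b)) :
    fderivWithin ℝ (jointMap φ c y) (jointDomain φ c y (Icc a b)) q (0, 1) =
      jointCurvature g φ y ν q • jointField φ c y ν q := by
  obtain ⟨O, hO, hD⟩ := h.exists_isOpen_jointDomain (c := c) hφ
  obtain ⟨u, s⟩ := q
  have h1 := ((h.contDiffOn_jointMap hφ hc (u, s) hq).differentiableWithinAt
    (by simp)).hasFDerivWithinAt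
  set I : Set ℝ := Icc a b ∩ {s' | (u, s') ∈ O} with hI
  have hIo : IsOpen {s' : ℝ | (u, s') ∈ O} := hO.preimage (by fun_prop)
  have hqO : (u, s) ∈ (φ.target ×ˢ Icc a b) ∩ O := hD ▸ hq
  have hsI : s ∈ I := ⟨hqO.1.2, hqO.2⟩
  have h2 : HasFDerivWithinAt (fun s' : ℝ => (u, s'))
      (ContinuousLinearMap.inr ℝ (EuclideanSpace ℝ (Fin n)) ℝ) I s :=
    (hasFDerivAt_prodMk_right u s).hasFDerivWithinAt
  have h3 := h1.comp s h2 fun s' hs' => by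
    rw [hD]; exact ⟨⟨hqO.1.1, hs'.1⟩, hs'.2⟩
  have h4 := ((mdifferentiable_chart_of_mem hc).mdifferentiableAt
    hq.2.2).hasMFDerivAt.comp_hasMFDerivWithinAt s (h.flow s hq.1 (φ.symm u))
  let w : EuclideanSpace ℝ (Fin (n + 1)) := ν (φ.symm u) s
  have h5 : HasFDerivWithinAt (fun s' => c (y (φ.symm u) s'))
      ((chartDeriv c (y (φ.symm u) s)).comp (ContinuousLinearMap.toSpanSingleton ℝ
        (jointCurvature g φ y ν (u, s) • w))) I s :=
    (hasMFDerivWithinAt_iff_hasFDerivWithinAt.mp h4).mono inter_subset_left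
  -- Both `h3` and `h5` differentiate the same curve within `I`; uniqueness at an end point requires
  -- `a < b`.
  have huniq : UniqueDiffWithinAt ℝ I s :=
    ((uniqueDiffOn_Icc hab).inter hIo) s hsI
  have h6 := congrArg (fun L => L 1) (huniq.eq h3 h5)
  simp only [ContinuousLinearMap.comp_apply, ContinuousLinearMap.inr_apply] at h6
  refine h6.trans ?_
  rw [ContinuousLinearMap.toSpanSingleton_apply, one_smul, map_smul]
  rfl

theorem isUnitNormal_joint (hφ : φ ∈ atlas (EuclideanSpace ℝ (Fin n)) S)
    (hc : c ∈ atlas (EuclideanSpace ℝ (Fin (n + 1))) M)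
    {q : EuclideanSpace ℝ (Fin n) × ℝ} (hq : q ∈ jointDomain φ c y (Icc a b)) :
    IsUnitNormal (chartMetric g c (jointMap φ c y q)) (timeForm g τ c (jointMap φ c y q))
      ((fderivWithin ℝ (jointMap φ c y) (jointDomain φ c y (Icc a b)) q).comp
      (ContinuousLinearMap.inl ℝ _ ℝ)) (jointField φ c y ν q) := by
  rw [h.fderivWithin_jointMap_space hφ hc hq]
  exact isUnitNormal_local (h.spacelike _ hq.1) (h.normal _ hq.1) hφ hc hq.2.1
    ((h.smooth_slice hq.1).mdifferentiableAt (by simp)) hq.2.2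

theorem contDiffOn_jointField (hφ : φ ∈ atlas (EuclideanSpace ℝ (Fin n)) S)
    (hc : c ∈ atlas (EuclideanSpace ℝ (Fin (n + 1))) M) (hab : a < b) :
    ContDiffOn ℝ ∞ (jointField φ c y ν) (jointDomain φ c y (Icc a b)) := by
  have hY := h.contDiffOn_jointMap hφ hc
  have hmaps : MapsTo (jointMap φ c y) (jointDomain φ c y (Icc a b)) c.target :=
    fun u hu => c.map_source hu.2.2
  have hdim : Module.finrank ℝ (EuclideanSpace ℝ (Fin (n + 1))) =
    Module.finrank ℝ (EuclideanSpace ℝ (Fin n)) + 1 := by simp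
  refine ContDiffOn.congr (f := fun q => unitNormal (chartMetric g c (jointMap φ c y q))
    (timeForm g τ c (jointMap φ c y q))
    ((fderivWithin ℝ (jointMap φ c y) (jointDomain φ c y (Icc a b)) q).comp
      (ContinuousLinearMap.inl ℝ _ ℝ))) ?_
    fun q hq => ((h.isUnitNormal_joint hφ hc hq).unitNormal_eq hdim).symm
  intro q hq
  have hd := (hY.fderivWithin (h.uniqueDiffOn_jointDomain hφ hab) (m := ∞) (by simp)) q hq
  exact contDiffWithinAt_unitNormal (((contDiffOn_chartMetric g hc).comp hY hmaps) q hq)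
    (((contDiffOn_timeForm g τ hc).comp hY hmaps) q hq)
    (hd.clm_comp contDiffWithinAt_const) (h.isUnitNormal_joint hφ hc hq) hdim

/-- By the flow equation the mean curvature equals `-g(∂_s y, ν)`, which is visibly smooth up to the
end times. -/
theorem contDiffOn_jointCurvature (hφ : φ ∈ atlas (EuclideanSpace ℝ (Fin n)) S)
    (hc : c ∈ atlas (EuclideanSpace ℝ (Fin (n + 1))) M) (hab : a < b) :
    ContDiffOn ℝ ∞ (jointCurvature g φ y ν) (jointDomain φ c y (Icc a b)) := by
  have hY := h.contDiffOn_jointMap hφ hc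
  have hmaps : MapsTo (jointMap φ c y) (jointDomain φ c y (Icc a b)) c.target :=
    fun u hu => c.map_source hu.2.2
  have hd : ContDiffOn ℝ ∞ (fun q => fderivWithin ℝ (jointMap φ c y)
      (jointDomain φ c y (Icc a b)) q (0, 1)) (jointDomain φ c y (Icc a b)) :=
    (hY.fderivWithin (h.uniqueDiffOn_jointDomain hφ hab) (m := ∞) (by simp)).clm_apply
      contDiffOn_const
  have hG : ContDiffOn ℝ ∞ (fun q => chartMetric g c (jointMap φ c y q))
      (jointDomain φ c y (Icc a b)) := (contDiffOn_chartMetric g hc).comp hY hmaps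
  refine ContDiffOn.congr (f := fun q => -chartMetric g c (jointMap φ c y q)
    (fderivWithin ℝ (jointMap φ c y) (jointDomain φ c y (Icc a b)) q (0, 1))
    (jointField φ c y ν q))
    ((hG.clm_apply hd).clm_apply (h.contDiffOn_jointField hφ hc hab)).neg fun q hq => ?_
  rw [h.fderivWithin_jointMap_time hφ hc hab hq]
  simp [(h.isUnitNormal_joint hφ hc hq).unit]

theorem continuousOn_meanCurvature (hab : a < b) :
    ContinuousOn (fun z : S × ℝ => meanCurvature g n (fun x => y x z.2) (fun x => ν x z.2) z.1)
      (univ ×ˢ Icc a b) := by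
  rintro ⟨x, s⟩ ⟨-, hs⟩
  set φ := chartAt (EuclideanSpace ℝ (Fin n)) x with hφdef
  set c := chartAt (EuclideanSpace ℝ (Fin (n + 1))) (y x s) with hcdef
  have hφ : φ ∈ atlas (EuclideanSpace ℝ (Fin n)) S := chart_mem_atlas _ _
  have hc : c ∈ atlas (EuclideanSpace ℝ (Fin (n + 1))) M := chart_mem_atlas _ _
  have hx : x ∈ φ.source := mem_chart_source _ _
  have hq : (φ x, s) ∈ jointDomain φ c y (Icc a b) := by
    refine ⟨hs, φ.map_source hx, ?_⟩
    simp only [mem_preimage, φ.left_inv hx]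
    exact mem_chart_source _ _
  obtain ⟨O, hO, hD⟩ := h.exists_isOpen_jointDomain (c := c) hφ
  have h1 := (h.contDiffOn_jointCurvature hφ hc hab).continuousOn _ hq
  have hcont : ContinuousAt (fun z : S × ℝ => (φ z.1, z.2)) (x, s) :=
    ((φ.continuousAt hx).comp (x := (x, s)) continuousAt_fst).prodMk continuousAt_snd
  have hev : ∀ᶠ z in 𝓝 (x, s), z.1 ∈ φ.source ∧ (φ z.1, z.2) ∈ O := by
    refine Filter.Eventually.and ?_ ?_
    · exact continuousAt_fst.eventually_mem (φ.open_source.mem_nhds hx)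
    · exact hcont.eventually_mem (hO.mem_nhds (hD ▸ hq).2)
  have h2 : Filter.Tendsto (fun z : S × ℝ => (φ z.1, z.2)) (𝓝[univ ×ˢ Icc a b] (x, s))
      (𝓝[jointDomain φ c y (Icc a b)] (φ x, s)) := by
    refine tendsto_nhdsWithin_iff.mpr ⟨hcont.tendsto.mono_left nhdsWithin_le_nhds, ?_⟩
    filter_upwards [self_mem_nhdsWithin, mem_nhdsWithin_of_mem_nhds hev] with z hz hz'
    rw [hD]
    exact ⟨⟨φ.map_source hz'.1, hz.2⟩, hz'.2⟩
  have h3 := h1.tendsto.comp h2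
  have h4 : ∀ z : S × ℝ, z.1 ∈ φ.source → jointCurvature g φ y ν (φ z.1, z.2) =
      meanCurvature g n (fun x => y x z.2) (fun x => ν x z.2) z.1 := fun z hz => by
    simp only [jointCurvature, φ.left_inv hz]
  have h5 := h4 (x, s) hx
  simp only at h5
  rw [h5] at h3
  refine h3.congr' ?_
  filter_upwards [mem_nhdsWithin_of_mem_nhds hev] with z hz
  exact h4 z hz.1

end IsMeanCurvatureFlow

end JointCoordinates

/-! ### The second derivative test and orthonormal bases. -/

section Calculus

variable {E : Type*} [NormedAddCommGroup E] [NormedSpace ℝ E]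
  {Ω : Set E} {G : E → E →L[ℝ] E →L[ℝ] ℝ} {Γ : E → E →L[ℝ] E →L[ℝ] E}

theorem IsLeviCivitaOn.fderiv_conn_symm (h : IsLeviCivitaOn Ω G Γ) {z : E} (hz : z ∈ Ω)
    (w u v : E) : fderiv ℝ Γ z w u v = fderiv ℝ Γ z w v u := by
  have hΓ := h.smooth_conn.diffAt h.isOpen hz
  have h1 : ∀ u v, fderiv ℝ (fun z => Γ z u v) z w = fderiv ℝ Γ z w u v := fun u v => by
    rw [((hΓ.hasFDerivAt.clm_apply (hasFDerivAt_const u z)).clm_apply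
      (hasFDerivAt_const v z)).fderiv]
    simp
  rw [← h1, ← h1, Filter.EventuallyEq.fderiv_eq
    (Filter.eventually_of_mem (h.isOpen.mem_nhds hz) fun z' hz' => h.torsion_free z' hz' u v)]

/-- The linear map `w ↦ R(w, N) N`. -/
def curvOperator (Γ : E → E →L[ℝ] E →L[ℝ] E) (z N : E) : E →ₗ[ℝ] E where
  toFun w := curv Γ z w N N
  map_add' u v := by
    simp only [curv, map_add, add_apply]
    abel
  map_smul' t v := by
    simp only [curv, map_smul, smul_apply, RingHom.id_apply, smul_add, smul_sub]

/-- The second derivative test at a local maximum. -/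
theorem fderiv_fderiv_nonpos_of_isLocalMax {f : E → ℝ} {W : Set E} (hf : ContDiffOn ℝ ∞ f W)
    (hW : IsOpen W) {q ξ : E} (hq : q ∈ W) (hmax : IsLocalMax (fun t : ℝ => f (q + t • ξ)) 0) :
    fderiv ℝ f q ξ = 0 ∧ fderiv ℝ (fderiv ℝ f) q ξ ξ ≤ 0 := by
  have hline : ∀ t : ℝ, HasDerivAt (fun t : ℝ => q + t • ξ) ξ t := fun t => by
    simpa using ((hasDerivAt_id t).smul_const ξ).const_add q
  have hcont : ContinuousAt (fun t : ℝ => q + t • ξ) 0 := (hline 0).continuousAt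
  have hq0 : q + (0 : ℝ) • ξ = q := by simp
  have hev : ∀ᶠ t in 𝓝 (0 : ℝ), q + t • ξ ∈ W :=
    hcont.eventually_mem (by rw [hq0]; exact hW.mem_nhds hq)
  have hd : ∀ t : ℝ, q + t • ξ ∈ W →
      HasDerivAt (fun t : ℝ => f (q + t • ξ)) (fderiv ℝ f (q + t • ξ) ξ) t := fun t ht =>
    (hf.diffAt hW ht).hasFDerivAt.comp_hasDerivAt t (hline t)
  have hderiv : deriv (fun t : ℝ => f (q + t • ξ)) =ᶠ[𝓝 0] fun t => fderiv ℝ f (q + t • ξ) ξ :=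
    hev.mono fun t ht => (hd t ht).deriv
  have hd0 := hd 0 (by rwa [hq0])
  have hd2 : HasDerivAt (fun t : ℝ => fderiv ℝ f (q + t • ξ) ξ)
      (fderiv ℝ (fderiv ℝ f) q ξ ξ) 0 := by
    rw [← fderiv_fderiv_apply hf hW hq]
    have h1 := (hf.fderiv_apply_const hW ξ).diffAt hW hq
    rw [← hq0] at h1
    have := h1.hasFDerivAt.comp_hasDerivAt (0 : ℝ) (hline 0)
    rwa [hq0] at this
  have hcrit : fderiv ℝ f q ξ = 0 := by
    have := hmax.hasDerivAt_eq_zero hd0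
    rwa [hq0] at this
  refine ⟨hcrit, ?_⟩
  -- A positive second derivative would make the point a local minimum too, so the function would be
  -- locally constant with zero second derivative.
  by_contra! hpos
  have hdd : deriv (deriv fun t : ℝ => f (q + t • ξ)) 0 = fderiv ℝ (fderiv ℝ f) q ξ ξ := by
    rw [hderiv.deriv_eq, hd2.deriv]
  have hmin := isLocalMin_of_deriv_deriv_pos (by rwa [hdd])
    (by rw [hd0.deriv, hq0, hcrit]) hd0.continuousAt
  have hconst : (fun t : ℝ => f (q + t • ξ)) =ᶠ[𝓝 0] fun _ => f (q + (0 : ℝ) • ξ) := by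
    filter_upwards [hmin, hmax] with t h1 h2 using le_antisymm h2 h1
  have h0 : deriv (deriv fun t : ℝ => f (q + t • ξ)) 0 = 0 := by
    rw [hconst.deriv.deriv_eq]
    simp
  rw [hdd] at h0
  exact hpos.ne' h0

theorem exists_orthonormal_basis_of_pos {n : ℕ} {F : Type*} [NormedAddCommGroup F]
    [NormedSpace ℝ F] (hF : Module.finrank ℝ F = n) [FiniteDimensional ℝ F]
    {B : F →L[ℝ] F →L[ℝ] ℝ} (hsymm : ∀ u v, B u v = B v u) (hpos : ∀ u, u ≠ 0 → 0 < B u u) :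
    ∃ b : Module.Basis (Fin n) ℝ F,
      ∀ i j, B (b i) (b j) = (1 : Matrix (Fin n) (Fin n) ℝ) i j := by
  subst hF
  let B' : LinearMap.BilinForm ℝ F := LinearMap.mk₂ ℝ (fun u v => B u v) (by simp) (by simp)
    (by simp) (by simp)
  have hB' : ∀ u v, B' u v = B u v := fun u v => rfl
  obtain ⟨v, hv⟩ := LinearMap.BilinForm.exists_orthogonal_basis (B := B')
    ⟨fun u v => by simpa [hB'] using hsymm u v⟩
  have hvpos : ∀ i, 0 < B (v i) (v i) := fun i => hpos _ (v.ne_zero i)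
  have hs : ∀ i, IsUnit (Real.sqrt (B (v i) (v i)))⁻¹ := fun i =>
    (inv_ne_zero (Real.sqrt_pos.mpr (hvpos i)).ne').isUnit
  refine ⟨v.isUnitSMul hs, fun i j => ?_⟩
  rw [Module.Basis.isUnitSMul_apply, Module.Basis.isUnitSMul_apply]
  simp only [map_smul, smul_apply, smul_eq_mul, Matrix.one_apply]
  by_cases hij : i = j
  · subst hij
    have := Real.mul_self_sqrt (hvpos i).le
    have hne := (Real.sqrt_pos.mpr (hvpos i)).ne'
    rw [if_pos rfl]
    field_simp
    rw [pow_two, this]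
  · have h0 : B (v i) (v j) = 0 := hv hij
    rw [if_neg hij, h0]
    ring

end Calculus

/-! ### The Ricci tensor as a trace of the curvature. -/

section Ricci

variable {m : ℕ} {M : Type*} [TopologicalSpace M] [ChartedSpace (EuclideanSpace ℝ (Fin m)) M]
  [IsManifold (𝓡 m) ∞ M] (g : LorentzianMetric m M)
  {c : OpenPartialHomeomorph M (EuclideanSpace ℝ (Fin m))}

theorem fderiv_chartConn_coord (hc : c ∈ atlas (EuclideanSpace ℝ (Fin m)) M)
    {z : EuclideanSpace ℝ (Fin m)} (hz : z ∈ c.target) (w u v : EuclideanSpace ℝ (Fin m))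
    (k : Fin m) : fderiv ℝ (chartConn g c) z w u v k =
      ∑ i, ∑ j, fderiv ℝ (christoffel g c k i j) z w * u i * v j := by
  have hΓ := (contDiffOn_chartConn g hc).diffAt c.open_target hz
  have h1 := ((hΓ.hasFDerivAt.clm_apply (hasFDerivAt_const u z)).clm_apply
      (hasFDerivAt_const v z))
  have h2 := (EuclideanSpace.proj k : EuclideanSpace ℝ (Fin m) →L[ℝ] ℝ).hasFDerivAt.comp z h1
  have h3 : HasFDerivAt (fun z => ∑ i, ∑ j, christoffel g c k i j z * u i * v j)
      (∑ i, ∑ j, (v j) • (u i) • fderiv ℝ (christoffel g c k i j) z) z :=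
    HasFDerivAt.fun_sum fun i _ => HasFDerivAt.fun_sum fun j _ =>
      (((contDiffOn_christoffel g hc k i j).diffAt c.open_target hz).hasFDerivAt.mul_const
        (u i)).mul_const (v j)
  have h4 : (fun z => ∑ i, ∑ j, christoffel g c k i j z * u i * v j) =
      (EuclideanSpace.proj k : EuclideanSpace ℝ (Fin m) →L[ℝ] ℝ) ∘
        fun z => chartConn g c z u v := by
    funext z
    exact (chartConn_coord g z u v k).symm
  rw [h4] at h3
  have h5 := congrArg (fun L => L w) (h2.unique h3)
  simp only [ContinuousLinearMap.comp_apply, FunLike.coe_sum, Finset.sum_apply, FunLike.coe_smul,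
    Pi.smul_apply, smul_eq_mul] at h5
  have h6 : (fderiv ℝ (chartConn g c) z w u v) k =
      ∑ i, ∑ j, v j * (u i * fderiv ℝ (christoffel g c k i j) z w) := by
    rw [← h5]
    simp
  rw [h6]
  exact Finset.sum_congr rfl fun i _ => Finset.sum_congr rfl fun j _ => by ring

theorem clm_apply_eq_sum {m : ℕ} (L : EuclideanSpace ℝ (Fin m) →L[ℝ] ℝ)
    (v : EuclideanSpace ℝ (Fin m)) : L v = ∑ j, v j * L (stdVec j) := by
  conv_lhs => rw [← sum_coord_smul_stdVec v]
  simp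

/-- The Ricci curvature is the trace of the curvature. -/
theorem trace_curvOperator (p : M) (v : TangentSpace (𝓡 m) p) :
    LinearMap.trace ℝ _ (curvOperator (chartConn g (chartAt (EuclideanSpace ℝ (Fin m)) p))
      (chartAt (EuclideanSpace ℝ (Fin m)) p p)
      (coords (chartAt (EuclideanSpace ℝ (Fin m)) p) p v)) = ricci g p v v := by
  set c := chartAt (EuclideanSpace ℝ (Fin m)) p with hcdef
  have hc : c ∈ atlas (EuclideanSpace ℝ (Fin m)) M := chart_mem_atlas _ _
  have hz : c p ∈ c.target := c.map_source (mem_chart_source _ _)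
  set N := coords c p v with hN
  set z := c p with hzdef
  have hLC := isLeviCivitaOn_chart g hc
  rw [LinearMap.trace_eq_matrix_trace ℝ (EuclideanSpace.basisFun (Fin m) ℝ).toBasis, Matrix.trace]
  have hdiag : ∀ k, (LinearMap.toMatrix (EuclideanSpace.basisFun (Fin m) ℝ).toBasis
      (EuclideanSpace.basisFun (Fin m) ℝ).toBasis (curvOperator (chartConn g c) z N)).diag k =
      curv (chartConn g c) z (stdVec k) N N k := fun k => by
    simp [LinearMap.toMatrix_apply, curvOperator, stdVec]
  have h1 : ∀ k, fderiv ℝ (chartConn g c) z (stdVec k) N N k =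
      ∑ i, ∑ j, partialDeriv k (christoffel g c k i j) z * N i * N j := fun k =>
    fderiv_chartConn_coord g hc hz _ _ _ _
  have h2 : ∀ k, fderiv ℝ (chartConn g c) z N (stdVec k) N k =
      ∑ i, ∑ j, partialDeriv j (christoffel g c k i k) z * N i * N j := fun k => by
    -- The symmetry of `Γ` puts the lower indices in the order used by `ricciComponent`.
    rw [hLC.fderiv_conn_symm hz, fderiv_chartConn_coord g hc hz]
    refine Finset.sum_congr rfl fun i _ => ?_
    rw [Finset.sum_eq_single k (fun j _ hj => by simp [stdVec, hj])
      (by simp), clm_apply_eq_sum, Finset.sum_mul, Finset.sum_mul]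
    refine Finset.sum_congr rfl fun j _ => ?_
    simp [partialDeriv]
    ring
  have h3 : ∀ k, chartConn g c z (stdVec k) (chartConn g c z N N) k =
      ∑ i, ∑ j, ∑ l, christoffel g c k k l z * christoffel g c l i j z * N i * N j := fun k => by
    rw [chartConn_coord, Finset.sum_eq_single k
      (fun j _ hj => by simp [stdVec, hj]) (by simp)]
    simp only [chartConn_coord, Finset.mul_sum]
    rw [Finset.sum_comm]
    refine Finset.sum_congr rfl fun i _ => ?_
    rw [Finset.sum_comm]
    refine Finset.sum_congr rfl fun j _ => Finset.sum_congr rfl fun l _ => ?_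
    simp
    ring
  have h4 : ∀ k, chartConn g c z N (chartConn g c z (stdVec k) N) k =
      ∑ i, ∑ j, ∑ l, christoffel g c k j l z * christoffel g c l i k z * N i * N j := fun k => by
    rw [hLC.torsion_free z hz (stdVec k), chartConn_coord, Finset.sum_comm]
    have : ∀ l, chartConn g c z N (stdVec k) l = ∑ i, christoffel g c l i k z * N i := by
      intro l
      rw [chartConn_coord]
      refine Finset.sum_congr rfl fun i _ => ?_
      rw [Finset.sum_eq_single k (fun j _ hj => by simp [stdVec, hj]) (by simp)]
      simp
    simp only [this, Finset.mul_sum]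
    have e : ∀ l, ∑ j, ∑ i, christoffel g c k j l z * N j * (christoffel g c l i k z * N i) =
        ∑ i, ∑ j, christoffel g c k j l z * christoffel g c l i k z * N i * N j := fun l => by
      rw [Finset.sum_comm]
      exact Finset.sum_congr rfl fun i _ => Finset.sum_congr rfl fun j _ => by ring
    rw [Finset.sum_congr rfl fun l _ => e l, Finset.sum_comm]
    exact Finset.sum_congr rfl fun i _ => Finset.sum_comm
  have hk : ∀ k, curv (chartConn g c) z (stdVec k) N N k = ∑ i, ∑ j,
      (partialDeriv k (christoffel g c k i j) z - partialDeriv j (christoffel g c k i k) z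
      + ∑ l, (christoffel g c k k l z * christoffel g c l i j z
      - christoffel g c k j l z * christoffel g c l i k z)) * N i * N j := fun k => by
    simp only [curv, PiLp.add_apply, PiLp.sub_apply]
    rw [h1, h2, h3, h4]
    simp only [add_mul, sub_mul, Finset.sum_mul, Finset.sum_add_distrib, Finset.sum_sub_distrib]
    ring
  rw [Finset.sum_congr rfl fun k _ => (hdiag k).trans (hk k), Finset.sum_comm]
  have hric : ricci g p v v = ∑ i, ∑ j, ricciComponent g c i j z * N i * N j := rfl
  rw [hric]
  refine Finset.sum_congr rfl fun i _ => ?_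
  rw [Finset.sum_comm]
  refine Finset.sum_congr rfl fun j _ => ?_
  rw [ricciComponent, ← Finset.sum_add_distrib, Finset.sum_mul, Finset.sum_mul]

end Ricci

/-! ### The evolution inequality on the manifold. -/

section EvolutionOfMeanCurvature

variable {n : ℕ} {M : Type*} [TopologicalSpace M]
  [ChartedSpace (EuclideanSpace ℝ (Fin (n + 1))) M]
  [IsManifold (𝓡 (n + 1)) ∞ M] {g : LorentzianMetric (n + 1) M} {τ : TimeOrientation g}
  {S : Type*} [TopologicalSpace S] [ChartedSpace (EuclideanSpace ℝ (Fin n)) S]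
  [IsManifold (𝓡 n) ∞ S]
  {c : OpenPartialHomeomorph M (EuclideanSpace ℝ (Fin (n + 1)))}
  {φ : OpenPartialHomeomorph S (EuclideanSpace ℝ (Fin n))} {y : S → ℝ → M}
  {ν : ∀ (x : S) (s : ℝ), TangentSpace (𝓡 (n + 1)) (y x s)} {a b : ℝ}

namespace IsMeanCurvatureFlow

variable (h : IsMeanCurvatureFlow τ a b y ν)
include h

theorem fderivWithin_jointMap_eq (hφ : φ ∈ atlas (EuclideanSpace ℝ (Fin n)) S)
    {q : EuclideanSpace ℝ (Fin n) × ℝ} (hq : q ∈ jointDomain φ c y (Ioo a b)) :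
    fderivWithin ℝ (jointMap φ c y) (jointDomain φ c y (Icc a b)) q =
      fderiv ℝ (jointMap φ c y) q :=
  fderivWithin_of_mem_nhds (Filter.mem_of_superset ((h.isOpen_jointDomain hφ).mem_nhds hq)
    (jointDomain_mono Ioo_subset_Icc_self))

/-- A mean curvature flow in coordinates. -/
theorem isNormalFlowOn (hφ : φ ∈ atlas (EuclideanSpace ℝ (Fin n)) S)
    (hc : c ∈ atlas (EuclideanSpace ℝ (Fin (n + 1))) M) (hab : a < b) :
    IsNormalFlowOn c.target (chartMetric g c) (chartConn g c) (jointDomain φ c y (Ioo a b))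
      (jointMap φ c y) (jointField φ c y ν) (jointCurvature g φ y ν) := by
  have hsub : jointDomain φ c y (Ioo a b) ⊆ jointDomain φ c y (Icc a b) :=
    jointDomain_mono Ioo_subset_Icc_self
  constructor
  · exact isLeviCivitaOn_chart g hc
  · exact h.isOpen_jointDomain hφ
  · exact fun q hq => c.map_source hq.2.2
  · exact (h.contDiffOn_jointMap hφ hc).mono hsub
  · exact (h.contDiffOn_jointField hφ hc hab).mono hsub
  · exact fun q hq => (h.isUnitNormal_joint hφ hc (hsub hq)).unit
  · intro q hq u
    have := (h.isUnitNormal_joint hφ hc (hsub hq)).orthogonal u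
    rwa [h.fderivWithin_jointMap_eq hφ hq] at this
  · intro q hq
    rw [← h.fderivWithin_jointMap_eq hφ hq]
    exact h.fderivWithin_jointMap_time hφ hc hab (hsub hq)

/-- The basis is arbitrary and independent of `q`, so that it can be chosen orthonormal at the
maximum and kept fixed while `q` varies. -/
theorem jointCurvature_eq_trace (hφ : φ ∈ atlas (EuclideanSpace ℝ (Fin n)) S)
    (hc : c ∈ atlas (EuclideanSpace ℝ (Fin (n + 1))) M) (hab : a < b)
    {q : EuclideanSpace ℝ (Fin n) × ℝ} (hq : q ∈ jointDomain φ c y (Ioo a b))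
    (e : Module.Basis (Fin n) ℝ (EuclideanSpace ℝ (Fin n))) :
    jointCurvature g φ y ν q = ((gram (fff (chartMetric g c) (jointMap φ c y) q) e)⁻¹ *
      (gram (sff (chartMetric g c) (chartConn g c) (jointMap φ c y) (jointField φ c y ν) q)
        e).transpose).trace := by
  have hF := h.isNormalFlowOn hφ hc hab
  obtain ⟨u, s⟩ := q
  have hs : s ∈ Icc a b := Ioo_subset_Icc_self hq.1
  have hslice : ∀ {f : EuclideanSpace ℝ (Fin n) × ℝ → EuclideanSpace ℝ (Fin (n + 1))},
      DifferentiableAt ℝ f (u, s) →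
      fderiv ℝ (fun u' => f (u', s)) u = (fderiv ℝ f (u, s)).comp
        (ContinuousLinearMap.inl ℝ _ ℝ) := fun hf =>
    (hf.hasFDerivAt.comp u (hasFDerivAt_prodMk_left u s)).fderiv
  have h1 : fderiv ℝ (localMap φ c fun x => y x s) u = (fderiv ℝ (jointMap φ c y) (u, s)).comp
      (ContinuousLinearMap.inl ℝ _ ℝ) := hslice (hF.smooth_map.diffAt hF.isOpen hq)
  have h2 : fderiv ℝ (localField φ c (fun x => y x s) fun x => ν x s) u =
      (fderiv ℝ (jointField φ c y ν) (u, s)).comp (ContinuousLinearMap.inl ℝ _ ℝ) :=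
    hslice (hF.smooth_normal.diffAt hF.isOpen hq)
  have h3 : jointCurvature g φ y ν (u, s) = _ :=
    meanCurvature_local (h.smooth_slice hs) (h.spacelike s hs) (h.normal s hs) hφ hc hq.2
  rw [h3]
  simp only [covD, h1, h2]
  exact metricTrace_eq_of_basis (chartMetric g c (jointMap φ c y (u, s)))
    (chartMetric g c (jointMap φ c y (u, s)))
    ((fderiv ℝ (jointMap φ c y) (u, s)).comp (ContinuousLinearMap.inl ℝ _ ℝ))
    ((fderiv ℝ (jointField φ c y ν) (u, s)).comp (ContinuousLinearMap.inl ℝ _ ℝ) +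
      ((chartConn g c (jointMap φ c y (u, s))).flip (jointField φ c y ν (u, s))).comp
        ((fderiv ℝ (jointMap φ c y) (u, s)).comp (ContinuousLinearMap.inl ℝ _ ℝ))) e

/-- The evolution inequality for the mean curvature at a spatial maximum. -/
theorem exists_hasDerivAt_le {x : S} {s : ℝ} (hs : s ∈ Ioo a b)
    (hmax : ∀ x', meanCurvature g n (fun x => y x s) (fun x => ν x s) x' ≤
      meanCurvature g n (fun x => y x s) (fun x => ν x s) x)
    (hpos : 0 ≤ meanCurvature g n (fun x => y x s) (fun x => ν x s) x) :
    ∃ d, HasDerivAt (fun s' => meanCurvature g n (fun x => y x s') (fun x => ν x s') x) d s ∧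
      d ≤ -meanCurvature g n (fun x => y x s) (fun x => ν x s) x *
        (meanCurvature g n (fun x => y x s) (fun x => ν x s) x ^ 2 / n +
          ricci g (y x s) (ν x s) (ν x s)) := by
  have hab : a < b := hs.1.trans hs.2
  set φ := chartAt (EuclideanSpace ℝ (Fin n)) x with hφdef
  set c := chartAt (EuclideanSpace ℝ (Fin (n + 1))) (y x s) with hcdef
  have hφ : φ ∈ atlas (EuclideanSpace ℝ (Fin n)) S := chart_mem_atlas _ _
  have hc : c ∈ atlas (EuclideanSpace ℝ (Fin (n + 1))) M := chart_mem_atlas _ _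
  have hx : x ∈ φ.source := mem_chart_source _ _
  have hq : (φ x, s) ∈ jointDomain φ c y (Ioo a b) := by
    refine ⟨hs, φ.map_source hx, ?_⟩
    simp only [mem_preimage, φ.left_inv hx]
    exact mem_chart_source _ _
  have hF := h.isNormalFlowOn hφ hc hab
  have hK : ∀ s', jointCurvature g φ y ν (φ x, s') =
      meanCurvature g n (fun x => y x s') (fun x => ν x s') x := fun s' => by
    simp only [jointCurvature, φ.left_inv hx]
  have hspace : ∀ u : EuclideanSpace ℝ (Fin n),
      fderiv ℝ (jointCurvature g φ y ν) (φ x, s) (u, 0) = 0 ∧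
      fderiv ℝ (fderiv ℝ (jointCurvature g φ y ν)) (φ x, s) (u, 0) (u, 0) ≤ 0 := fun u => by
    -- The inequality holds for every `t`, even outside the chart: `φ.symm` always returns some
    -- point of `S`, and the maximum is global.
    refine fderiv_fderiv_nonpos_of_isLocalMax hF.smooth_speed hF.isOpen hq
      (Filter.Eventually.of_forall fun t => ?_)
    simp only [Prod.smul_mk, Prod.mk_add_mk, smul_zero, add_zero, zero_smul]
    rw [hK]
    exact hmax _
  have hunit := h.isUnitNormal_joint hφ hc (jointDomain_mono Ioo_subset_Icc_self hq)
  rw [h.fderivWithin_jointMap_eq hφ hq] at hunit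
  obtain ⟨e, he⟩ := exists_orthonormal_basis_of_pos (n := n)
    (F := EuclideanSpace ℝ (Fin n)) (by simp)
    (B := (chartMetric g c (jointMap φ c y (φ x, s))).bilinearComp
      ((fderiv ℝ (jointMap φ c y) (φ x, s)).comp (ContinuousLinearMap.inl ℝ _ ℝ))
      ((fderiv ℝ (jointMap φ c y) (φ x, s)).comp (ContinuousLinearMap.inl ℝ _ ℝ)))
    (fun u v => hunit.symm _ _) hunit.spacelike
  have hle := hF.fderiv_speed_time_le hq e (by simp) he
    (fun q' hq' => h.jointCurvature_eq_trace hφ hc hab hq' e)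
    (fun u => (hspace u).1) (fun u => (hspace u).2) (by rw [hK]; exact hpos)
    (curvOperator (chartConn g c) (jointMap φ c y (φ x, s)) (jointField φ c y ν (φ x, s)))
    fun w => rfl
  have htr : LinearMap.trace ℝ _ (curvOperator (chartConn g c) (jointMap φ c y (φ x, s))
      (jointField φ c y ν (φ x, s))) = ricci g (y x s) (ν x s) (ν x s) := by
    rw [← trace_curvOperator, ← hcdef]
    have e1 : jointMap φ c y (φ x, s) = c (y x s) := by
      simp only [jointMap, localMap, φ.left_inv hx]
    have e2 : jointField φ c y ν (φ x, s) = coords c (y x s) (ν x s) := by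
      simp only [jointField, localField]
      rw [φ.left_inv hx]
      rfl
    rw [e1, e2]
  rw [htr, hK] at hle
  refine ⟨_, ?_, hle⟩
  have hd := (hF.smooth_speed.diffAt hF.isOpen hq).hasFDerivAt.comp_hasDerivAt s
    ((hasDerivAt_const s (φ x)).prodMk (hasDerivAt_id s))
  refine hd.congr_of_eventuallyEq (Filter.Eventually.of_forall fun s' => ?_)
  exact (hK s').symm

end IsMeanCurvatureFlow

end EvolutionOfMeanCurvature

/-! ### The maximum principle on a compact space. -/

section MaximumPrinciple

variable {S : Type*} [TopologicalSpace S] [CompactSpace S]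

/-- A function that decreases fast enough at its large spatial maxima stays below the corresponding
exponential barrier. -/
theorem le_exp_of_deriv_le {a b κ C r : ℝ} (hab : a < b) {K : S → ℝ → ℝ}
    (hcont : ContinuousOn (fun z : S × ℝ => K z.1 z.2) (univ ×ˢ Icc a b))
    (hC : 0 ≤ C) (hinit : ∀ x, K x a ≤ κ + C)
    (hder : ∀ x, ∀ s ∈ Ioo a b, (∀ x', K x' s ≤ K x s) → κ < K x s →
      ∃ d, HasDerivAt (K x) d s ∧ d < -r * (K x s - κ)) (x : S) {s : ℝ} (hs : s ∈ Icc a b) :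
    K x s ≤ κ + Real.exp (-r * (s - a)) * C := by
  have hslice : ∀ x, ContinuousOn (K x) (Icc a b) := fun x =>
    hcont.comp (f := fun s => (x, s)) (by fun_prop) fun s hs => ⟨mem_univ _, hs⟩
  -- Raising the barrier by `ε` makes the initial inequality strict. The time `b` is excluded since
  -- derivatives are controlled only in the open interval.
  have key : ∀ ε > 0, ∀ x, ∀ s ∈ Ico a b, K x s < κ + Real.exp (-r * (s - a)) * (C + ε) := by
    intro ε hε
    set β : ℝ → ℝ := fun s => κ + Real.exp (-r * (s - a)) * (C + ε) with hβ
    have hβd : ∀ s, HasDerivAt β (-r * (β s - κ)) s := fun s => by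
      have h1 : HasDerivAt (fun s : ℝ => -r * (s - a)) (-r) s := by
        simpa using ((hasDerivAt_id s).sub_const a).const_mul (-r)
      have h2 : HasDerivAt β _ s := (h1.exp.mul_const (C + ε)).const_add κ
      refine h2.congr_deriv ?_
      simp only [hβ]
      ring
    have hβc : Continuous β := continuous_iff_continuousAt.mpr fun s => (hβd s).continuousAt
    by_contra! hcon
    obtain ⟨x₁, s₁, hs₁, hx₁⟩ := hcon
    have hsub : Icc a s₁ ⊆ Icc a b := Icc_subset_Icc_right hs₁.2.le
    -- The set where the barrier is reached; by compactness it has an earliest time `s₀`.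
    let Z : Set (S × ℝ) := {z | z ∈ univ ×ˢ Icc a s₁ ∧ β z.2 ≤ K z.1 z.2}
    have hZc : IsCompact Z := by
      have hclosed : IsClosed Z := by
        have : ContinuousOn (fun z : S × ℝ => K z.1 z.2 - β z.2) (univ ×ˢ Icc a s₁) :=
          (hcont.mono (prod_mono_right hsub)).sub (hβc.comp continuous_snd).continuousOn
        have h2 := this.preimage_isClosed_of_isClosed (isClosed_univ.prod isClosed_Icc)
          (isClosed_Ici (a := (0 : ℝ)))
        convert h2 using 1
        ext z
        simp [Z]
      exact (isCompact_univ.prod isCompact_Icc).of_isClosed_subset hclosed fun z hz => hz.1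
    obtain ⟨⟨x₀, s₀⟩, hz₀, hmin⟩ := hZc.exists_isMinOn (f := Prod.snd)
      ⟨(x₁, s₁), ⟨⟨mem_univ _, right_mem_Icc.mpr hs₁.1⟩, hx₁⟩⟩ continuous_snd.continuousOn
    have hs₀ : s₀ ∈ Icc a s₁ := hz₀.1.2
    have htouch : β s₀ ≤ K x₀ s₀ := hz₀.2
    have hbefore : ∀ x, ∀ s ∈ Ico a s₀, K x s < β s := by
      intro x s hs
      by_contra! hle
      have := hmin (a := (x, s)) ⟨⟨mem_univ _, hs.1, hs.2.le.trans hs₀.2⟩, hle⟩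
      exact absurd hs.2 (not_lt.mpr this)
    have has₀ : a < s₀ := by
      refine lt_of_le_of_ne hs₀.1 fun heq => ?_
      rw [← heq] at htouch
      have h1 : β a = κ + (C + ε) := by simp [hβ]
      have := hinit x₀
      linarith
    have hs₀b : s₀ ∈ Ioo a b := ⟨has₀, hs₀.2.trans_lt hs₁.2⟩
    -- Limit from earlier times. It makes `x₀` a spatial maximum at time `s₀`, so that `hder`
    -- applies there.
    have hle : ∀ x, K x s₀ ≤ β s₀ := by
      intro x
      have h1 : ContinuousWithinAt (K x) (Ico a s₀) s₀ :=
        (hslice x s₀ (hsub hs₀)).mono fun s hs => ⟨hs.1, hs.2.le.trans (hsub hs₀).2⟩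
      refine ContinuousWithinAt.closure_le (s := Ico a s₀) ?_ h1
        hβc.continuousWithinAt fun s hs => (hbefore x s hs).le
      rw [closure_Ico has₀.ne]
      exact right_mem_Icc.mpr has₀.le
    have heq : K x₀ s₀ = β s₀ := le_antisymm (hle x₀) htouch
    have hκ : κ < K x₀ s₀ := by
      rw [heq]
      have : 0 < Real.exp (-r * (s₀ - a)) * (C + ε) := by positivity
      simp only [hβ]
      linarith
    obtain ⟨d, hd, hdlt⟩ := hder x₀ s₀ hs₀b (fun x' => heq ▸ hle x') hκ
    have hdiff : HasDerivAt (fun s => K x₀ s - β s) (d - -r * (β s₀ - κ)) s₀ := hd.sub (hβd s₀)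
    -- `K x₀ - β` is negative before `s₀` and zero at `s₀`, so its left difference quotients are
    -- positive; this contradicts the strict inequality for `d`.
    have hnonneg : 0 ≤ d - -r * (β s₀ - κ) := by
      have h1 : HasDerivWithinAt (fun s => K x₀ s - β s) (d - -r * (β s₀ - κ)) (Iio s₀) s₀ :=
        hdiff.hasDerivWithinAt
      have h2 := (hasDerivWithinAt_iff_tendsto_slope' (by simp)).mp h1
      refine ge_of_tendsto h2 ?_
      filter_upwards [Ioo_mem_nhdsLT has₀] with s hs
      have h3 := hbefore x₀ s ⟨hs.1.le, hs.2⟩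
      rw [slope_def_field, heq]
      apply div_nonneg_of_nonpos
      · linarith
      · linarith [hs.2]
    rw [heq] at hdlt
    linarith
  have key' : ∀ ε > 0, ∀ x, ∀ s ∈ Icc a b, K x s ≤ κ + Real.exp (-r * (s - a)) * (C + ε) := by
    intro ε hε x s hs
    have hmem : s ∈ closure (Ico a b) := by rwa [closure_Ico hab.ne]
    refine ContinuousWithinAt.closure_le (s := Ico a b) (f := K x)
      (g := fun s => κ + Real.exp (-r * (s - a)) * (C + ε)) hmem
      ((hslice x s hs).mono Ico_subset_Icc_self) ?_ fun s hs => (key ε hε x s hs).le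
    exact Continuous.continuousWithinAt (by fun_prop)
  have hlim : Filter.Tendsto (fun ε : ℝ => κ + Real.exp (-r * (s - a)) * (C + ε)) (𝓝[>] 0)
      (𝓝 (κ + Real.exp (-r * (s - a)) * C)) := by
    have : Continuous fun ε : ℝ => κ + Real.exp (-r * (s - a)) * (C + ε) := by fun_prop
    have h1 := (this.tendsto 0).mono_left (nhdsWithin_le_nhds (s := Ioi 0))
    simpa using h1
  refine ge_of_tendsto hlim ?_
  filter_upwards [self_mem_nhdsWithin] with ε hε using key' ε hε x s hs

end MaximumPrinciple

end LorentzMCF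

end

/-! ### The decay estimate. -/

theorem theorem2 (n : ℕ) (hn : 2 ≤ n)
    {M : Type*} [TopologicalSpace M] [T2Space M]
    [ChartedSpace (EuclideanSpace ℝ (Fin (n + 1))) M] [IsManifold (𝓡 (n + 1)) ∞ M]
    (g : LorentzMCF.LorentzianMetric (n + 1) M) (τ : LorentzMCF.TimeOrientation g)
    (G Λ : ℝ) (hG : 0 < G) (hΛ : 0 < Λ)
    (T : ∀ p : M, TangentSpace (𝓡 (n + 1)) p →L[ℝ] TangentSpace (𝓡 (n + 1)) p →L[ℝ] ℝ)
    (hEinstein : LorentzMCF.EinsteinEquations g G Λ T)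
    (hSEC : LorentzMCF.StrongEnergyCondition τ T)
    {S : Type*} [TopologicalSpace S] [T2Space S] [CompactSpace S]
    [ChartedSpace (EuclideanSpace ℝ (Fin n)) S] [IsManifold (𝓡 n) ∞ S]
    (l₁ l₂ : ℝ) (hl : l₁ ≤ l₂)
    (y : S → ℝ → M) (ν : ∀ (x : S) (s : ℝ), TangentSpace (𝓡 (n + 1)) (y x s))
    (hflow : LorentzMCF.IsMeanCurvatureFlow τ l₁ l₂ y ν)
    (K : S → ℝ → ℝ)
    (hK : ∀ x s, K x s = LorentzMCF.meanCurvature g n (fun x' => y x' s) (fun x' => ν x' s) x)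
    (hbig : ∃ x : S, ∃ s ∈ Set.Icc l₁ l₂, LorentzMCF.cosmologicalK n G Λ < K x s)
    (Km : ℝ → ℝ) (hKm : ∀ s, Km s = ⨆ x : S, K x s) :
    (∀ s ∈ Set.Icc l₁ l₂, IsGreatest (Set.range fun x : S => K x s) (Km s)) ∧
      Km l₂ ≤ LorentzMCF.cosmologicalK n G Λ +
        Real.exp (-(2 / (n : ℝ)) * LorentzMCF.cosmologicalK n G Λ ^ 2 * (l₂ - l₁)) *
          (Km l₁ - LorentzMCF.cosmologicalK n G Λ) := by
  open LorentzMCF in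
  obtain ⟨x₀, s₀, hs₀, hbig⟩ := hbig
  have hKs : ∀ s, (fun x => K x s) = meanCurvature g n (fun x' => y x' s) (fun x' => ν x' s) :=
    fun s => funext fun x => hK x s
  have hgreat : ∀ s ∈ Icc l₁ l₂, IsGreatest (range fun x : S => K x s) (Km s) := by
    intro s hs
    have hcont : Continuous fun x : S => K x s := by
      rw [hKs]
      exact continuous_meanCurvature (hflow.smooth_slice hs) (hflow.spacelike s hs)
        (hflow.normal s hs)
    rw [hKm]
    exact (isCompact_range hcont).isGreatest_sSup ⟨_, x₀, rfl⟩
  refine ⟨hgreat, ?_⟩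
  -- For `λ₁ = λ₂` the exponential is `1` and the estimate is an equality.
  rcases hl.eq_or_lt with rfl | hlt
  · simp
  set κ := cosmologicalK n G Λ with hκ
  have hκpos : 0 < κ := cosmologicalK_pos hn hG hΛ
  have hnpos : (0 : ℝ) < n := by exact_mod_cast (by omega : 0 < n)
  have hcont : ContinuousOn (fun z : S × ℝ => K z.1 z.2) (univ ×ˢ Icc l₁ l₂) := by
    simp only [hK]
    exact hflow.continuousOn_meanCurvature hlt
  have hder : ∀ x, ∀ s ∈ Ioo l₁ l₂, (∀ x', K x' s ≤ K x s) → κ < K x s →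
      ∃ d, HasDerivAt (K x) d s ∧ d < -(2 / (n : ℝ) * κ ^ 2) * (K x s - κ) := by
    intro x s hs hmax hlarge
    obtain ⟨d, hd, hle⟩ := hflow.exists_hasDerivAt_le (x := x) hs
      (fun x' => by rw [← hK, ← hK]; exact hmax x') (by rw [← hK]; linarith)
    have hN := hflow.normal s (Ioo_subset_Icc_self hs)
    have hric := ricci_ge_of_einstein hn g τ hG hΛ T hEinstein hSEC (y x s) (ν x s)
      (hN.future x) (hN.unit x)
    refine ⟨d, ?_, ?_⟩
    · have e : K x = fun s' => meanCurvature g n (fun x' => y x' s') (fun x' => ν x' s') x :=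
        funext fun s' => hK x s'
      rwa [e]
    · rw [← hK] at hle
      have h1 : K x s * (K x s ^ 2 / n - κ ^ 2 / n) ≤
          K x s * (K x s ^ 2 / n + ricci g (y x s) (ν x s) (ν x s)) :=
        mul_le_mul_of_nonneg_left (by linarith) (by linarith)
      -- The remainder factors with a double root at `κ`; its positivity supplies the strict
      -- inequality that the maximum principle requires.
      have h2 : K x s * (K x s ^ 2 / n - κ ^ 2 / n) - 2 / n * κ ^ 2 * (K x s - κ) =
          (K x s - κ) ^ 2 * (K x s + 2 * κ) / n := by
        field_simp
        ring
      have h3 : 0 < (K x s - κ) ^ 2 * (K x s + 2 * κ) / n := by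
        have : 0 < K x s - κ := by linarith
        have : 0 < K x s + 2 * κ := by linarith
        positivity
      linarith
  have hbound := fun (C : ℝ) hC hinit (x : S) (s : ℝ) (hs : s ∈ Icc l₁ l₂) =>
    le_exp_of_deriv_le (C := C) hlt hcont hC hinit hder x hs
  -- Otherwise `C = 0` is an admissible constant and gives `K ≤ κ` throughout, contradicting the
  -- point `(x₀, s₀)`.
  have hC : 0 ≤ Km l₁ - κ := by
    by_contra! hneg
    have := hbound 0 le_rfl (fun x => by
      have := (hgreat l₁ (left_mem_Icc.mpr hl)).2 ⟨x, rfl⟩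
      simp only at this
      linarith) x₀ s₀ hs₀
    linarith
  obtain ⟨x₂, hx₂⟩ := (hgreat l₂ (right_mem_Icc.mpr hl)).1
  have := hbound (Km l₁ - κ) hC (fun x => by
      have := (hgreat l₁ (left_mem_Icc.mpr hl)).2 ⟨x, rfl⟩
      simp only at this
      linarith) x₂ l₂ (right_mem_Icc.mpr hl)
  simp only at hx₂
  rw [hx₂] at this
  rwa [neg_mul]
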